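/- Let $(R,\mathfrak m,k)$ be a Noetherian local ring, let $S=R[X_1,\dots,X_n]$ ($n\ge 0$) be a polynomial ring, $\mathbb Z$-graded with $R$ in degree $0$ and $\deg X_j>0$ for all $j$, and let $\mathbb M$ be a finitely generated $\mathbb Z$-graded $S$-module. Put $S_+=(X_1,\dots,X_n)$, and let $M=\mathbb M\otimes_R k$ with the induced $S$-module structure and grading. For an $S$-module $N$, $H^i_{S_+}(N)$ denotes the $i$-th cohomology of the Čech complex with terms $\mathcal C^0=N$ and $\mathcal C^i=\bigoplus_{j_1<\dots<j_i}N_{X_{j_1}\cdots X_{j_i}}$; it is graded if $N$ is. Let $\operatorname{cd}_{S_+}(N)=\sup\{i : H^i_{S_+}(N)\ne 0\}$ ($-\infty$ if there is no such $i$). For a graded $S$-module $N$ let $$a^i(N)=\sup\{\mu\in\mathbb Z : H^i_{S_+}(N)_\mu\neq 0\}$$ ($-\infty$ if there is no such $\mu$) and $\operatorname{reg}(N)=\max_i\{a^i(N)+i\}$. Let $\operatorname{depth}_{S_+}(\mathbb M)$ be the supremum of the lengths of $\mathbb M$-regular sequences in $S_+$ ($\infty$ if $\mathbb M=0$). The module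 $\operatorname{Tor}_1^R(\mathbb M,k)$ carries the $S$-module structure inherited from $\mathbb M$. (i) Assume $\mathbb M\neq 0$. Then $d:=\dim M$ is a non-negative integer, the natural graded map $H^d_{S_+}(\mathbb M)\otimes_R k\to H^d_{S_+}(M)$ is an isomorphism of graded modules, and $d=\max\{i : H^i_{S_+}(\mathbb M)\neq 0\}$; so $H^i_{S_+}(\mathbb M)=0$ for all $i>d$. In particular $a^d(\mathbb M)=a^d(M)\in\mathbb Z$. (ii) Let $\mu$ and $\ell$ be integers. If $\operatorname{cd}_{S_+}(\operatorname{Tor}_1^R(\mathbb M,k))\le \ell+1$, then $$H^i_{S_+}(\mathbb M)_\mu=0\ \text{ for all } i\ge\ell\quad\Longrightarrow\quad H^i_{S_+}(M)_\mu=0\ \text{ for all } i\ge\ell ,$$ and the two conditions are equivalent if $\operatorname{cd}_{S_+}(\operatorname{Tor}_1^R(\mathbb M,k))\le \ell$. In particular, if $\operatorname{cd}_{S_+}(\operatorname{Tor}_1^R(\mathbb M,k))\le 1$, then $\operatorname{reg}(M)\le\operatorname{reg}(\mathbb M)$, and equality holds if moreover $\operatorname{depth}_{S_+}(\mathbb M)>0$.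 -/

import Mathlib

open scoped TensorProduct

universe u v

noncomputable section

namespace LocalCoh

/-- The variables of the polynomial ring `R[X_0, …, X_{n-1}]`. -/
abbrev vars (R : Type*) [CommRing R] (n : ℕ) : Fin n → MvPolynomial (Fin n) R := MvPolynomial.X

section Cech

variable {S : Type*} [CommRing S] {n : ℕ} (x : Fin n → S)
variable (M : Type*) [AddCommGroup M] [Module S M]
variable {N : Type*} [AddCommGroup N] [Module S N]

/-- The submonoid of powers of `∏ j ∈ J, x j`. -/
abbrev prodPowers (J : Finset (Fin n)) : Submonoid S := Submonoid.powers (∏ j ∈ J, x j)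

/-- The localization of `M` at the product of the `x j`, `j ∈ J`. -/
abbrev Loc (J : Finset (Fin n)) : Type _ := LocalizedModule (prodPowers x J) M

theorem isUnit_of_subset {J J' : Finset (Fin n)} (h : J ⊆ J') (s : prodPowers x J) :
    IsUnit (algebraMap S (Module.End S (Loc x M J')) s) := by
  obtain ⟨s, e, rfl⟩ := s
  have h1 : IsUnit (algebraMap S (Module.End S (Loc x M J')) (∏ j ∈ J', x j)) :=
    IsLocalizedModule.map_units (S := prodPowers x J')
      (LocalizedModule.mkLinearMap (prodPowers x J') M) ⟨_, Submonoid.mem_powers _⟩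
  rw [← Finset.prod_sdiff h, map_mul] at h1
  have h2 : Commute (algebraMap S (Module.End S (Loc x M J')) (∏ j ∈ J' \ J, x j))
      (algebraMap S (Module.End S (Loc x M J')) (∏ j ∈ J, x j)) :=
    Algebra.commutes _ _
  simpa only [map_pow] using ((h2.isUnit_mul_iff.mp h1).2).pow e

/-- The canonical map between localizations, for `J ⊆ J'`. -/
def res {J J' : Finset (Fin n)} (h : J ⊆ J') : Loc x M J →ₗ[S] Loc x M J' :=
  LocalizedModule.lift (prodPowers x J) (LocalizedModule.mkLinearMap (prodPowers x J') M)
    (isUnit_of_subset x M h)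

theorem res_mk {J J' : Finset (Fin n)} (h : J ⊆ J') (m : M) :
    res x M h (LocalizedModule.mkLinearMap (prodPowers x J) M m) =
      LocalizedModule.mkLinearMap (prodPowers x J') M m :=
  LinearMap.congr_fun (LocalizedModule.lift_comp (prodPowers x J)
    (LocalizedModule.mkLinearMap (prodPowers x J') M) (isUnit_of_subset x M h)) m

/-- The `i`-th term of the Čech complex: the sum of the localizations of `M` at the products of
`i` of the elements `x j`. For `i = 0` this is `M` (localized at `1`). -/
abbrev Cochain (i : ℕ) : Type _ := ∀ J : {J : Finset (Fin n) // J.card = i}, Loc x M J.1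

theorem card_erase {i : ℕ} (J : {J : Finset (Fin n) // J.card = i + 1}) (j : J.1) :
    (J.1.erase j.1).card = i := by
  rw [Finset.card_erase_of_mem j.2, J.2, Nat.add_sub_cancel]

/-- The Čech differential, with the usual sign given by the position of the omitted index. -/
def d (i : ℕ) : Cochain x M i →ₗ[S] Cochain x M (i + 1) :=
  LinearMap.pi fun J => ∑ j : J.1, ((-1 : S) ^ (J.1.filter (· < j.1)).card) •
    (res x M (J.1.erase_subset j.1) ∘ₗ
      LinearMap.proj (⟨J.1.erase j.1, card_erase J j⟩ : {J : Finset (Fin n) // J.card = i}))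

theorem d_apply (i : ℕ) (c : Cochain x M i) (J : {J : Finset (Fin n) // J.card = i + 1}) :
    d x M i c J = ∑ j : J.1, ((-1 : S) ^ (J.1.filter (· < j.1)).card) •
      res x M (J.1.erase_subset j.1) (c ⟨J.1.erase j.1, card_erase J j⟩) := by
  simp [d]

/-- The image in degree `i` of the incoming differential (zero for `i = 0`). -/
def boundaries : (i : ℕ) → Submodule S (Cochain x M i)
  | 0 => ⊥
  | i + 1 => LinearMap.range (d x M i)

/-- The `i`-th cohomology module of the Čech complex of `M` with respect to `x`. -/
abbrev Coh (i : ℕ) : Type _ :=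
  LinearMap.ker (d x M i) ⧸ (boundaries x M i).submoduleOf (LinearMap.ker (d x M i))

variable {M}

/-- Functoriality of the terms of the Čech complex. -/
def cochainMap (f : M →ₗ[S] N) (i : ℕ) : Cochain x M i →ₗ[S] Cochain x N i :=
  LinearMap.pi fun J =>
    IsLocalizedModule.map (prodPowers x J.1) (LocalizedModule.mkLinearMap (prodPowers x J.1) M)
      (LocalizedModule.mkLinearMap (prodPowers x J.1) N) f ∘ₗ LinearMap.proj J

theorem res_map {J J' : Finset (Fin n)} (h : J ⊆ J') (f : M →ₗ[S] N) (z : Loc x M J) :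
    res x N h (IsLocalizedModule.map (prodPowers x J) (LocalizedModule.mkLinearMap _ M)
      (LocalizedModule.mkLinearMap _ N) f z) =
    IsLocalizedModule.map (prodPowers x J') (LocalizedModule.mkLinearMap _ M)
      (LocalizedModule.mkLinearMap _ N) f (res x M h z) := by
  have : res x N h ∘ₗ (IsLocalizedModule.map (prodPowers x J) (LocalizedModule.mkLinearMap _ M)
      (LocalizedModule.mkLinearMap _ N) f) =
    (IsLocalizedModule.map (prodPowers x J') (LocalizedModule.mkLinearMap _ M)
      (LocalizedModule.mkLinearMap _ N) f) ∘ₗ res x M h := by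
    apply IsLocalizedModule.ext (prodPowers x J) (LocalizedModule.mkLinearMap (prodPowers x J) M)
      (isUnit_of_subset x N h)
    ext m
    have h1 : ∀ (K : Finset (Fin n)) (m : M), IsLocalizedModule.map (prodPowers x K)
        (LocalizedModule.mkLinearMap _ M) (LocalizedModule.mkLinearMap _ N) f
        (LocalizedModule.mkLinearMap (prodPowers x K) M m) =
        LocalizedModule.mkLinearMap (prodPowers x K) N (f m) := fun K m =>
      IsLocalizedModule.map_apply _ _ _ f m
    simp only [LinearMap.comp_apply, h1, res_mk]
  exact LinearMap.congr_fun this z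

theorem d_cochainMap (f : M →ₗ[S] N) (i : ℕ) (c : Cochain x M i) :
    d x N i (cochainMap x f i c) = cochainMap x f (i + 1) (d x M i c) := by
  funext J
  simp [d_apply, cochainMap, res_map]

theorem cochainMap_mem_ker (f : M →ₗ[S] N) (i : ℕ) :
    ∀ c ∈ LinearMap.ker (d x M i), cochainMap x f i c ∈ LinearMap.ker (d x N i) := by
  intro c hc
  rw [LinearMap.mem_ker] at hc ⊢
  rw [d_cochainMap, hc, map_zero]

/-- Functoriality of Čech cohomology. -/
def cohMap (f : M →ₗ[S] N) (i : ℕ) : Coh x M i →ₗ[S] Coh x N i :=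
  Submodule.mapQ _ _ ((cochainMap x f i).restrict (cochainMap_mem_ker x f i)) (by
    rintro ⟨c, hc⟩ h
    rw [Submodule.mem_comap]
    change c ∈ boundaries x M i at h
    change cochainMap x f i c ∈ boundaries x N i
    cases i with
    | zero =>
      have h0 : c = 0 := h
      subst h0
      exact map_zero _
    | succ i =>
      obtain ⟨b, hb⟩ := h
      exact ⟨cochainMap x f i b, by rw [d_cochainMap, hb]⟩)

theorem res_res {J J' J'' : Finset (Fin n)} (h : J ⊆ J') (h' : J' ⊆ J'') (z : Loc x M J) :
    res x M h' (res x M h z) = res x M (h.trans h') z := by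
  have : res x M h' ∘ₗ res x M h = res x M (h.trans h') := by
    apply IsLocalizedModule.ext (prodPowers x J) (LocalizedModule.mkLinearMap (prodPowers x J) M)
      (isUnit_of_subset x M (h.trans h'))
    ext m
    simp only [LinearMap.comp_apply, res_mk]
  exact LinearMap.congr_fun this z

theorem res_congr {i : ℕ} (c : Cochain x M i) {J : Finset (Fin n)}
    {K L : {J : Finset (Fin n) // J.card = i}} (e : K = L) (hK : K.1 ⊆ J) (hL : L.1 ⊆ J) :
    res x M hK (c K) = res x M hL (c L) := by
  subst e; rfl

/-- The Čech differentials compose to zero. -/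
theorem d_comp_d (i : ℕ) (c : Cochain x M i) : d x M (i + 1) (d x M i c) = 0 := by
  funext J
  rw [d_apply]
  simp only [d_apply, map_sum, map_smul, res_res, Finset.smul_sum, smul_smul]
  rw [Finset.sum_sigma']
  refine Finset.sum_involution
    (fun p _ => ⟨⟨p.2.1, Finset.mem_of_mem_erase p.2.2⟩,
      ⟨p.1.1, Finset.mem_erase.2 ⟨(Finset.ne_of_mem_erase p.2.2).symm, p.1.2⟩⟩⟩) ?_ ?_ ?_ ?_
  · rintro ⟨⟨a, ha⟩, ⟨b, hb⟩⟩ -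
    have hba : b ≠ a := Finset.ne_of_mem_erase hb
    have hbJ := Finset.mem_of_mem_erase hb
    dsimp only
    rw [res_congr x c (Subtype.ext (Finset.erase_right_comm) :
      (⟨(J.1.erase b).erase a, _⟩ : {J : Finset (Fin n) // J.card = i}) =
        ⟨(J.1.erase a).erase b, card_erase ⟨J.1.erase a, card_erase J ⟨a, ha⟩⟩ ⟨b, hb⟩⟩) _
        ((Finset.erase_subset _ _).trans (Finset.erase_subset _ _)), ← add_smul]
    convert zero_smul S _
    rw [Finset.filter_erase, Finset.filter_erase]
    rcases lt_or_gt_of_ne hba with h | h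
    · have h1 : a ∉ J.1.filter (· < b) := by simp [h.le]
      have h2 : b ∈ J.1.filter (· < a) := by simp [h, hbJ]
      rw [Finset.erase_eq_of_notMem h1, ← Finset.card_erase_add_one h2]
      ring
    · have h1 : b ∉ J.1.filter (· < a) := by simp [h.le]
      have h2 : a ∈ J.1.filter (· < b) := by simp [h, ha]
      rw [Finset.erase_eq_of_notMem h1, ← Finset.card_erase_add_one h2]
      ring
  · rintro ⟨⟨a, ha⟩, ⟨b, hb⟩⟩ - - h
    have hba : b ≠ a := Finset.ne_of_mem_erase hb
    simp only [Sigma.mk.injEq, Subtype.mk.injEq] at h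
    exact hba h.1
  · intros; simp
  · intros; rfl

theorem cohMap_mk (f : M →ₗ[S] N) (i : ℕ) (c : LinearMap.ker (d x M i)) :
    cohMap x f i (Submodule.Quotient.mk c) =
      Submodule.Quotient.mk ⟨cochainMap x f i c.1, cochainMap_mem_ker x f i c.1 c.2⟩ := rfl

theorem cohMap_add (f g : M →ₗ[S] N) (i : ℕ) (c : Coh x M i) :
    cohMap x (f + g) i c = cohMap x f i c + cohMap x g i c := by
  obtain ⟨c, rfl⟩ := Submodule.Quotient.mk_surjective _ c
  simp only [cohMap_mk, ← Submodule.Quotient.mk_add]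
  congr 1
  ext J
  simp [cochainMap]

theorem cohMap_smul (s : S) (f : M →ₗ[S] N) (i : ℕ) (c : Coh x M i) :
    cohMap x (s • f) i c = s • cohMap x f i c := by
  obtain ⟨c, rfl⟩ := Submodule.Quotient.mk_surjective _ c
  simp only [cohMap_mk, ← Submodule.Quotient.mk_smul]
  congr 1
  ext J
  simp [cochainMap]

end Cech

section Invariants

variable {S : Type*} [CommRing S] {n : ℕ} (x : Fin n → S)
variable (M : Type*) [AddCommGroup M] [Module S M]

/-- The cohomological dimension: the supremum of the `i` for which the `i`-th cohomology module is
nonzero, and `-∞` if all of them vanish. -/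
def cd : EReal := ⨆ (i : ℕ) (_ : Nontrivial (Coh x M i)), (i : EReal)

/-- The depth of `M` with respect to an ideal `I`: the supremum of the lengths of the `M`-regular
sequences in `I`. Weakly regular sequences are regular if `I • M ≠ M`; they give the usual
convention that the depth is `∞` for `M = 0`. -/
def depth (I : Ideal S) : ℕ∞ :=
  ⨆ (rs : List S) (_ : (∀ r ∈ rs, r ∈ I) ∧ RingTheory.Sequence.IsWeaklyRegular M rs),
    (rs.length : ℕ∞)

end Invariants

section Graded

variable {R : Type*} {S : Type*} [CommRing R] [CommRing S] [Algebra R S]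
variable {n : ℕ} (x : Fin n → S) (w : Fin n → ℤ)
variable {M : Type*} [AddCommGroup M] [Module R M] [Module S M] [IsScalarTower R S M]
variable (𝓜 : ℤ → Submodule R M)

/-- The degree `μ` part of the localization of a graded module at a product of the homogeneous
elements `x j` of degrees `w j`: the fractions `m / (∏ j ∈ J, x j) ^ e` with `m` homogeneous of
degree `μ + e * ∑ j ∈ J, w j`. -/
def locDeg (J : Finset (Fin n)) (μ : ℤ) : Submodule R (Loc x M J) :=
  Submodule.span R {z | ∃ e : ℕ, ∃ m ∈ 𝓜 (μ + e * ∑ j ∈ J, w j),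
    z = LocalizedModule.mk m (⟨(∏ j ∈ J, x j) ^ e, e, rfl⟩ : prodPowers x J)}

/-- The degree `μ` part of the `i`-th term of the Čech complex. -/
def cochainDeg (i : ℕ) (μ : ℤ) : Submodule R (Cochain x M i) :=
  Submodule.pi Set.univ fun J => locDeg x w 𝓜 J.1 μ

/-- The degree `μ` part of Čech cohomology: the classes of the cocycles of degree `μ`. -/
def cohDeg (i : ℕ) (μ : ℤ) : Submodule R (Coh x M i) :=
  ((cochainDeg x w 𝓜 i μ).comap ((LinearMap.ker (d x M i)).subtype.restrictScalars R)).map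
    (((boundaries x M i).submoduleOf (LinearMap.ker (d x M i))).mkQ.restrictScalars R)

/-- The invariant `a^i`: the supremum of the degrees in which the `i`-th cohomology module is
nonzero, and `-∞` if there are none. -/
def aInv (i : ℕ) : EReal := ⨆ (μ : ℤ) (_ : cohDeg x w 𝓜 i μ ≠ ⊥), ((μ : ℝ) : EReal)

/-- The Castelnuovo-Mumford regularity: the maximum of the `a^i + i`. -/
def reg : EReal := ⨆ i : ℕ, aInv x w 𝓜 i + (i : EReal)

end Graded

section Tensor

variable {R : Type*} {S : Type*} [CommRing R] [CommRing S] [Algebra R S]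
variable {n : ℕ} (x : Fin n → S)
variable {M : Type*} [AddCommGroup M] [Module R M]
variable (N : Type*) [AddCommGroup N] [Module R N]

/-- The grading of `M ⊗[R] N` induced by a grading of `M`, with `N` placed in degree `0`: the
degree `μ` part is the image of `𝓜 μ ⊗[R] N`. -/
def tensorDeg (𝓜 : ℤ → Submodule R M) (μ : ℤ) : Submodule R (M ⊗[R] N) :=
  LinearMap.range ((𝓜 μ).subtype.rTensor N)

variable (M) [Module S M] [IsScalarTower R S M] {N}

/-- The `S`-linear map `m ↦ m ⊗ y`. -/
def tmulRight (y : N) : M →ₗ[S] M ⊗[R] N where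
  toFun m := m ⊗ₜ[R] y
  map_add' a b := TensorProduct.add_tmul a b y
  map_smul' _ _ := rfl

variable (N)

/-- The natural map from `H^i(M) ⊗[R] N` to `H^i(M ⊗[R] N)`, which sends `c ⊗ y` to the image
of `c` under the map induced by `m ↦ m ⊗ y`. -/
def comparison (i : ℕ) : Coh x M i ⊗[R] N →ₗ[S] Coh x (M ⊗[R] N) i :=
  TensorProduct.AlgebraTensorModule.lift
    { toFun := fun c =>
        { toFun := fun y => cohMap x (tmulRight M y) i c
          map_add' := fun y z => by
            rw [← cohMap_add]
            congr 2
            refine LinearMap.ext fun m => ?_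
            exact TensorProduct.tmul_add m y z
          map_smul' := fun r y => by
            have h : tmulRight (R := R) (S := S) M (r • y) =
                algebraMap R S r • tmulRight (R := R) (S := S) M y := by
              refine LinearMap.ext fun m => ?_
              change m ⊗ₜ[R] (r • y) = algebraMap R S r • (m ⊗ₜ[R] y)
              rw [TensorProduct.tmul_smul, algebraMap_smul]
            rw [RingHom.id_apply, h, cohMap_smul, algebraMap_smul] }
      map_add' := fun a b => by
        ext y
        exact map_add (cohMap x (tmulRight (R := R) (S := S) M y) i) a b
      map_smul' := fun s a => by
        ext y
        exact map_smul (cohMap x (tmulRight (R := R) (S := S) M y) i) s a }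

theorem comparison_tmul (i : ℕ) (c : Coh x M i) (y : N) :
    comparison x M N i (c ⊗ₜ[R] y) = cohMap x (tmulRight M y) i c := rfl

end Tensor

section Tor

open CategoryTheory

variable (R : Type u) (S : Type u) [CommRing R] [CommRing S] [Algebra R S]
variable (M : Type v) [AddCommGroup M] [Module R M] [Module S M] [IsScalarTower R S M]

/-- The functor `M ⊗[R] -` from `R`-modules to `S`-modules, for an `S`-module `M`. -/
def tensorFunctor : ModuleCat.{u} R ⥤ ModuleCat.{max u v} S where
  obj N := ModuleCat.of S (M ⊗[R] N)
  map f := ModuleCat.ofHom (TensorProduct.AlgebraTensorModule.lTensor S M f.hom)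
  map_id N := by
    ext1
    exact TensorProduct.AlgebraTensorModule.lTensor_id
  map_comp f g := by
    ext1
    exact TensorProduct.AlgebraTensorModule.lTensor_comp _ _

instance : (tensorFunctor R S M).Additive where
  map_add {X Y f g} := by
    ext1
    refine LinearMap.ext fun z => ?_
    exact LinearMap.congr_fun (LinearMap.lTensor_add M f.hom g.hom) z

/-- `Tor_q^R(M, N)` with the `S`-module structure that it inherits from `M`: the `q`-th left
derived functor of `M ⊗[R] -`, that is, the homology of `M ⊗[R] P` for a projective resolution `P`
of `N` over `R`. -/
def tor (q : ℕ) (N : Type u) [AddCommGroup N] [Module R N] : ModuleCat.{max u v} S :=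
  ((tensorFunctor R S M).leftDerived q).obj (ModuleCat.of R N)

end Tor

end LocalCoh

end

/-! Write `S` for the polynomial ring, `k` for the residue field and `𝔪` for the maximal ideal of
`R`. No spectral sequence is used: everything is dimension shifting along short exact sequences, by
descending induction on the cohomological degree, which starts because the Čech complex stops at
`n`. Localization is exact, so short exact sequences of modules induce exact sequences of
cohomology. These are formulated for an idempotent operator on cochains (`CochainOp`), so that the
identity gives ungraded statements and the projection to degree `μ` gives graded ones.

Nakayama: since all weights are positive, every graded piece `H^i(M)_μ` is a finite `R`-module and
vanishes for large `μ` (`Grading.finBdd`). Let `a_1, …, a_r` generate `𝔪` and let `W` be the kernel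
of `M ⊗ R^r → M`, `m ⊗ y ↦ ∑ y_j a_j m`. If `H^{i+1}(W)` vanishes, then the kernel of `H^i(M) →
H^i(M ⊗ k)` is `𝔪 H^i(M)`. Thus vanishing for `M ⊗ k` gives vanishing for `M`
(`Grading.van_of_van_tensor`).

Part (i): `W` is supported inside the support of `M`, so its closed fibre is no larger than that of
`M`. With Grothendieck vanishing for `M ⊗ k`, descending induction gives `H^i(M) = 0` for `i > d =
dim (M ⊗ k)`, and in degree `d` the comparison map is bijective. That `H^d(M ⊗ k) ≠ 0` is
`exists_supportDim_eq_not_acyclic`. There, a longest possible chain of homogeneous regular elements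
in the annihilator `I` of `M ⊗ k` leads from `𝔪S` to an ideal `J` for which `I` lies in an
associated prime `Q` of `S / J`. Macaulay duality for the top cohomology of `k[X_1, …, X_n]`
descends to `S / J`; it forces the top cohomology of `S / Q` to be nonzero, and a nonzero map from
`M ⊗ k` to `S / Q` transfers this to `M ⊗ k`.

Part (ii): by a local criterion of flatness, over the closed fibre the support of every `Tor_1(M,
R^r / K)` lies in that of `Tor_1(M, k)`. The dimension of the latter is its cohomological dimension,
by the nonvanishing result of (i), so the cohomology of every `Tor_1(M, R^r / K)` vanishes above the
bound assumed for `Tor_1(M, k)` (`acyclic_torKer`). Presenting `X` as `R^r / K` then shifts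
vanishing in degree `μ` from `M` to `M ⊗ X` (`Grading.van_tensor`). For the converse, `W` is an
extension of `Tor_1(M, k)` by the image of `M ⊗ K` in `M ⊗ R^r`, where `K` is the module of
relations of the `a_j`, and Nakayama applies (`Grading.van_of_forall_van_tensor`). -/

noncomputable section

namespace LocalCoh

set_option linter.unusedSectionVars false

/-! ### Čech complexes: functoriality, exactness of the terms, torsion of the cohomology -/

section CechBasics

variable {S : Type*} [CommRing S] {n : ℕ} (x : Fin n → S)
variable {M N L : Type*} [AddCommGroup M] [Module S M] [AddCommGroup N] [Module S N]
  [AddCommGroup L] [Module S L]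

/-- The localization map. -/
abbrev toLoc (M : Type*) [AddCommGroup M] [Module S M] (J : Finset (Fin n)) : M →ₗ[S] Loc x M J :=
  LocalizedModule.mkLinearMap (prodPowers x J) M

/-- Functoriality of the localizations. -/
abbrev locMap (f : M →ₗ[S] N) (J : Finset (Fin n)) : Loc x M J →ₗ[S] Loc x N J :=
  IsLocalizedModule.map (prodPowers x J) (LocalizedModule.mkLinearMap (prodPowers x J) M)
      (LocalizedModule.mkLinearMap (prodPowers x J) N) f

/-- Together with `pow_smul_cancel` this reduces identities in a localization to identities in `M`:
choose a denominator, multiply by it and compare. -/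
theorem exists_pow_smul_eq_toLoc (J : Finset (Fin n)) (z : Loc x M J) :
    ∃ (e : ℕ) (m : M), (∏ j ∈ J, x j) ^ e • z = toLoc x M J m := by
  obtain ⟨⟨m, s⟩, h⟩ := IsLocalizedModule.surj (prodPowers x J) (toLoc x M J) z
  obtain ⟨s, e, rfl⟩ := s
  exact ⟨e, m, h⟩

theorem pow_smul_cancel {J : Finset (Fin n)} {e : ℕ} {z z' : Loc x M J}
    (h : (∏ j ∈ J, x j) ^ e • z = (∏ j ∈ J, x j) ^ e • z') : z = z' :=
  IsLocalizedModule.smul_injective (toLoc x M J)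
    (⟨(∏ j ∈ J, x j) ^ e, e, rfl⟩ : prodPowers x J) h

theorem exists_pow_smul_eq (J : Finset (Fin n)) (e : ℕ) (z : Loc x M J) :
    ∃ y : Loc x M J, (∏ j ∈ J, x j) ^ e • y = z := by
  have h := IsLocalizedModule.map_units (toLoc x M J)
    (⟨(∏ j ∈ J, x j) ^ e, e, rfl⟩ : prodPowers x J)
  exact ((Module.End.isUnit_iff _).1 h).2 z

theorem toLoc_eq_zero_iff {J : Finset (Fin n)} {m : M} :
    toLoc x M J m = 0 ↔ ∃ e : ℕ, (∏ j ∈ J, x j) ^ e • m = 0 := by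
  rw [IsLocalizedModule.eq_zero_iff (prodPowers x J)]
  constructor
  · rintro ⟨⟨_, e, rfl⟩, h⟩
    exact ⟨e, h⟩
  · rintro ⟨e, h⟩
    exact ⟨⟨_, e, rfl⟩, h⟩

theorem toLoc_eq_iff {J : Finset (Fin n)} {m m' : M} :
    toLoc x M J m = toLoc x M J m' ↔
      ∃ e : ℕ, (∏ j ∈ J, x j) ^ e • m = (∏ j ∈ J, x j) ^ e • m' := by
  rw [← sub_eq_zero, ← map_sub, toLoc_eq_zero_iff]
  simp only [smul_sub, sub_eq_zero]

theorem locMap_toLoc (f : M →ₗ[S] N) (J : Finset (Fin n)) (m : M) :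
    locMap x f J (toLoc x M J m) = toLoc x N J (f m) :=
  IsLocalizedModule.map_apply _ _ _ f m

theorem locMap_comp (f : M →ₗ[S] N) (g : N →ₗ[S] L) (J : Finset (Fin n)) (z : Loc x M J) :
    locMap x (g ∘ₗ f) J z = locMap x g J (locMap x f J z) := by
  obtain ⟨e, m, h⟩ := exists_pow_smul_eq_toLoc x J z
  apply pow_smul_cancel x (e := e)
  simp only [← map_smul, h, locMap_toLoc, LinearMap.comp_apply]

theorem locMap_id (J : Finset (Fin n)) (z : Loc x M J) :
    locMap x (LinearMap.id : M →ₗ[S] M) J z = z := by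
  obtain ⟨e, m, h⟩ := exists_pow_smul_eq_toLoc x J z
  apply pow_smul_cancel x (e := e)
  simp only [← map_smul, h, locMap_toLoc, LinearMap.id_apply]

theorem cochainMap_comp (f : M →ₗ[S] N) (g : N →ₗ[S] L) (i : ℕ) (c : Cochain x M i) :
    cochainMap x (g ∘ₗ f) i c = cochainMap x g i (cochainMap x f i c) :=
  funext fun J => locMap_comp x f g J.1 (c J)

theorem cochainMap_id (i : ℕ) (c : Cochain x M i) :
    cochainMap x (LinearMap.id : M →ₗ[S] M) i c = c :=
  funext fun J => locMap_id x J.1 (c J)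

theorem cochainMap_smul (s : S) (f : M →ₗ[S] N) (i : ℕ) (c : Cochain x M i) :
    cochainMap x (s • f) i c = s • cochainMap x f i c := by
  ext J; simp [cochainMap]

theorem cochainMap_add (f g : M →ₗ[S] N) (i : ℕ) (c : Cochain x M i) :
    cochainMap x (f + g) i c = cochainMap x f i c + cochainMap x g i c := by
  ext J; simp [cochainMap]

theorem cochainMap_zero (i : ℕ) (c : Cochain x M i) :
    cochainMap x (0 : M →ₗ[S] N) i c = 0 := by
  ext J; simp [cochainMap]

theorem cochainMap_injective {f : M →ₗ[S] N} (hf : Function.Injective f) (i : ℕ) :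
    Function.Injective (cochainMap x f i) := by
  intro c c' h
  funext J
  exact IsLocalizedModule.map_injective (prodPowers x J.1) (toLoc x M J.1) (toLoc x N J.1) f hf
    (congrFun h J)

theorem cochainMap_surjective {f : M →ₗ[S] N} (hf : Function.Surjective f) (i : ℕ) :
    Function.Surjective (cochainMap x f i) := by
  intro c
  choose b hb using fun J : {J : Finset (Fin n) // J.card = i} =>
    IsLocalizedModule.map_surjective (prodPowers x J.1) (toLoc x M J.1) (toLoc x N J.1) f hf (c J)
  exact ⟨b, funext hb⟩

theorem cochainMap_exact {f : M →ₗ[S] N} {g : N →ₗ[S] L} (h : Function.Exact f g) (i : ℕ) :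
    Function.Exact (cochainMap x f i) (cochainMap x g i) := by
  intro c
  constructor
  · intro hc
    have h1 : ∀ J : {J : Finset (Fin n) // J.card = i}, ∃ b, locMap x f J.1 b = c J := fun J =>
      (IsLocalizedModule.map_exact (prodPowers x J.1) (toLoc x M J.1) (toLoc x N J.1)
        (toLoc x L J.1) f g h (c J)).1 (congrFun hc J)
    choose b hb using h1
    exact ⟨b, funext hb⟩
  · rintro ⟨b, rfl⟩
    rw [← cochainMap_comp, h.linearMap_comp_eq_zero, cochainMap_zero]

theorem mem_boundaries_zero {c : Cochain x M 0} : c ∈ boundaries x M 0 ↔ c = 0 := Iff.rfl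

theorem d_boundary {i : ℕ} {c : Cochain x M i} (hc : c ∈ boundaries x M i) : d x M i c = 0 := by
  cases i with
  | zero => rw [(mem_boundaries_zero x).1 hc, map_zero]
  | succ i =>
    obtain ⟨b, rfl⟩ := hc
    exact d_comp_d x i b

theorem cochainMap_boundary (f : M →ₗ[S] N) {i : ℕ} {c : Cochain x M i}
    (hc : c ∈ boundaries x M i) : cochainMap x f i c ∈ boundaries x N i := by
  cases i with
  | zero => rw [(mem_boundaries_zero x).1 hc, map_zero]; exact Submodule.zero_mem _
  | succ i =>
    obtain ⟨b, rfl⟩ := hc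
    exact ⟨cochainMap x f i b, d_cochainMap x f i b⟩

/-- The class of a cocycle. -/
abbrev cls {i : ℕ} (c : Cochain x M i) (hc : d x M i c = 0) : Coh x M i :=
  Submodule.Quotient.mk ⟨c, hc⟩

theorem cls_eq_zero {i : ℕ} {c : Cochain x M i} {hc : d x M i c = 0} :
    cls x c hc = 0 ↔ c ∈ boundaries x M i := Submodule.Quotient.mk_eq_zero _

theorem cls_eq {i : ℕ} {c c' : Cochain x M i} {hc : d x M i c = 0} {hc' : d x M i c' = 0} :
    cls x c hc = cls x c' hc' ↔ c - c' ∈ boundaries x M i := Submodule.Quotient.eq _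

theorem exists_cls {i : ℕ} (h : Coh x M i) : ∃ (c : Cochain x M i) (hc : d x M i c = 0),
    cls x c hc = h := by
  obtain ⟨⟨c, hc⟩, rfl⟩ := Submodule.Quotient.mk_surjective _ h
  exact ⟨c, hc, rfl⟩

/-- The vanishing of Čech cohomology, in terms of cochains. -/
def Acyclic (M : Type*) [AddCommGroup M] [Module S M] (i : ℕ) : Prop :=
  ∀ c : Cochain x M i, d x M i c = 0 → c ∈ boundaries x M i

theorem acyclic_iff {i : ℕ} : Acyclic x M i ↔ ¬ Nontrivial (Coh x M i) := by
  rw [not_nontrivial_iff_subsingleton]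
  constructor
  · intro h
    refine subsingleton_of_forall_eq 0 fun y => ?_
    obtain ⟨c, hc, rfl⟩ := exists_cls x y
    exact (cls_eq_zero x).2 (h c hc)
  · intro h c hc
    exact (cls_eq_zero x (hc := hc)).1 (Subsingleton.elim _ _)

theorem cohMap_comp (f : M →ₗ[S] N) (g : N →ₗ[S] L) (i : ℕ) (c : Coh x M i) :
    cohMap x (g ∘ₗ f) i c = cohMap x g i (cohMap x f i c) := by
  obtain ⟨c, hc, rfl⟩ := exists_cls x c
  simp only [cohMap_mk, cochainMap_comp]

theorem cohMap_id (i : ℕ) (c : Coh x M i) : cohMap x (LinearMap.id : M →ₗ[S] M) i c = c := by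
  obtain ⟨c, hc, rfl⟩ := exists_cls x c
  simp only [cohMap_mk, cochainMap_id]

/-- Čech cohomology transports along isomorphisms. -/
def cohEquiv (f : M ≃ₗ[S] N) (i : ℕ) : Coh x M i ≃ₗ[S] Coh x N i :=
  LinearEquiv.ofLinearMap (cohMap x f.toLinearMap i) (cohMap x f.symm.toLinearMap i)
    (LinearMap.ext fun c => by
      rw [LinearMap.comp_apply, ← cohMap_comp]
      rw [show f.toLinearMap ∘ₗ f.symm.toLinearMap = LinearMap.id from
        LinearMap.ext fun m => f.apply_symm_apply m]
      exact cohMap_id x i c)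
    (LinearMap.ext fun c => by
      rw [LinearMap.comp_apply, ← cohMap_comp]
      rw [show f.symm.toLinearMap ∘ₗ f.toLinearMap = LinearMap.id from
        LinearMap.ext fun m => f.symm_apply_apply m]
      exact cohMap_id x i c)

theorem acyclic_of_equiv (f : M ≃ₗ[S] N) {i : ℕ} (h : Acyclic x M i) : Acyclic x N i := by
  rw [acyclic_iff] at h ⊢
  exact fun h' => h (cohEquiv x f i).toEquiv.nontrivial

/-- The Čech complex stops after degree `n`. -/
theorem acyclic_of_lt {i : ℕ} (hi : n < i) : Acyclic x M i := by
  intro c _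
  have : c = 0 := by
    funext J
    have := J.2
    have := Finset.card_le_univ J.1
    simp at this
    omega
  rw [this]
  exact Submodule.zero_mem _

/-- Every class of Čech cohomology is annihilated by a power of each `x j`. -/
theorem exists_pow_smul_mem_boundaries (j : Fin n) {i : ℕ} (c : Cochain x M i)
    (hc : d x M i c = 0) : ∃ e : ℕ, x j ^ e • c ∈ boundaries x M i := by
  -- For `J` not containing `j`, the component of `d c` at `J ∪ {j}` is, up to sign, the image of `c
  -- J`, because all other terms involve index sets containing `j`. Hence `c J` dies after inverting
  -- `x j`.
  have key : ∀ (c : Cochain x M i), d x M i c = 0 → (∀ J, j ∈ J.1 → c J = 0) →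
      ∃ e : ℕ, x j ^ e • c = 0 := by
    intro c hc h0
    have h1 : ∀ J : {J : Finset (Fin n) // J.card = i}, ∃ e : ℕ, x j ^ e • c J = 0 := by
      intro J
      by_cases hj : j ∈ J.1
      · exact ⟨0, by rw [h0 J hj, smul_zero]⟩
      let J' : {J : Finset (Fin n) // J.card = i + 1} :=
        ⟨insert j J.1, by rw [Finset.card_insert_of_notMem hj, J.2]⟩
      have h2 := congrFun hc J'
      rw [d_apply, Finset.sum_eq_single ⟨j, Finset.mem_insert_self j J.1⟩] at h2
      · have e1 : (⟨J'.1.erase j, card_erase J' ⟨j, Finset.mem_insert_self j J.1⟩⟩ :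
            {J : Finset (Fin n) // J.card = i}) = J := Subtype.ext (Finset.erase_insert hj)
        have e2 := res_congr x c (J := J'.1) e1 (Finset.erase_subset _ _) (Finset.subset_insert _ _)
        have h3 : res x M (Finset.subset_insert j J.1) (c J) = 0 := by
          have := congrArg (fun z => ((-1 : S) ^ (J'.1.filter (· < j)).card) • z) h2
          rw [← e2]
          simpa [smul_smul, ← mul_pow] using this
        obtain ⟨e, m, hm⟩ := exists_pow_smul_eq_toLoc x J.1 (c J)
        have h4 := congrArg (fun z => (∏ j ∈ J.1, x j) ^ e • z) h3
        simp only [← map_smul, hm, res_mk, smul_zero] at h4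
        obtain ⟨k, hk⟩ := (toLoc_eq_zero_iff x).1 h4
        refine ⟨k, pow_smul_cancel x (e := k + e) ?_⟩
        rw [smul_zero, pow_add, mul_smul, smul_comm _ (x j ^ k), hm, ← map_smul, ← map_smul,
          smul_smul, ← mul_pow, mul_comm, ← Finset.prod_insert hj, hk, map_zero]
      · rintro ⟨b, hb⟩ - hbj
        have : j ∈ (insert j J.1).erase b := Finset.mem_erase.2
          ⟨fun h => hbj (Subtype.ext h.symm), Finset.mem_insert_self _ _⟩
        rw [h0 _ this, map_zero, smul_zero]
      · intro h; exact absurd (Finset.mem_univ _) h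
    choose e he using h1
    refine ⟨∑ J, e J, funext fun J => ?_⟩
    rw [Pi.smul_apply, ← Finset.sum_erase_add _ _ (Finset.mem_univ J), pow_add, mul_smul, he,
      smul_zero, Pi.zero_apply]
  cases i with
  | zero =>
    obtain ⟨e, he⟩ := key c hc fun J hj => by
      rw [Finset.card_eq_zero.1 J.2] at hj
      exact absurd hj (Finset.notMem_empty _)
    exact ⟨e, he⟩
  | succ i =>
    -- A power of `x j` clears the part of the denominator of `c J` that involves `x j`.
    have h1 : ∀ J : {J : Finset (Fin n) // J.card = i + 1}, j ∈ J.1 → ∃ e : ℕ,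
        ∃ b : Loc x M (J.1.erase j), res x M (J.1.erase_subset j) b = x j ^ e • c J := by
      intro J hj
      obtain ⟨e, m, hm⟩ := exists_pow_smul_eq_toLoc x J.1 (c J)
      obtain ⟨b, hb⟩ := exists_pow_smul_eq x (J.1.erase j) e (toLoc x M (J.1.erase j) m)
      refine ⟨e, b, pow_smul_cancel x (e := e) ?_⟩
      rw [smul_comm, hm]
      nth_rw 1 [← Finset.mul_prod_erase _ _ hj]
      rw [mul_pow, mul_smul, ← map_smul, hb, res_mk]
    choose! e b hb using h1
    let E := ∑ J, e J
    -- The homotopy "insert `j`", defined after multiplication by a common power `x j ^ E`. By the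
    -- choice of signs `d B` and `x j ^ E • c` agree at every `J` containing `j`, so `key` applies
    -- to their difference.
    let B : Cochain x M i := fun J => if hj : j ∈ J.1 then 0 else
      ((-1 : S) ^ (J.1.filter (· < j)).card * x j ^ (E - e ⟨insert j J.1, by
        rw [Finset.card_insert_of_notMem hj, J.2]⟩)) •
      (Finset.erase_insert hj ▸ b ⟨insert j J.1, by rw [Finset.card_insert_of_notMem hj, J.2]⟩ :
        Loc x M J.1)
    have hcast : ∀ (J : {J : Finset (Fin n) // J.card = i})
        (J' : {J : Finset (Fin n) // J.card = i + 1})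
        (h : J'.1.erase j = J.1) (h' : J.1 ⊆ J'.1), j ∈ J'.1 →
        res x M h' (h ▸ b J') = x j ^ e J' • c J' := by
      rintro ⟨J, hJ⟩ J' h h' hj
      dsimp only at h
      subst h
      exact hb J' hj
    have hB : ∀ J : {J : Finset (Fin n) // J.card = i + 1}, j ∈ J.1 →
        d x M i B J = x j ^ E • c J := by
      intro J hj
      rw [d_apply, Finset.sum_eq_single ⟨j, hj⟩]
      · have hj' : j ∉ J.1.erase j := Finset.notMem_erase _ _
        have hins : (⟨insert j (J.1.erase j), by
          rw [Finset.card_insert_of_notMem hj', Finset.card_erase_of_mem hj, J.2]; rfl⟩ :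
            {J : Finset (Fin n) // J.card = i + 1}) = J := Subtype.ext (Finset.insert_erase hj)
        have hfil : (J.1.erase j).filter (· < j) = J.1.filter (· < j) := by
          rw [Finset.filter_erase, Finset.erase_eq_of_notMem (by simp)]
        have hle : e J ≤ E := Finset.single_le_sum (fun _ _ => Nat.zero_le _) (Finset.mem_univ J)
        have hBJ : B ⟨J.1.erase j, card_erase J ⟨j, hj⟩⟩ = ((-1 : S) ^ (J.1.filter (· < j)).card *
            x j ^ (E - e J)) • b J := by
          simp only [B, dif_neg hj', hfil]
          congr 1
          · rw [hins]
          · have : ∀ (J' : {J : Finset (Fin n) // J.card = i + 1}) (h : J'.1.erase j = J.1.erase j),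
              J' = J → (h ▸ b J' : Loc x M (J.1.erase j)) = b J := by
              rintro J' h rfl; rfl
            exact this _ _ hins
        rw [hBJ, map_smul, hb J hj, smul_smul, smul_smul, ← mul_assoc, ← mul_pow, mul_assoc,
          ← pow_add, Nat.sub_add_cancel hle]
        simp
      · rintro ⟨a, ha⟩ - haj
        have : j ∈ J.1.erase a := Finset.mem_erase.2 ⟨fun h => haj (Subtype.ext h.symm), hj⟩
        simp only [B, dif_pos this, map_zero, smul_zero]
      · intro h; exact absurd (Finset.mem_univ _) h
    obtain ⟨k, hk⟩ := key (x j ^ E • c - d x M i B) (by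
      rw [map_sub, map_smul, hc, d_comp_d, smul_zero, sub_zero]) (fun J hj => by
      rw [Pi.sub_apply, hB J hj, Pi.smul_apply, sub_self])
    refine ⟨k + E, x j ^ k • B, ?_⟩
    rw [smul_sub, sub_eq_zero] at hk
    rw [map_smul, ← hk, pow_add, mul_smul]

end CechBasics

/-! ### Pieces of the long exact sequence, for idempotent operators on cochains -/

section LongExactSequence

variable {S : Type*} [CommRing S] {n : ℕ} (x : Fin n → S)

/-- An idempotent operator on the Čech complex, such as the projection to a graded piece. -/
structure CochainOp (M : Type*) [AddCommGroup M] [Module S M] where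
  op : ∀ i, Cochain x M i →+ Cochain x M i
  op_op : ∀ i c, op i (op i c) = op i c
  d_op : ∀ i c, d x M i (op i c) = op (i + 1) (d x M i c)

namespace CochainOp

/-- The identity operator. -/
def one (M : Type*) [AddCommGroup M] [Module S M] : CochainOp x M where
  op _ := AddMonoidHom.id _
  op_op _ _ := rfl
  d_op _ _ := rfl

variable {x}
variable {M N L W : Type*} [AddCommGroup M] [Module S M] [AddCommGroup N] [Module S N]
  [AddCommGroup L] [Module S L] [AddCommGroup W] [Module S W]

theorem op_boundary (P : CochainOp x M) {i : ℕ} {c : Cochain x M i} (hc : c ∈ boundaries x M i) :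
    P.op i c ∈ boundaries x M i := by
  cases i with
  | zero => rw [(mem_boundaries_zero x).1 hc, map_zero]; exact Submodule.zero_mem _
  | succ i =>
    obtain ⟨b, rfl⟩ := hc
    exact ⟨P.op i b, P.d_op i b⟩

/-- The part of cohomology cut out by the operator vanishes. -/
def Van (P : CochainOp x M) (i : ℕ) : Prop :=
  ∀ c : Cochain x M i, d x M i c = 0 → P.op i c ∈ boundaries x M i

theorem van_one {i : ℕ} : (one x M).Van i ↔ Acyclic x M i := Iff.rfl

theorem van_of_acyclic (P : CochainOp x M) {i : ℕ} (h : Acyclic x M i) : P.Van i :=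
  fun c hc => P.op_boundary (h c hc)

theorem van_of_subsingleton [Subsingleton M] (P : CochainOp x M) (i : ℕ) : P.Van i := by
  intro c _
  rw [Subsingleton.elim (P.op i c) 0]
  exact Submodule.zero_mem _

/-- A linear map that commutes with the operators. -/
def Compat (P : CochainOp x M) (Q : CochainOp x N) (f : M →ₗ[S] N) : Prop :=
  ∀ i c, cochainMap x f i (P.op i c) = Q.op i (cochainMap x f i c)

theorem compat_one (f : M →ₗ[S] N) : Compat (one x M) (one x N) f := fun _ _ => rfl

/-- If `W → M → N → L → 0` is exact and the cohomology of `W` vanishes in degree `i + 1`, then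
`H^i(M) → H^i(N) → H^i(L)` is exact. -/
theorem exists_lift_of_van {PW : CochainOp x W} {PM : CochainOp x M} {PN : CochainOp x N}
    {j : W →ₗ[S] M} {f : M →ₗ[S] N} {g : N →ₗ[S] L}
    (hj : PW.Compat PM j) (hf : PM.Compat PN f)
    (hji : Function.Injective j) (hjf : Function.Exact j f) (hfg : Function.Exact f g)
    (hg : Function.Surjective g) {i : ℕ} (hW : PW.Van (i + 1))
    {c : Cochain x N i} (hc : d x N i c = 0) (hgc : cochainMap x g i c ∈ boundaries x L i) :
    ∃ a : Cochain x M i, d x M i a = 0 ∧ PN.op i c - cochainMap x f i a ∈ boundaries x N i := by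
  -- Changing `c` by a coboundary makes its image in `L` zero as a cochain; in degree `0` there are
  -- no coboundaries and none is needed.
  obtain ⟨b, hb, hcb⟩ : ∃ b ∈ boundaries x N i, cochainMap x g i (c - b) = 0 := by
    cases i with
    | zero =>
      refine ⟨0, Submodule.zero_mem _, ?_⟩
      rw [sub_zero]; exact hgc
    | succ i =>
      obtain ⟨e, he⟩ := hgc
      obtain ⟨e', rfl⟩ := cochainMap_surjective x hg i e
      refine ⟨d x N i e', ⟨e', rfl⟩, ?_⟩
      rw [map_sub, ← d_cochainMap, he, sub_self]
  obtain ⟨a, ha⟩ := (cochainMap_exact x hfg i _).1 hcb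
  have h1 : cochainMap x f (i + 1) (d x M i a) = 0 := by
    rw [← d_cochainMap, ha, map_sub, hc, d_boundary x hb, sub_zero]
  obtain ⟨w, hw⟩ := (cochainMap_exact x hjf (i + 1) _).1 h1
  have h2 : d x W (i + 1) w = 0 := by
    apply cochainMap_injective x hji
    rw [← d_cochainMap, hw, d_comp_d, map_zero]
  obtain ⟨v, hv⟩ := hW w h2
  -- The obstruction `d a` to being a cocycle comes from the cocycle `w` of `W`. After applying the
  -- operator it is a coboundary `d v`, and subtracting `v` does not change the image in `N`.
  refine ⟨PM.op i a - cochainMap x j i v, ?_, ?_⟩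
  · rw [map_sub, PM.d_op, ← hw, ← hj, d_cochainMap, hv, sub_self]
  · have h3 : cochainMap x f i (cochainMap x j i v) = 0 :=
      (cochainMap_exact x hjf i _).2 ⟨v, rfl⟩
    rw [map_sub, h3, sub_zero, hf, ha, map_sub, sub_sub_cancel]
    exact PN.op_boundary hb

/-- If `0 → W → M → N → 0` is exact and the cohomology of `W` vanishes in degree `i + 1`, then
`H^i(M) → H^i(N)` is surjective. -/
theorem exists_lift_of_surjective {PW : CochainOp x W} {PM : CochainOp x M} {PN : CochainOp x N}
    {j : W →ₗ[S] M} {f : M →ₗ[S] N} (hj : PW.Compat PM j) (hf : PM.Compat PN f)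
    (hji : Function.Injective j) (hjf : Function.Exact j f) (hfs : Function.Surjective f)
    {i : ℕ} (hW : PW.Van (i + 1)) {c : Cochain x N i} (hc : d x N i c = 0) :
    ∃ a : Cochain x M i, d x M i a = 0 ∧ PN.op i c - cochainMap x f i a ∈ boundaries x N i := by
  -- The preceding lemma with `L = 0`.
  refine exists_lift_of_van (g := (0 : N →ₗ[S] PUnit)) hj hf hji hjf
    (fun y => ⟨fun _ => hfs y, fun _ => rfl⟩) (fun _ => ⟨0, Subsingleton.elim _ _⟩) hW hc ?_
  rw [cochainMap_zero]
  exact Submodule.zero_mem _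

/-- This is the segment `H^i(M) → H^i(N) → H^{i+1}(W)` of the long exact sequence. -/
theorem van_of_surjective {PW : CochainOp x W} {PM : CochainOp x M} {PN : CochainOp x N}
    {j : W →ₗ[S] M} {f : M →ₗ[S] N} (hj : PW.Compat PM j) (hf : PM.Compat PN f)
    (hji : Function.Injective j) (hjf : Function.Exact j f) (hfs : Function.Surjective f)
    {i : ℕ} (hW : PW.Van (i + 1)) (hM : PM.Van i) : PN.Van i := by
  intro c hc
  obtain ⟨a, ha, h⟩ := exists_lift_of_surjective hj hf hji hjf hfs hW hc
  have h1 := PN.op_boundary h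
  rw [map_sub, PN.op_op, ← hf] at h1
  simpa using Submodule.add_mem _ h1 (cochainMap_boundary x f (hM a ha))

/-- Exactness of `H^i(M) → H^i(N) → H^i(L)`, obtained from `exists_lift_of_van` with `W = 0`. -/
theorem op_mem_boundaries_of_exact {PM : CochainOp x M} {PN : CochainOp x N}
    {f : M →ₗ[S] N} {g : N →ₗ[S] L} (hf : PM.Compat PN f)
    (hfi : Function.Injective f) (hfg : Function.Exact f g) (hgs : Function.Surjective g)
    {i : ℕ} (hM : PM.Van i) {c : Cochain x N i} (hc : d x N i c = 0)
    (hgc : cochainMap x g i c ∈ boundaries x L i) : PN.op i c ∈ boundaries x N i := by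
  obtain ⟨a, ha, h⟩ := exists_lift_of_van (W := PUnit) (PW := one x PUnit) (j := 0) (c := c)
    (fun k b => by rw [Subsingleton.elim b 0]; simp) hf
    (fun _ _ _ => Subsingleton.elim _ _)
    (fun y => ⟨fun h => ⟨0, hfi (by rw [h]; simp)⟩, by rintro ⟨y, rfl⟩; simp⟩)
    hfg hgs (van_of_subsingleton _ _) hc hgc
  have h1 := PN.op_boundary h
  rw [map_sub, PN.op_op, ← hf] at h1
  simpa using Submodule.add_mem _ h1 (cochainMap_boundary x f (hM a ha))

/-- The middle term of a short exact sequence has no cohomology if the outer terms have none. -/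
theorem van_of_exact {PM : CochainOp x M} {PN : CochainOp x N} {PL : CochainOp x L}
    {f : M →ₗ[S] N} {g : N →ₗ[S] L} (hf : PM.Compat PN f) (hg : PN.Compat PL g)
    (hfi : Function.Injective f) (hfg : Function.Exact f g) (hgs : Function.Surjective g)
    {i : ℕ} (hM : PM.Van i) (hL : PL.Van i) : PN.Van i := by
  intro c hc
  -- One copy of the operator is used up by the vanishing for `L`, the other by the vanishing for
  -- `M`.
  rw [← PN.op_op]
  refine op_mem_boundaries_of_exact hf hfi hfg hgs hM (by rw [PN.d_op, hc, map_zero]) ?_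
  rw [hg]
  exact hL _ (by rw [d_cochainMap, hc, map_zero])

/-- If `0 → M → N → L → 0` is exact and the cohomology of `L` vanishes in degree `i`, then
`H^{i+1}(M) → H^{i+1}(N)` is injective. -/
theorem op_mem_boundaries_of_van {PM : CochainOp x M} {PN : CochainOp x N} {PL : CochainOp x L}
    {f : M →ₗ[S] N} {g : N →ₗ[S] L} (hf : PM.Compat PN f) (hg : PN.Compat PL g)
    (hfi : Function.Injective f) (hfg : Function.Exact f g) (hgs : Function.Surjective g)
    {i : ℕ} (hL : PL.Van i) {a : Cochain x M (i + 1)}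
    (ha : cochainMap x f (i + 1) a ∈ boundaries x N (i + 1)) :
    PM.op (i + 1) a ∈ boundaries x M (i + 1) := by
  obtain ⟨b, hb⟩ := ha
  -- If the image of `a` is `d b`, then `b` becomes a cocycle in `L`. Its projection is a coboundary
  -- there, so after a correction the projection of `b` comes from `M`.
  have h1 : d x L i (cochainMap x g i b) = 0 := by
    rw [d_cochainMap, hb]; exact (cochainMap_exact x hfg _ _).2 ⟨a, rfl⟩
  obtain ⟨b', hb', h2⟩ : ∃ b' ∈ boundaries x N i, cochainMap x g i (PN.op i b - b') = 0 := by
    have h3 := hL _ h1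
    rw [← hg] at h3
    cases i with
    | zero =>
      refine ⟨0, Submodule.zero_mem _, ?_⟩
      rw [sub_zero]; exact h3
    | succ i =>
      obtain ⟨e, he⟩ := h3
      obtain ⟨e', rfl⟩ := cochainMap_surjective x hgs i e
      refine ⟨d x N i e', ⟨e', rfl⟩, ?_⟩
      rw [map_sub, ← d_cochainMap, he, sub_self]
  obtain ⟨a', ha'⟩ := (cochainMap_exact x hfg i _).1 h2
  refine ⟨a', ?_⟩
  apply cochainMap_injective x hfi
  rw [← d_cochainMap, ha', map_sub, d_boundary x hb', sub_zero, PN.d_op, hb, hf]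

end CochainOp

end LongExactSequence

/-! ### Gradings by projections, and the induced gradings of the Čech complex -/

section Grading

variable (R : Type*) {S : Type*} [CommRing R] [CommRing S] [Algebra R S]
variable {n : ℕ} (x : Fin n → S) (w : Fin n → ℤ)

/-- A grading of a module, given by the projections to its homogeneous components, for which
`x j` has degree `w j`. -/
structure Grading (M : Type*) [AddCommGroup M] [Module R M] [Module S M] where
  proj : ℤ → M →ₗ[R] M
  proj_proj : ∀ μ m, proj μ (proj μ m) = proj μ m
  proj_of_ne : ∀ μ ν m, μ ≠ ν → proj μ (proj ν m) = 0
  exists_sum : ∀ m, ∃ s : Finset ℤ, ∑ μ ∈ s, proj μ m = m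
  proj_smul : ∀ j μ m, proj (μ + w j) (x j • m) = x j • proj μ m

namespace Grading

variable {R x w}
variable {M N : Type*} [AddCommGroup M] [Module R M] [Module S M] [IsScalarTower R S M]
  [AddCommGroup N] [Module R N] [Module S N] [IsScalarTower R S N]
variable (G : Grading R x w M) (G' : Grading R x w N)

/-- The homogeneous components. -/
def deg (μ : ℤ) : Submodule R M := LinearMap.range (G.proj μ)

theorem mem_deg {μ : ℤ} {m : M} : m ∈ G.deg μ ↔ G.proj μ m = m :=
  ⟨by rintro ⟨m, rfl⟩; exact G.proj_proj μ m, fun hm => ⟨m, hm⟩⟩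

theorem proj_mem_deg (μ : ℤ) (m : M) : G.proj μ m ∈ G.deg μ := ⟨m, rfl⟩

/-- A homogeneous map. -/
def Compat (f : M →ₗ[S] N) : Prop := ∀ μ m, f (G.proj μ m) = G'.proj μ (f m)

theorem proj_prod_pow_smul (J : Finset (Fin n)) (e : ℕ) (μ : ℤ) (m : M) :
    G.proj (μ + e * ∑ j ∈ J, w j) ((∏ j ∈ J, x j) ^ e • m) =
      (∏ j ∈ J, x j) ^ e • G.proj μ m := by
  have h1 : ∀ (J : Finset (Fin n)) (μ : ℤ) (m : M),
      G.proj (μ + ∑ j ∈ J, w j) ((∏ j ∈ J, x j) • m) = (∏ j ∈ J, x j) • G.proj μ m := by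
    intro J
    induction J using Finset.induction_on with
    | empty => intro μ m; simp
    | insert j J hj ih =>
      intro μ m
      rw [Finset.sum_insert hj, Finset.prod_insert hj, mul_smul, mul_smul, ← ih,
        ← G.proj_smul, add_comm (w j), add_assoc]
  induction e generalizing μ m with
  | zero => simp
  | succ e ih =>
    rw [pow_succ, mul_smul, mul_smul, ← h1, ← ih]
    congr 2
    push_cast; ring

theorem proj_pow_smul (j : Fin n) (e : ℕ) (μ : ℤ) (m : M) :
    G.proj (μ + e * w j) (x j ^ e • m) = x j ^ e • G.proj μ m := by
  simpa using G.proj_prod_pow_smul {j} e μ m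

/-- The component of degree `μ` of `m / f ^ e` has to be that of `m` of degree `μ + e deg f`,
divided by `f ^ e`. Two representations of `z` agree after multiplication by a power of `f`;
comparing components of the resulting degree shows independence. One `y` serving all representations
is what makes `locProj` linear. -/
theorem exists_locProj (J : Finset (Fin n)) (μ : ℤ) (z : Loc x M J) :
    ∃ y : Loc x M J, ∀ (e : ℕ) (m : M), (∏ j ∈ J, x j) ^ e • z = toLoc x M J m →
      (∏ j ∈ J, x j) ^ e • y = toLoc x M J (G.proj (μ + e * ∑ j ∈ J, w j) m) := by
  obtain ⟨e₀, m₀, h₀⟩ := exists_pow_smul_eq_toLoc x J z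
  obtain ⟨y, hy⟩ := exists_pow_smul_eq x J e₀
    (toLoc x M J (G.proj (μ + e₀ * ∑ j ∈ J, w j) m₀))
  refine ⟨y, fun e m h => ?_⟩
  have h1 : toLoc x M J ((∏ j ∈ J, x j) ^ e₀ • m) = toLoc x M J ((∏ j ∈ J, x j) ^ e • m₀) := by
    rw [map_smul, map_smul, ← h, ← h₀, smul_comm]
  obtain ⟨k, hk⟩ := (toLoc_eq_iff x).1 h1
  have h2 := congrArg (G.proj (μ + ((k + e + e₀ : ℕ) : ℤ) * ∑ j ∈ J, w j)) hk
  rw [smul_smul, smul_smul, ← pow_add, ← pow_add] at h2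
  have e1 : μ + ((k + e + e₀ : ℕ) : ℤ) * ∑ j ∈ J, w j =
    (μ + e * ∑ j ∈ J, w j) + ((k + e₀ : ℕ) : ℤ) * ∑ j ∈ J, w j := by push_cast; ring
  have e2 : μ + ((k + e + e₀ : ℕ) : ℤ) * ∑ j ∈ J, w j =
    (μ + e₀ * ∑ j ∈ J, w j) + ((k + e : ℕ) : ℤ) * ∑ j ∈ J, w j := by push_cast; ring
  nth_rw 1 [e1] at h2
  rw [e2, G.proj_prod_pow_smul, G.proj_prod_pow_smul] at h2
  apply pow_smul_cancel x (e := k + e₀)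
  rw [← map_smul, h2, map_smul, ← hy, smul_smul, smul_smul, ← pow_add, ← pow_add]
  congr 2; ring

/-- The projection of a localization to its component of degree `μ`. -/
def locProj (J : Finset (Fin n)) (μ : ℤ) : Loc x M J →ₗ[R] Loc x M J where
  toFun z := (G.exists_locProj J μ z).choose
  map_add' z z' := by
    obtain ⟨e, m, h⟩ := exists_pow_smul_eq_toLoc x J z
    obtain ⟨e', m', h'⟩ := exists_pow_smul_eq_toLoc x J z'
    have a : (∏ j ∈ J, x j) ^ (e + e') • z = toLoc x M J ((∏ j ∈ J, x j) ^ e' • m) := by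
      rw [map_smul, ← h, smul_smul, ← pow_add, add_comm]
    have a' : (∏ j ∈ J, x j) ^ (e + e') • z' = toLoc x M J ((∏ j ∈ J, x j) ^ e • m') := by
      rw [map_smul, ← h', smul_smul, ← pow_add]
    apply pow_smul_cancel x (e := e + e')
    rw [(G.exists_locProj J μ (z + z')).choose_spec _ _ (by rw [smul_add, a, a', ← map_add]),
      smul_add, (G.exists_locProj J μ z).choose_spec _ _ a,
      (G.exists_locProj J μ z').choose_spec _ _ a', map_add, map_add]
  map_smul' r z := by
    obtain ⟨e, m, h⟩ := exists_pow_smul_eq_toLoc x J z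
    have a : (∏ j ∈ J, x j) ^ e • r • z = toLoc x M J (r • m) := by
      rw [smul_comm, h, ← algebraMap_smul S r, ← map_smul, algebraMap_smul]
    apply pow_smul_cancel x (e := e)
    rw [(G.exists_locProj J μ (r • z)).choose_spec _ _ a, RingHom.id_apply, smul_comm,
      (G.exists_locProj J μ z).choose_spec _ _ h, map_smul, ← algebraMap_smul S r, map_smul,
      algebraMap_smul]

theorem locProj_spec {J : Finset (Fin n)} (μ : ℤ) {z : Loc x M J} {e : ℕ} {m : M}
    (h : (∏ j ∈ J, x j) ^ e • z = toLoc x M J m) :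
    (∏ j ∈ J, x j) ^ e • G.locProj J μ z =
      toLoc x M J (G.proj (μ + e * ∑ j ∈ J, w j) m) :=
  (G.exists_locProj J μ z).choose_spec e m h

theorem locProj_locProj (J : Finset (Fin n)) (μ : ℤ) (z : Loc x M J) :
    G.locProj J μ (G.locProj J μ z) = G.locProj J μ z := by
  obtain ⟨e, m, h⟩ := exists_pow_smul_eq_toLoc x J z
  apply pow_smul_cancel x (e := e)
  rw [G.locProj_spec μ (G.locProj_spec μ h), G.proj_proj, G.locProj_spec μ h]

theorem proj_eq_zero_of_notMem {s : Finset ℤ} {m : M} (h : ∑ μ ∈ s, G.proj μ m = m) {ν : ℤ}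
    (hν : ν ∉ s) : G.proj ν m = 0 := by
  rw [← h, map_sum]
  exact Finset.sum_eq_zero fun μ hμ => G.proj_of_ne _ _ _ fun e => hν (e ▸ hμ)

theorem sum_proj_of_subset {s t : Finset ℤ} {m : M} (h : ∑ μ ∈ s, G.proj μ m = m)
    (hst : s ⊆ t) : ∑ μ ∈ t, G.proj μ m = m := by
  rw [← Finset.sum_subset hst fun μ _ hμ => G.proj_eq_zero_of_notMem h hμ, h]

/-- Allowing all larger sets `t` lets the finitely many index sets `J` share one set of degrees in
`exists_sum_cochainProj`. -/
theorem exists_sum_locProj (J : Finset (Fin n)) (z : Loc x M J) :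
    ∃ s : Finset ℤ, ∀ t, s ⊆ t → ∑ μ ∈ t, G.locProj J μ z = z := by
  obtain ⟨e, m, h⟩ := exists_pow_smul_eq_toLoc x J z
  obtain ⟨s, hs⟩ := G.exists_sum m
  -- The degrees of `m`, lowered by the degree of the denominator.
  let φ : ℤ ↪ ℤ := addRightEmbedding (-(e * ∑ j ∈ J, w j))
  refine ⟨s.map φ, fun t ht => ?_⟩
  apply pow_smul_cancel x (e := e)
  have hz : ∀ μ ∈ t, μ ∉ s.map φ → G.locProj J μ z = 0 := by
    intro μ _ hμ
    apply pow_smul_cancel x (e := e)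
    rw [G.locProj_spec μ h, G.proj_eq_zero_of_notMem hs, map_zero, smul_zero]
    intro h'
    exact hμ (Finset.mem_map.2 ⟨_, h', by simp [φ]⟩)
  rw [← Finset.sum_subset ht hz, Finset.sum_map, Finset.smul_sum, h]
  conv_rhs => rw [← hs, map_sum]
  refine Finset.sum_congr rfl fun μ _ => ?_
  rw [G.locProj_spec _ h]
  congr 2
  simp [φ]

theorem locProj_pow_smul (J : Finset (Fin n)) (j : Fin n) (μ : ℤ) (z : Loc x M J) :
    G.locProj J (μ + w j) (x j • z) = x j • G.locProj J μ z := by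
  obtain ⟨e, m, h⟩ := exists_pow_smul_eq_toLoc x J z
  apply pow_smul_cancel x (e := e)
  rw [G.locProj_spec (m := x j • m) _ (by rw [smul_comm, h, map_smul]), smul_comm,
    G.locProj_spec μ h, ← map_smul, ← G.proj_smul, add_right_comm]

theorem res_locProj {J J' : Finset (Fin n)} (hJ : J ⊆ J') (μ : ℤ) (z : Loc x M J) :
    res x M hJ (G.locProj J μ z) = G.locProj J' μ (res x M hJ z) := by
  obtain ⟨e, m, h⟩ := exists_pow_smul_eq_toLoc x J z
  have h1 : (∏ j ∈ J', x j) ^ e • res x M hJ z =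
      toLoc x M J' ((∏ j ∈ J' \ J, x j) ^ e • m) := by
    rw [← Finset.prod_sdiff hJ, mul_pow, mul_smul, ← map_smul, h, res_mk, map_smul]
  apply pow_smul_cancel x (e := e)
  rw [G.locProj_spec μ h1]
  nth_rw 1 [← Finset.prod_sdiff hJ]
  rw [mul_pow, mul_smul, ← map_smul, G.locProj_spec μ h, res_mk, ← Finset.sum_sdiff hJ, mul_add,
    ← add_assoc, add_right_comm, G.proj_prod_pow_smul, map_smul]

theorem locMap_locProj {f : M →ₗ[S] N} (hf : G.Compat G' f) (J : Finset (Fin n)) (μ : ℤ)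
    (z : Loc x M J) : locMap x f J (G.locProj J μ z) = G'.locProj J μ (locMap x f J z) := by
  obtain ⟨e, m, h⟩ := exists_pow_smul_eq_toLoc x J z
  apply pow_smul_cancel x (e := e)
  rw [G'.locProj_spec (m := f m) μ (by rw [← map_smul, h, locMap_toLoc]), ← map_smul,
    G.locProj_spec μ h, locMap_toLoc, hf]

/-- The projection of the Čech complex to its component of degree `μ`. -/
def cochainProj (μ : ℤ) (i : ℕ) : Cochain x M i →ₗ[R] Cochain x M i :=
  LinearMap.pi fun J => G.locProj J.1 μ ∘ₗ LinearMap.proj J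

theorem cochainProj_apply (μ : ℤ) (i : ℕ) (c : Cochain x M i)
    (J : {J : Finset (Fin n) // J.card = i}) :
    G.cochainProj μ i c J = G.locProj J.1 μ (c J) := rfl

theorem d_cochainProj (μ : ℤ) (i : ℕ) (c : Cochain x M i) :
    d x M i (G.cochainProj μ i c) = G.cochainProj μ (i + 1) (d x M i c) := by
  funext J
  rw [d_apply, cochainProj_apply, d_apply, map_sum]
  refine Finset.sum_congr rfl fun j _ => ?_
  rw [cochainProj_apply, res_locProj]
  obtain h | h := neg_one_pow_eq_or S (J.1.filter (· < j.1)).card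
  · rw [h, one_smul, one_smul]
  · rw [h, neg_one_smul, neg_one_smul, map_neg]

/-- The projection to the degree `μ` part, as an operator on the Čech complex. -/
def op (μ : ℤ) : CochainOp x M where
  op i := (G.cochainProj μ i).toAddMonoidHom
  op_op _ c := funext fun J => G.locProj_locProj J.1 μ (c J)
  d_op i c := G.d_cochainProj μ i c

theorem op_apply (μ : ℤ) (i : ℕ) (c : Cochain x M i) : (G.op μ).op i c = G.cochainProj μ i c := rfl

variable {G G'} in
theorem Compat.op {f : M →ₗ[S] N} (hf : G.Compat G' f) (μ : ℤ) :
    (G.op μ).Compat (G'.op μ) f :=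
  fun _ c => funext fun J => locMap_locProj G G' hf J.1 μ (c J)

theorem exists_sum_cochainProj (i : ℕ) (c : Cochain x M i) :
    ∃ s : Finset ℤ, ∑ μ ∈ s, G.cochainProj μ i c = c := by
  choose s hs using fun J : {J : Finset (Fin n) // J.card = i} => G.exists_sum_locProj J.1 (c J)
  refine ⟨Finset.univ.biUnion s, funext fun J => ?_⟩
  rw [Finset.sum_apply]
  exact hs J _ (Finset.subset_biUnion_of_mem s (Finset.mem_univ J))

theorem cochainProj_smul (j : Fin n) (μ : ℤ) (i : ℕ) (c : Cochain x M i) :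
    G.cochainProj (μ + w j) i (x j • c) = x j • G.cochainProj μ i c :=
  funext fun J => G.locProj_pow_smul J.1 j μ (c J)

/-- This links the graded pieces spanned by homogeneous fractions to the projections, with which all
later arguments work. -/
theorem locDeg_deg (J : Finset (Fin n)) (μ : ℤ) :
    locDeg x w G.deg J μ = LinearMap.range (G.locProj J μ) := by
  apply le_antisymm
  · rw [locDeg, Submodule.span_le]
    rintro z ⟨e, m, hm, rfl⟩
    refine ⟨LocalizedModule.mk m ⟨_, e, rfl⟩, pow_smul_cancel x (e := e) ?_⟩
    have h : (∏ j ∈ J, x j) ^ e • LocalizedModule.mk m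
        (⟨(∏ j ∈ J, x j) ^ e, e, rfl⟩ : prodPowers x J) = toLoc x M J m := by
      rw [LocalizedModule.smul'_mk]
      exact LocalizedModule.mk_cancel (⟨(∏ j ∈ J, x j) ^ e, e, rfl⟩ : prodPowers x J) m
    rw [G.locProj_spec μ h, G.mem_deg.1 hm, h]
  · rintro _ ⟨z, rfl⟩
    obtain ⟨e, m, h⟩ := exists_pow_smul_eq_toLoc x J z
    refine Submodule.subset_span ⟨e, _, G.proj_mem_deg (μ + e * ∑ j ∈ J, w j) m,
      pow_smul_cancel x (e := e) ?_⟩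
    rw [G.locProj_spec μ h, LocalizedModule.smul'_mk]
    exact (LocalizedModule.mk_cancel (⟨(∏ j ∈ J, x j) ^ e, e, rfl⟩ : prodPowers x J) _).symm

theorem mem_cochainDeg {i : ℕ} {μ : ℤ} {c : Cochain x M i} :
    c ∈ cochainDeg x w G.deg i μ ↔ G.cochainProj μ i c = c := by
  simp only [cochainDeg, Submodule.mem_pi, Set.mem_univ, true_imp_iff, locDeg_deg]
  constructor
  · intro h
    funext J
    obtain ⟨z, hz⟩ := h J
    rw [cochainProj_apply, ← hz, locProj_locProj]
  · intro h J
    exact ⟨c J, congrFun h J⟩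

theorem mem_cohDeg {i : ℕ} {μ : ℤ} {h : Coh x M i} :
    h ∈ cohDeg x w G.deg i μ ↔ ∃ (c : Cochain x M i) (hc : d x M i c = 0),
      G.cochainProj μ i c = c ∧ cls x c hc = h := by
  constructor
  · rintro ⟨⟨c, hc⟩, h1, rfl⟩
    exact ⟨c, hc, G.mem_cochainDeg.1 h1, rfl⟩
  · rintro ⟨c, hc, h1, rfl⟩
    exact ⟨⟨c, hc⟩, G.mem_cochainDeg.2 h1, rfl⟩

theorem d_cochainProj_eq_zero {i : ℕ} {c : Cochain x M i} (hc : d x M i c = 0) (μ : ℤ) :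
    d x M i (G.cochainProj μ i c) = 0 := by rw [d_cochainProj, hc, map_zero]

theorem cls_cochainProj_mem {i : ℕ} {c : Cochain x M i} (hc : d x M i c = 0) (μ : ℤ) :
    cls x (G.cochainProj μ i c) (G.d_cochainProj_eq_zero hc μ) ∈ cohDeg x w G.deg i μ :=
  G.mem_cohDeg.2 ⟨_, G.d_cochainProj_eq_zero hc μ, (G.op μ).op_op i c, rfl⟩

/-- The dictionary by which the exact sequences for `CochainOp` become statements on graded pieces:
a homogeneous cocycle equals its own projection. -/
theorem cohDeg_eq_bot_iff {i : ℕ} {μ : ℤ} :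
    cohDeg x w G.deg i μ = ⊥ ↔ (G.op μ).Van i := by
  rw [Submodule.eq_bot_iff]
  constructor
  · intro h c hc
    exact (cls_eq_zero x (hc := G.d_cochainProj_eq_zero hc μ)).1 (h _ (G.cls_cochainProj_mem hc μ))
  · intro h y hy
    obtain ⟨c, hc, h1, rfl⟩ := G.mem_cohDeg.1 hy
    rw [cls_eq_zero, ← h1]
    exact h c hc

theorem acyclic_of_forall_van {i : ℕ} (h : ∀ μ, (G.op μ).Van i) : Acyclic x M i := by
  intro c hc
  obtain ⟨s, hs⟩ := G.exists_sum_cochainProj i c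
  rw [← hs]
  exact Submodule.sum_mem _ fun μ _ => h μ c hc

end Grading
end Grading

/-! ### Induced gradings: kernels, ranges, cokernels, shifts, tensor products -/

section GradingConstructions

variable {R : Type*} {S : Type*} [CommRing R] [CommRing S] [Algebra R S]
variable {n : ℕ} {x : Fin n → S} {w : Fin n → ℤ}

namespace Grading

variable {M N : Type*} [AddCommGroup M] [Module R M] [Module S M] [IsScalarTower R S M]
  [AddCommGroup N] [Module R N] [Module S N] [IsScalarTower R S N]

/-- The grading induced along an injective map with homogeneous image. -/
def ofInjective (G : Grading R x w N) (f : M →ₗ[S] N) (hf : Function.Injective f)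
    (h : ∀ μ m, ∃ m', f m' = G.proj μ (f m)) : Grading R x w M where
  proj μ :=
    { toFun := fun m => (h μ m).choose
      map_add' := fun a b => hf (by
        rw [(h μ (a + b)).choose_spec, map_add, map_add, map_add, (h μ a).choose_spec,
          (h μ b).choose_spec])
      map_smul' := fun r a => hf (by
        rw [(h μ (r • a)).choose_spec, RingHom.id_apply, f.map_smul_of_tower, map_smul,
          f.map_smul_of_tower, (h μ a).choose_spec]) }
  proj_proj μ m := hf (by
    change f (h μ (h μ m).choose).choose = f (h μ m).choose
    rw [(h μ _).choose_spec, (h μ m).choose_spec, G.proj_proj])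
  proj_of_ne μ ν m hμ := hf (by
    change f (h μ (h ν m).choose).choose = f 0
    rw [(h μ _).choose_spec, (h ν m).choose_spec, G.proj_of_ne _ _ _ hμ, map_zero])
  exists_sum m := by
    obtain ⟨s, hs⟩ := G.exists_sum (f m)
    refine ⟨s, hf ?_⟩
    rw [map_sum]
    exact (Finset.sum_congr rfl fun μ _ => (h μ m).choose_spec).trans hs
  proj_smul j μ m := hf (by
    change f (h _ (x j • m)).choose = f (x j • (h μ m).choose)
    rw [(h _ _).choose_spec, f.map_smul, f.map_smul, (h μ m).choose_spec, G.proj_smul])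

theorem compat_ofInjective (G : Grading R x w N) (f : M →ₗ[S] N) (hf : Function.Injective f)
    (h : ∀ μ m, ∃ m', f m' = G.proj μ (f m)) : (G.ofInjective f hf h).Compat G f :=
  fun μ m => (h μ m).choose_spec

/-- The grading induced along a surjective map with homogeneous kernel. -/
def ofSurjective (G : Grading R x w M) (f : M →ₗ[S] N) (hf : Function.Surjective f)
    (h : ∀ μ m, f m = 0 → f (G.proj μ m) = 0) : Grading R x w N :=
  -- Independence of the chosen preimage, because the kernel is homogeneous.
  have key : ∀ μ m, f (G.proj μ (hf (f m)).choose) = f (G.proj μ m) := fun μ m => by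
    rw [← sub_eq_zero, ← map_sub, ← map_sub]
    exact h _ _ (by rw [map_sub, (hf (f m)).choose_spec, sub_self])
  { proj := fun μ =>
      { toFun := fun y => f (G.proj μ (hf y).choose)
        map_add' := fun a b => by
          obtain ⟨a, rfl⟩ := hf a
          obtain ⟨b, rfl⟩ := hf b
          rw [← map_add, key, key, key, map_add, map_add]
        map_smul' := fun r a => by
          obtain ⟨a, rfl⟩ := hf a
          rw [← f.map_smul_of_tower, key, key, map_smul, f.map_smul_of_tower, RingHom.id_apply] }
    proj_proj := fun μ y => by
      obtain ⟨m, rfl⟩ := hf y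
      change f (G.proj μ (hf (f (G.proj μ (hf (f m)).choose))).choose) =
        f (G.proj μ (hf (f m)).choose)
      rw [key, G.proj_proj]
    proj_of_ne := fun μ ν y hμ => by
      obtain ⟨m, rfl⟩ := hf y
      change f (G.proj μ (hf (f (G.proj ν (hf (f m)).choose))).choose) = 0
      rw [key, G.proj_of_ne _ _ _ hμ, map_zero]
    exists_sum := fun y => by
      obtain ⟨m, rfl⟩ := hf y
      obtain ⟨s, hs⟩ := G.exists_sum m
      refine ⟨s, ?_⟩
      conv_rhs => rw [← hs, map_sum]
      exact Finset.sum_congr rfl fun μ _ => key μ m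
    proj_smul := fun j μ y => by
      obtain ⟨m, rfl⟩ := hf y
      change f (G.proj _ (hf (x j • f m)).choose) = x j • f (G.proj μ (hf (f m)).choose)
      rw [← map_smul f, key, key, G.proj_smul, map_smul] }

theorem compat_ofSurjective (G : Grading R x w M) (f : M →ₗ[S] N) (hf : Function.Surjective f)
    (h : ∀ μ m, f m = 0 → f (G.proj μ m) = 0) : G.Compat (G.ofSurjective f hf h) f := fun μ m => by
  change f (G.proj μ m) = f (G.proj μ (hf (f m)).choose)
  rw [← sub_eq_zero, ← map_sub, ← map_sub]
  exact h _ _ (by rw [map_sub, (hf (f m)).choose_spec, sub_self])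

variable {G : Grading R x w M} {G' : Grading R x w N} {f : M →ₗ[S] N}

/-- The grading of the kernel of a homogeneous map. -/
def ker (hf : G.Compat G' f) : Grading R x w (LinearMap.ker f) :=
  G.ofInjective (LinearMap.ker f).subtype Subtype.val_injective fun μ m =>
    ⟨⟨G.proj μ m, by rw [LinearMap.mem_ker, hf, LinearMap.mem_ker.1 m.2, map_zero]⟩, rfl⟩

theorem compat_ker (hf : G.Compat G' f) : (ker hf).Compat G (LinearMap.ker f).subtype :=
  compat_ofInjective _ _ _ _

/-- The grading of the range of a homogeneous map. -/
def range (hf : G.Compat G' f) : Grading R x w (LinearMap.range f) :=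
  G'.ofInjective (LinearMap.range f).subtype Subtype.val_injective fun μ m => by
    obtain ⟨_, m, rfl⟩ := m
    exact ⟨⟨_, G.proj μ m, rfl⟩, hf μ m⟩

theorem compat_range (hf : G.Compat G' f) : (range hf).Compat G' (LinearMap.range f).subtype :=
  compat_ofInjective _ _ _ _

theorem compat_rangeRestrict (hf : G.Compat G' f) : G.Compat (range hf) f.rangeRestrict :=
  fun μ m => Subtype.val_injective (by
    change f (G.proj μ m) = _
    rw [hf]
    exact (compat_range hf μ (f.rangeRestrict m)).symm)

/-- The grading of the cokernel of a homogeneous map. -/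
def coker (hf : G.Compat G' f) : Grading R x w (N ⧸ LinearMap.range f) :=
  G'.ofSurjective (LinearMap.range f).mkQ (Submodule.mkQ_surjective _) fun μ m hm => by
    rw [Submodule.mkQ_apply, Submodule.Quotient.mk_eq_zero] at hm ⊢
    obtain ⟨m, rfl⟩ := hm
    exact ⟨G.proj μ m, hf μ m⟩

theorem compat_coker (hf : G.Compat G' f) : G'.Compat (coker hf) (LinearMap.range f).mkQ :=
  compat_ofSurjective _ _ _ _

/-- The shifted grading. -/
def shift (G : Grading R x w M) (δ : ℤ) : Grading R x w M where
  proj μ := G.proj (μ - δ)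
  proj_proj _ := G.proj_proj _
  proj_of_ne μ ν m h := G.proj_of_ne _ _ m (by simpa using h)
  exists_sum m := by
    obtain ⟨s, hs⟩ := G.exists_sum m
    refine ⟨s.map (addRightEmbedding δ), ?_⟩
    rw [Finset.sum_map]
    simpa using hs
  proj_smul j μ m := by
    rw [← G.proj_smul, add_sub_right_comm]

theorem cochainProj_shift (G : Grading R x w M) (δ μ : ℤ) (i : ℕ) (c : Cochain x M i) :
    (G.shift δ).cochainProj μ i c = G.cochainProj (μ - δ) i c := by
  funext J
  rw [cochainProj_apply, cochainProj_apply]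
  obtain ⟨e, m, h⟩ := exists_pow_smul_eq_toLoc x J.1 (c J)
  apply pow_smul_cancel x (e := e)
  rw [locProj_spec _ _ h, locProj_spec _ _ h]
  change toLoc x M J.1 (G.proj _ m) = _
  rw [add_sub_right_comm]

theorem cohDeg_shift (G : Grading R x w M) (δ μ : ℤ) (i : ℕ) :
    cohDeg x w (G.shift δ).deg i μ = cohDeg x w G.deg i (μ - δ) := by
  ext y
  simp only [mem_cohDeg, cochainProj_shift]

/-- Multiplication by a variable is homogeneous after a shift. -/
theorem compat_smul (G : Grading R x w M) (j : Fin n) :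
    (G.shift (w j)).Compat G (LinearMap.lsmul S M (x j)) := fun μ m => by
  change x j • G.proj (μ - w j) m = G.proj μ (x j • m)
  rw [← G.proj_smul, sub_add_cancel]

/-- The grading of a tensor product with a module in degree `0`. -/
def tensor (G : Grading R x w M) (N : Type*) [AddCommGroup N] [Module R N] :
    Grading R x w (M ⊗[R] N) where
  proj μ := (G.proj μ).rTensor N
  proj_proj μ z := by
    rw [← LinearMap.comp_apply, ← LinearMap.rTensor_comp]
    congr 2
    exact LinearMap.ext (G.proj_proj μ)
  proj_of_ne μ ν z h := by
    rw [← LinearMap.comp_apply, ← LinearMap.rTensor_comp,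
      show G.proj μ ∘ₗ G.proj ν = 0 from LinearMap.ext fun m => G.proj_of_ne μ ν m h,
      LinearMap.rTensor_zero, LinearMap.zero_apply]
  exists_sum z := by
    -- Stated for all larger sets so that two summands can be handled over the union of their sets.
    have : ∃ s : Finset ℤ, ∀ t, s ⊆ t → ∑ μ ∈ t, (G.proj μ).rTensor N z = z := by
      induction z with
      | zero => exact ⟨∅, fun t _ => by simp⟩
      | tmul m y =>
        obtain ⟨s, hs⟩ := G.exists_sum m
        refine ⟨s, fun t ht => ?_⟩
        simp only [LinearMap.rTensor_tmul, ← TensorProduct.sum_tmul, G.sum_proj_of_subset hs ht]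
      | add a b ha hb =>
        obtain ⟨s, hs⟩ := ha
        obtain ⟨s', hs'⟩ := hb
        refine ⟨s ∪ s', fun t ht => ?_⟩
        simp only [map_add, Finset.sum_add_distrib, hs t (Finset.union_subset_left ht),
          hs' t (Finset.union_subset_right ht)]
    obtain ⟨s, hs⟩ := this
    exact ⟨s, hs s subset_rfl⟩
  proj_smul j μ z := by
    induction z with
    | zero => simp
    | tmul m y =>
      rw [TensorProduct.smul_tmul', LinearMap.rTensor_tmul, LinearMap.rTensor_tmul, G.proj_smul,
        TensorProduct.smul_tmul']
    | add a b ha hb => simp only [smul_add, map_add, ha, hb]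

theorem deg_tensor (G : Grading R x w M) (N : Type*) [AddCommGroup N] [Module R N] :
    (G.tensor N).deg = tensorDeg N G.deg := by
  funext μ
  change LinearMap.range ((G.proj μ).rTensor N) =
    LinearMap.range ((LinearMap.range (G.proj μ)).subtype.rTensor N)
  have : G.proj μ = (LinearMap.range (G.proj μ)).subtype ∘ₗ (G.proj μ).rangeRestrict := rfl
  conv_lhs => rw [this, LinearMap.rTensor_comp]
  rw [LinearMap.range_comp_of_range_eq_top]
  exact LinearMap.range_eq_top.2
    (LinearMap.rTensor_surjective N (G.proj μ).surjective_rangeRestrict)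

theorem compat_lTensor (G : Grading R x w M) {N N' : Type*} [AddCommGroup N] [Module R N]
    [AddCommGroup N'] [Module R N'] (g : N →ₗ[R] N') :
    (G.tensor N).Compat (G.tensor N') (TensorProduct.AlgebraTensorModule.lTensor S M g) := by
  intro μ z
  induction z with
  | zero => simp
  | tmul m y => rfl
  | add a b ha hb => simp only [map_add, ha, hb]

theorem compat_tmulRight (G : Grading R x w M) {N : Type*} [AddCommGroup N] [Module R N] (y : N) :
    G.Compat (G.tensor N) (tmulRight M y) := fun _ _ => rfl

/-- The grading given by a decomposition into homogeneous components. -/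
def ofDecomposition (𝓜 : ℤ → Submodule R M) [DirectSum.Decomposition 𝓜]
    (h : ∀ j μ, ∀ m ∈ 𝓜 μ, x j • m ∈ 𝓜 (μ + w j)) : Grading R x w M where
  proj μ := (𝓜 μ).subtype ∘ₗ DirectSum.component R ℤ (fun i => 𝓜 i) μ ∘ₗ
    (DirectSum.decomposeLinearEquiv 𝓜).toLinearMap
  proj_proj μ m := by
    change ((DirectSum.decompose 𝓜 ((DirectSum.decompose 𝓜 m μ : 𝓜 μ) : M)) μ : M) = _
    rw [DirectSum.decompose_coe, DirectSum.of_eq_same]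
    rfl
  proj_of_ne μ ν m hμ := by
    change ((DirectSum.decompose 𝓜 ((DirectSum.decompose 𝓜 m ν : 𝓜 ν) : M)) μ : M) = _
    rw [DirectSum.decompose_coe, DirectSum.of_eq_of_ne _ _ _ hμ]
    rfl
  exists_sum m := by
    classical
    exact ⟨_, DirectSum.sum_support_decompose 𝓜 m⟩
  proj_smul j μ m := by
    change ((DirectSum.decompose 𝓜 (x j • m)) (μ + w j) : M) = x j • (DirectSum.decompose 𝓜 m μ : M)
    induction m using DirectSum.Decomposition.inductionOn 𝓜 with
    | zero => simp
    | @homogeneous ν m =>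
      rw [DirectSum.decompose_of_mem 𝓜 (h j ν m m.2), DirectSum.decompose_coe]
      by_cases hμ : μ = ν
      · subst hμ
        rw [DirectSum.of_eq_same, DirectSum.of_eq_same]
      · rw [DirectSum.of_eq_of_ne _ _ _ hμ, DirectSum.of_eq_of_ne _ _ _ (by simpa using hμ)]
        simp
    | add a b ha hb =>
      rw [smul_add, DirectSum.decompose_add, DirectSum.decompose_add, DirectSum.add_apply,
        DirectSum.add_apply, Submodule.coe_add, Submodule.coe_add, ha, hb, smul_add]

theorem deg_ofDecomposition (𝓜 : ℤ → Submodule R M) [DirectSum.Decomposition 𝓜]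
    (h : ∀ j μ, ∀ m ∈ 𝓜 μ, x j • m ∈ 𝓜 (μ + w j)) : (ofDecomposition 𝓜 h).deg = 𝓜 := by
  funext μ
  ext m
  rw [mem_deg]
  change (DirectSum.decompose 𝓜 m μ : M) = m ↔ m ∈ 𝓜 μ
  constructor
  · intro hm
    rw [← hm]
    exact (DirectSum.decompose 𝓜 m μ).2
  · exact DirectSum.decompose_of_mem_same 𝓜

end Grading
end GradingConstructions

/-! ### Graded pieces of cohomology are finite over `R` and vanish in large degrees -/

section Finiteness

/-- The range of `β` is a quotient of the range of `α`. This substitutes for a connecting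
homomorphism, which need not be constructed as a map. -/
theorem _root_.LinearMap.fg_range_of_ker_le {R V P Q : Type*} [Ring R] [AddCommGroup V]
    [Module R V] [AddCommGroup P] [Module R P] [AddCommGroup Q] [Module R Q]
    (α : V →ₗ[R] P) (β : V →ₗ[R] Q) (h : LinearMap.ker α ≤ LinearMap.ker β)
    (hα : (LinearMap.range α).FG) : (LinearMap.range β).FG := by
  have h1 : Module.Finite R (LinearMap.range α) := Module.Finite.iff_fg.2 hα
  have h2 : Module.Finite R (V ⧸ LinearMap.ker α) :=
    Module.Finite.equiv α.quotKerEquivRange.symm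
  have h3 : Module.Finite R (V ⧸ LinearMap.ker β) :=
    Module.Finite.of_surjective (Submodule.factor h) (Submodule.factor_surjective h)
  exact Module.Finite.iff_fg.1 (Module.Finite.equiv β.quotKerEquivRange)

theorem _root_.Submodule.fg_of_le_of_fg {R V : Type*} [Ring R] [IsNoetherianRing R]
    [AddCommGroup V] [Module R V] {N N' : Submodule R V} (h : N ≤ N') (hN : N'.FG) : N.FG := by
  have : IsNoetherian R N' := isNoetherian_of_fg_of_noetherian _ hN
  have := isNoetherian_of_injective (Submodule.inclusion h) (Submodule.inclusion_injective h)
  exact Module.Finite.iff_fg.1 inferInstance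

namespace Grading

section

variable {R : Type*} {S : Type*} [CommRing R] [CommRing S] [Algebra R S]
variable {n : ℕ} {x : Fin n → S} {w : Fin n → ℤ}
variable {M N L : Type*} [AddCommGroup M] [Module R M] [Module S M] [IsScalarTower R S M]
  [AddCommGroup N] [Module R N] [Module S N] [IsScalarTower R S N]
  [AddCommGroup L] [Module R L] [Module S L] [IsScalarTower R S L]
variable {GM : Grading R x w M} {GN : Grading R x w N} {GP : Grading R x w L}
variable {f : M →ₗ[S] N} {g : N →ₗ[S] L}

theorem cohMap_mem_cohDeg (hf : GM.Compat GN f) {i : ℕ} {μ : ℤ} {y : Coh x M i}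
    (hy : y ∈ cohDeg x w GM.deg i μ) : cohMap x f i y ∈ cohDeg x w GN.deg i μ := by
  obtain ⟨c, hc, h1, rfl⟩ := GM.mem_cohDeg.1 hy
  refine GN.mem_cohDeg.2 ⟨cochainMap x f i c, by rw [d_cochainMap, hc, map_zero], ?_, rfl⟩
  exact (hf.op μ i c).symm.trans (congrArg _ h1)

/-- Exactness at `H^i(N)` within one degree: a lift of the class, given by `exists_lift_of_van`, is
projected to degree `μ`. -/
theorem inf_ker_cohMap_le (hf : GM.Compat GN f) (hfi : Function.Injective f)
    (hfg : Function.Exact f g) (hgs : Function.Surjective g) (i : ℕ) (μ : ℤ) :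
    cohDeg x w GN.deg i μ ⊓ LinearMap.ker ((cohMap x g i).restrictScalars R) ≤
      (cohDeg x w GM.deg i μ).map ((cohMap x f i).restrictScalars R) := by
  rintro y ⟨hy, hgy⟩
  obtain ⟨c, hc, h1, rfl⟩ := GN.mem_cohDeg.1 hy
  have hgc : cochainMap x g i c ∈ boundaries x L i := (cls_eq_zero x).1 hgy
  obtain ⟨a, ha, h⟩ := CochainOp.exists_lift_of_van (W := PUnit) (PW := .one x PUnit) (j := 0)
    (c := c) (fun k b => by rw [Subsingleton.elim b 0]; simp) (hf.op μ)
    (fun _ _ _ => Subsingleton.elim _ _)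
    (fun y => ⟨fun h => ⟨0, hfi (by rw [h]; simp)⟩, by rintro ⟨y, rfl⟩; simp⟩)
    hfg hgs (CochainOp.van_of_subsingleton _ _) hc hgc
  refine ⟨_, GM.cls_cochainProj_mem ha μ, ?_⟩
  refine ((cls_eq x).2 ?_).symm
  have h2 := (GN.op μ).op_boundary h
  rw [map_sub, CochainOp.op_op, op_apply, h1] at h2
  have h3 : cochainMap x f i ((GM.op μ).op i a) = (GN.op μ).op i (cochainMap x f i a) := hf.op μ i a
  change c - cochainMap x f i ((GM.op μ).op i a) ∈ _
  rwa [h3]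

/-- The kernel in question is the image of `H^i(L)_μ` under the connecting homomorphism, so it
inherits finiteness. -/
theorem fg_inf_ker_cohMap [IsNoetherianRing R] (hf : GM.Compat GN f) (hg : GN.Compat GP g)
    (hfi : Function.Injective f) (hfg : Function.Exact f g) (hgs : Function.Surjective g)
    (i : ℕ) (μ : ℤ) (hL : (cohDeg x w GP.deg i μ).FG) :
    (cohDeg x w GM.deg (i + 1) μ ⊓
      LinearMap.ker ((cohMap x f (i + 1)).restrictScalars R)).FG := by
  let fc := cochainMap x f (i + 1)
  let e := (LinearEquiv.ofInjective fc (cochainMap_injective x hfi _)).symm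
  have he : ∀ y, fc (e y) = y.1 := fun y =>
    congrArg Subtype.val
      ((LinearEquiv.ofInjective fc (cochainMap_injective x hfi _)).apply_symm_apply y)
  -- Cochains of `N` of degree `μ` whose differential comes from `M`. The connecting homomorphism
  -- relates the class of `g b`, which is `α b`, to that of the preimage of `d b`, which is `β b`.
  let W : Submodule R (Cochain x N i) :=
    ((LinearMap.range fc).comap (d x N i)).restrictScalars R ⊓ cochainDeg x w GN.deg i μ
  let α : W →ₗ[R] Coh x L i :=
    (((boundaries x L i).submoduleOf (LinearMap.ker (d x L i))).mkQ.restrictScalars R) ∘ₗ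
    { toFun := fun b => (⟨cochainMap x g i b.1, by
          rw [LinearMap.mem_ker, d_cochainMap]
          exact (cochainMap_exact x hfg _ _).2 b.2.1⟩ : LinearMap.ker (d x L i))
      map_add' := fun a b => Subtype.ext (map_add _ _ _)
      map_smul' := fun r a => Subtype.ext ((cochainMap x g i).map_smul_of_tower r a.1) }
  let β : W →ₗ[R] Coh x M (i + 1) :=
    (((boundaries x M (i + 1)).submoduleOf
      (LinearMap.ker (d x M (i + 1)))).mkQ.restrictScalars R) ∘ₗ
    { toFun := fun b => (⟨e ⟨d x N i b.1, b.2.1⟩, by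
          rw [LinearMap.mem_ker]
          apply cochainMap_injective x hfi
          rw [← d_cochainMap]
          change d x N (i + 1) (fc _) = _
          rw [he, d_comp_d, map_zero]⟩ : LinearMap.ker (d x M (i + 1)))
      map_add' := fun a b => Subtype.ext (cochainMap_injective x hfi _ (by
        change fc (e _) = fc (e _ + e _)
        rw [map_add fc, he, he, he]
        exact map_add _ _ _))
      map_smul' := fun r a => Subtype.ext (cochainMap_injective x hfi _ (by
        change fc (e _) = fc (r • e _)
        rw [fc.map_smul_of_tower, he, he]
        exact (d x N i).map_smul_of_tower r a.1)) }
  -- The connecting homomorphism is well defined.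
  have hαβ : LinearMap.ker α ≤ LinearMap.ker β := by
    rintro ⟨b, hb⟩ hbα
    have h1 : cochainMap x g i b ∈ boundaries x L i := (cls_eq_zero x).1 hbα
    refine (cls_eq_zero x).2 ?_
    obtain ⟨b', hb', h2⟩ : ∃ b' ∈ boundaries x N i, cochainMap x g i (b - b') = 0 := by
      clear * - h1 hgs
      cases i with
      | zero =>
        refine ⟨0, Submodule.zero_mem _, ?_⟩
        rw [sub_zero]; exact h1
      | succ i =>
        obtain ⟨e, he⟩ := h1
        obtain ⟨e', rfl⟩ := cochainMap_surjective x hgs i e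
        refine ⟨d x N i e', ⟨e', rfl⟩, ?_⟩
        rw [map_sub, ← d_cochainMap, he, sub_self]
    obtain ⟨a', ha'⟩ := (cochainMap_exact x hfg i _).1 h2
    refine ⟨a', cochainMap_injective x hfi _ ?_⟩
    change _ = fc (e _)
    rw [← d_cochainMap, ha', map_sub, d_boundary x hb', sub_zero, he]
  have hα : (LinearMap.range α).FG := by
    refine Submodule.fg_of_le_of_fg ?_ hL
    rintro _ ⟨b, rfl⟩
    exact GP.mem_cohDeg.2 ⟨cochainMap x g i b.1, _,
      (hg.op μ i b.1).symm.trans (congrArg _ (GN.mem_cochainDeg.1 b.2.2)), rfl⟩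
  have hβ := LinearMap.fg_range_of_ker_le α β hαβ hα
  refine Submodule.fg_of_le_of_fg ?_ hβ
  rintro y ⟨hy, hfy⟩
  obtain ⟨a, ha, h1, rfl⟩ := GM.mem_cohDeg.1 hy
  obtain ⟨b, hb⟩ : fc a ∈ boundaries x N (i + 1) := (cls_eq_zero x).1 hfy
  have h2 : d x N i (GN.cochainProj μ i b) = fc a := by
    rw [d_cochainProj, hb]
    exact (hf.op μ (i + 1) a).symm.trans (congrArg _ h1)
  refine ⟨⟨GN.cochainProj μ i b, ⟨a, h2.symm⟩, GN.mem_cochainDeg.2 ((GN.op μ).op_op i b)⟩, ?_⟩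
  refine (cls_eq x).2 ?_
  convert Submodule.zero_mem _
  rw [sub_eq_zero]
  apply cochainMap_injective x hfi
  change fc (e _) = _
  rw [he]
  exact h2

end

section

variable {R : Type*} [CommRing R] [IsNoetherianRing R] {n : ℕ} {w : Fin n → ℤ}

/-- Cohomology is finitely generated in each degree, and vanishes in large degrees. -/
def FinBdd {M : Type*} [AddCommGroup M] [Module R M] [Module (MvPolynomial (Fin n) R) M]
    [IsScalarTower R (MvPolynomial (Fin n) R) M]
    (G : Grading R (vars R n) w M) : Prop :=
  (∀ i μ, (cohDeg (vars R n) w G.deg i μ).FG) ∧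
    ∃ μ₀ : ℤ, ∀ μ, μ₀ < μ → ∀ i, (G.op μ).Van i

variable {M : Type v} [AddCommGroup M] [Module R M] [Module (MvPolynomial (Fin n) R) M]
  [IsScalarTower R (MvPolynomial (Fin n) R) M]

/-- A polynomial acts through its constant coefficient, so generators over the polynomial ring
already generate over `R`. -/
theorem finite_of_smul_eq_zero [Module.Finite (MvPolynomial (Fin n) R) M]
    (h : ∀ j (m : M), vars R n j • m = 0) :
    Module.Finite R M := by
  obtain ⟨s, hs⟩ := Module.Finite.fg_top (R := (MvPolynomial (Fin n) R)) (M := M)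
  refine ⟨s, ?_⟩
  rw [eq_top_iff]
  intro m _
  have key : ∀ (p : MvPolynomial (Fin n) R) (m : M), p • m = MvPolynomial.constantCoeff p • m := by
    intro p m
    induction p using MvPolynomial.induction_on with
    | C a => rw [MvPolynomial.constantCoeff_C, ← MvPolynomial.algebraMap_eq, algebraMap_smul]
    | add p q hp hq => rw [add_smul, hp, hq, map_add, add_smul]
    | mul_X p j hp => rw [mul_smul, h, smul_zero]; simp
  have hm : m ∈ Submodule.span (MvPolynomial (Fin n) R) (s : Set M) := hs ▸ Submodule.mem_top
  induction hm using Submodule.span_induction with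
  | mem m hm => exact Submodule.subset_span hm
  | zero => exact Submodule.zero_mem _
  | add a b _ _ ha hb => exact Submodule.add_mem _ (ha trivial) (hb trivial)
  | smul p m _ hm => rw [key]; exact Submodule.smul_mem _ _ (hm trivial)

/-- All localizations at nonempty `J` vanish, so only `M` itself in cohomological degree `0` is
left; it is finite over `R`, and finitely many generators occupy finitely many degrees. -/
theorem finBdd_of_smul_eq_zero [Module.Finite (MvPolynomial (Fin n) R) M]
    (G : Grading R (vars R n) w M)
    (h : ∀ j (m : M), vars R n j • m = 0) : G.FinBdd := by
  have hfin := finite_of_smul_eq_zero h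
  have hloc : ∀ J : Finset (Fin n), J.Nonempty → Subsingleton (Loc (vars R n) M J) := by
    intro J ⟨j, hj⟩
    refine subsingleton_of_forall_eq 0 fun z => ?_
    obtain ⟨e, m, hm⟩ := exists_pow_smul_eq_toLoc (vars R n) J z
    apply pow_smul_cancel (vars R n) (e := e)
    rw [hm, smul_zero, toLoc_eq_zero_iff]
    refine ⟨1, ?_⟩
    rw [pow_one, ← Finset.prod_erase_mul _ _ hj, mul_smul, h, smul_zero]
  have hnoeth : ∀ J : Finset (Fin n), IsNoetherian R (Loc (vars R n) M J) := by
    intro J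
    obtain rfl | hJ := J.eq_empty_or_nonempty
    · refine isNoetherian_of_surjective (f := (toLoc (vars R n) M ∅).restrictScalars R) ?_
      rw [LinearMap.range_eq_top]
      intro z
      obtain ⟨e, m, hm⟩ := exists_pow_smul_eq_toLoc (vars R n) ∅ z
      exact ⟨m, by simpa using hm.symm⟩
    · have := hloc J hJ
      infer_instance
  constructor
  · intro i μ
    have : IsNoetherian R (Cochain (vars R n) M i) := isNoetherian_pi
    have : IsNoetherian R (LinearMap.ker (d (vars R n) M i)) :=
      isNoetherian_of_injective ((LinearMap.ker (d (vars R n) M i)).subtype.restrictScalars R)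
        Subtype.val_injective
    exact Submodule.FG.map _ (IsNoetherian.noetherian _)
  · obtain ⟨s, hs⟩ := Module.Finite.fg_top (R := R) (M := M)
    choose t ht using G.exists_sum
    obtain ⟨μ₀, hμ₀⟩ := (s.biUnion t).bddAbove
    refine ⟨μ₀, fun μ hμ i c _ => ?_⟩
    have hp : G.proj μ = 0 := by
      refine LinearMap.ext_on hs fun y hy => ?_
      rw [LinearMap.zero_apply]
      refine G.proj_eq_zero_of_notMem (ht y) fun hy' => ?_
      exact absurd (hμ₀ (Finset.mem_coe.2 (Finset.mem_biUnion.2 ⟨y, hy, hy'⟩))) (not_le.2 hμ)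
    have : (G.op μ).op i c = 0 := by
      funext J
      change G.locProj J.1 μ (c J) = 0
      obtain hJ | hJ := J.1.eq_empty_or_nonempty
      · obtain ⟨e, m, hm⟩ := exists_pow_smul_eq_toLoc (vars R n) J.1 (c J)
        apply pow_smul_cancel (vars R n) (e := e)
        rw [G.locProj_spec _ hm, hJ]
        simp [hp]
      · have := hloc J.1 hJ
        exact Subsingleton.elim _ _
    rw [this]
    exact Submodule.zero_mem _

/-- Multiplication by `X_j` is factored through its range. In large degrees it is injective on
cohomology, because the cohomology of its kernel and cokernel vanishes there; every class is killed
by a power of `X_j`, so cohomology vanishes there. Finiteness then descends from degree `μ + w j` to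
degree `μ`, up to finite kernels. -/
theorem finBdd_of_ker_coker (hw : ∀ j, 0 < w j) (G : Grading R (vars R n) w M) (j : Fin n)
    (hK : (Grading.ker (G.compat_smul j)).FinBdd) (hC : (Grading.coker (G.compat_smul j)).FinBdd) :
    G.FinBdd := by
  set X := LinearMap.lsmul (MvPolynomial (Fin n) R) M (vars R n j) with hX
  have hcK := compat_ker (G.compat_smul j)
  have hcp := compat_rangeRestrict (G.compat_smul j)
  have hcr := compat_range (G.compat_smul j)
  have hcC := compat_coker (G.compat_smul j)
  have exK : Function.Exact (LinearMap.ker X).subtype X.rangeRestrict := by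
    rw [LinearMap.exact_iff, LinearMap.ker_rangeRestrict, Submodule.range_subtype]
  have exC : Function.Exact (LinearMap.range X).subtype (LinearMap.range X).mkQ := by
    rw [LinearMap.exact_iff, Submodule.ker_mkQ, Submodule.range_subtype]
  have hsub : ∀ i (c : Cochain (vars R n) M i), cochainMap (vars R n) (LinearMap.range X).subtype i
      (cochainMap (vars R n) X.rangeRestrict i c) = vars R n j • c := by
    intro i c
    rw [← cochainMap_comp, show (LinearMap.range X).subtype ∘ₗ X.rangeRestrict =
      vars R n j • LinearMap.id from rfl, cochainMap_smul, cochainMap_id]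
  have hsub' : ∀ i (y : Coh (vars R n) M i), cohMap (vars R n) (LinearMap.range X).subtype i
      (cohMap (vars R n) X.rangeRestrict i y) = vars R n j • y := by
    intro i y
    rw [← cohMap_comp, show (LinearMap.range X).subtype ∘ₗ X.rangeRestrict =
      vars R n j • LinearMap.id from rfl, cohMap_smul, cohMap_id]
  obtain ⟨hK1, μK, hK2⟩ := hK
  obtain ⟨hC1, μC, hC2⟩ := hC
  -- `H^i(M) → H^i(range)` is injective in degree `μ` by the bound for the kernel, `H^i(range) →
  -- H^i(M)` by that for the cokernel.
  have hinj : ∀ μ, max μK μC < μ → ∀ i (c : Cochain (vars R n) M i), d (vars R n) M i c = 0 →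
      vars R n j • c ∈ boundaries (vars R n) M i → G.cochainProj (μ - w j) i c ∈
        boundaries (vars R n) M i := by
    intro μ hμ i c hc hxc
    rw [← hsub] at hxc
    have hdpc : d (vars R n) (LinearMap.range X) i
        (cochainMap (vars R n) X.rangeRestrict i c) = 0 := by
      rw [d_cochainMap, hc, map_zero]
    have h1 : ((Grading.range (G.compat_smul j)).op μ).op i
        (cochainMap (vars R n) X.rangeRestrict i c) ∈ boundaries (vars R n) _ i := by
      cases i with
      | zero =>
        have h2 : cochainMap (vars R n) X.rangeRestrict 0 c = 0 := by
          apply cochainMap_injective (vars R n) (LinearMap.range X).injective_subtype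
          rw [(mem_boundaries_zero _).1 hxc, map_zero]
        rw [h2, map_zero]
        exact Submodule.zero_mem _
      | succ i =>
        exact CochainOp.op_mem_boundaries_of_van (hcr.op μ) (hcC.op μ)
          (LinearMap.range X).injective_subtype exC (Submodule.mkQ_surjective _)
          (hC2 μ (lt_of_le_of_lt (le_max_right _ _) hμ) i) hxc
    rw [← hcp.op] at h1
    have h2 := CochainOp.op_mem_boundaries_of_exact (hcK.op μ) (LinearMap.ker X).injective_subtype
      exK X.surjective_rangeRestrict (hK2 μ (lt_of_le_of_lt (le_max_left _ _) hμ) i)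
      (by rw [CochainOp.d_op, hc, map_zero]) h1
    rwa [CochainOp.op_op, op_apply, cochainProj_shift] at h2
  have hbdd : ∀ μ, max μK μC < μ → ∀ i, (G.op μ).Van i := by
    intro μ hμ i c hc
    have key : ∀ (e : ℕ) (μ : ℤ) (c : Cochain (vars R n) M i), max μK μC < μ →
        G.cochainProj μ i c = c → d (vars R n) M i c = 0 →
        vars R n j ^ e • c ∈ boundaries (vars R n) M i → c ∈ boundaries (vars R n) M i := by
      intro e
      induction e with
      | zero => intro μ c _ _ _ h; simpa using h
      | succ e ih =>
        intro μ c hμ hcμ hc h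
        rw [pow_succ, mul_smul] at h
        have h1 := ih (μ + w j) (vars R n j • c) (hμ.trans (by linarith [hw j]))
          (by rw [cochainProj_smul, hcμ]) (by rw [map_smul, hc, smul_zero]) h
        have h2 := hinj (μ + w j) (hμ.trans (by linarith [hw j])) i c hc h1
        rwa [add_sub_cancel_right, hcμ] at h2
    obtain ⟨e, he⟩ := exists_pow_smul_mem_boundaries (vars R n) j _ (G.d_cochainProj_eq_zero hc μ)
    exact key e μ _ hμ ((G.op μ).op_op i c) (G.d_cochainProj_eq_zero hc μ) he
  refine ⟨fun i μ => ?_, _, hbdd⟩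
  -- Induction on the distance `k` to the range of vanishing; one step raises the degree by `w j ≥
  -- 1`.
  suffices H : ∀ (k : ℕ) (μ : ℤ), max μK μC < μ + k → (cohDeg (vars R n) w G.deg i μ).FG by
    refine H (max μK μC + 1 - μ).toNat μ ?_
    have := Int.self_le_toNat (max μK μC + 1 - μ)
    linarith
  intro k
  induction k with
  | zero =>
    intro μ hμ
    rw [G.cohDeg_eq_bot_iff.2 (hbdd μ (by simpa using hμ) i)]
    exact Submodule.fg_bot
  | succ k ih =>
    intro μ hμ
    have h1 : (cohDeg (vars R n) w G.deg i (μ + w j)).FG := ih _ (by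
      push_cast at hμ
      linarith [hw j, Int.add_one_le_iff.2 (hw j)])
    have h2 : (cohDeg (vars R n) w (Grading.range (G.compat_smul j)).deg i (μ + w j)).FG := by
      refine Submodule.fg_of_fg_map_of_fg_inf_ker
        ((cohMap (vars R n) (LinearMap.range X).subtype i).restrictScalars R) ?_ ?_
      · refine Submodule.fg_of_le_of_fg ?_ h1
        rintro _ ⟨y, hy, rfl⟩
        exact cohMap_mem_cohDeg hcr hy
      · cases i with
        | zero =>
          convert Submodule.fg_bot
          rw [eq_bot_iff]
          rintro y ⟨-, hy⟩
          obtain ⟨c, hc, rfl⟩ := exists_cls _ y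
          have h3 : cochainMap (vars R n) (LinearMap.range X).subtype 0 c = 0 :=
            (mem_boundaries_zero _).1 ((cls_eq_zero _).1 hy)
          have h4 : c = 0 := cochainMap_injective _ (LinearMap.range X).injective_subtype 0
            (by rw [h3, map_zero])
          exact (cls_eq_zero _).2 ((mem_boundaries_zero _).2 h4)
        | succ i =>
          exact fg_inf_ker_cohMap hcr hcC (LinearMap.range X).injective_subtype exC
            (Submodule.mkQ_surjective _) i _ (hC1 i _)
    have h3 : cohDeg (vars R n) w G.deg i μ =
        cohDeg (vars R n) w (G.shift (w j)).deg i (μ + w j) := by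
      rw [cohDeg_shift, add_sub_cancel_right]
    rw [h3]
    refine Submodule.fg_of_fg_map_of_fg_inf_ker
        ((cohMap (vars R n) X.rangeRestrict i).restrictScalars R) ?_ ?_
    · refine Submodule.fg_of_le_of_fg ?_ h2
      rintro _ ⟨y, hy, rfl⟩
      exact cohMap_mem_cohDeg hcp hy
    · have h4 := hK1 i (μ + w j)
      exact Submodule.fg_of_le_of_fg (inf_ker_cohMap_le hcK (LinearMap.ker X).injective_subtype exK
        X.surjective_rangeRestrict i _) (h4.map
        ((cohMap (vars R n) (LinearMap.ker X).subtype i).restrictScalars R))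

/-- Induction on the set `T` of variables that may act nontrivially: kernel and cokernel of `X_j`
are both killed by `X_j`, which removes `j` from `T`. -/
theorem finBdd (hw : ∀ j, 0 < w j) [Module.Finite (MvPolynomial (Fin n) R) M]
    (G : Grading R (vars R n) w M) :
    G.FinBdd := by
  suffices H : ∀ (T : Finset (Fin n)) (M : Type v) [AddCommGroup M] [Module R M]
      [Module (MvPolynomial (Fin n) R) M]
      [IsScalarTower R (MvPolynomial (Fin n) R) M] [Module.Finite (MvPolynomial (Fin n) R) M]
      (G : Grading R (vars R n) w M),
      (∀ j ∉ T, ∀ m : M, vars R n j • m = 0) → G.FinBdd from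
    H Finset.univ M G fun j hj => absurd (Finset.mem_univ j) hj
  intro T
  induction T using Finset.induction_on with
  | empty =>
    intro M _ _ _ _ _ G h
    exact finBdd_of_smul_eq_zero G fun j => h j (Finset.notMem_empty j)
  | insert j T hj ih =>
    intro M _ _ _ _ _ G h
    have : IsNoetherian (MvPolynomial (Fin n) R) M := isNoetherian_of_isNoetherianRing_of_finite _ _
    refine finBdd_of_ker_coker hw G j (ih _ _ ?_) (ih _ _ ?_)
    · rintro k hk ⟨m, hm⟩
      by_cases hkj : k = j
      · subst hkj; exact Subtype.ext hm
      · exact Subtype.ext (h k (by simp [hk, hkj]) m)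
    · intro k hk m
      obtain ⟨m, rfl⟩ := Submodule.mkQ_surjective _ m
      rw [← map_smul]
      by_cases hkj : k = j
      · subst hkj
        rw [Submodule.mkQ_apply, Submodule.Quotient.mk_eq_zero]
        exact ⟨m, rfl⟩
      · rw [h k (by simp [hk, hkj]) m, map_zero]

end
end Grading
end Finiteness

/-! ### Grothendieck vanishing -/

section Vanishing

open scoped Pointwise

variable {S : Type*} [CommRing S] {n : ℕ} (x : Fin n → S)
variable {N : Type*} [AddCommGroup N] [Module S N]

theorem exact_lsmul_mkQ (N : Type*) [AddCommGroup N] [Module S N] (y : S) :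
    Function.Exact (LinearMap.lsmul S N y) (Submodule.mkQ (y • (⊤ : Submodule S N))) := by
  intro m
  rw [Submodule.mkQ_apply, Submodule.Quotient.mk_eq_zero,
    Submodule.mem_smul_pointwise_iff_exists]
  simp

theorem cochainMap_lsmul (y : S) (i : ℕ) (c : Cochain x N i) :
    cochainMap x (LinearMap.lsmul S N y) i c = y • c := by
  rw [show LinearMap.lsmul S N y = y • LinearMap.id from rfl, cochainMap_smul, cochainMap_id]

/-- Every class of Čech cohomology is annihilated by a power of each element of the ideal. -/
theorem exists_pow_smul_mem_boundaries_of_mem {y : S} (hy : y ∈ Ideal.span (Set.range x)) {i : ℕ}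
    (c : Cochain x N i) (hc : d x N i c = 0) : ∃ e : ℕ, y ^ e • c ∈ boundaries x N i := by
  let I : Ideal S := (boundaries x N i).comap (LinearMap.toSpanSingleton S _ c)
  have : Ideal.span (Set.range x) ≤ I.radical := by
    rw [Ideal.span_le]
    rintro _ ⟨j, rfl⟩
    exact exists_pow_smul_mem_boundaries x j c hc
  exact this hy

/-- Every class is killed by a power of `y`, so injectivity of `y` on cohomology already forces
cohomology to vanish. -/
theorem mem_boundaries_of_torsion {y : S} (hy : y ∈ Ideal.span (Set.range x)) {i : ℕ}
    (h : ∀ c : Cochain x N i, d x N i c = 0 → y • c ∈ boundaries x N i → c ∈ boundaries x N i) :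
    Acyclic x N i := by
  intro c hc
  obtain ⟨e, he⟩ := exists_pow_smul_mem_boundaries_of_mem x hy c hc
  induction e with
  | zero => simpa using he
  | succ e ih =>
    rw [pow_succ', mul_smul] at he
    exact ih (h _ (by rw [map_smul, hc, smul_zero]) he)

theorem acyclic_zero_of_isSMulRegular {y : S} (hy : y ∈ Ideal.span (Set.range x))
    (hreg : IsSMulRegular N y) : Acyclic x N 0 := by
  refine mem_boundaries_of_torsion x hy fun c _ h => ?_
  rw [mem_boundaries_zero] at h ⊢
  apply cochainMap_injective x (f := LinearMap.lsmul S N y) hreg 0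
  rw [cochainMap_lsmul, h, map_zero]

/-- From `0 → N → N → N / yN → 0`: the vanishing of `H^i(N / yN)` makes `y` injective on
`H^{i+1}(N)`. -/
theorem acyclic_succ_of_isSMulRegular {y : S} (hy : y ∈ Ideal.span (Set.range x))
    (hreg : IsSMulRegular N y) {i : ℕ} (h : Acyclic x (QuotSMulTop y N) i) :
    Acyclic x N (i + 1) := by
  refine mem_boundaries_of_torsion x hy fun c _ hyc => ?_
  rw [← cochainMap_lsmul] at hyc
  exact CochainOp.op_mem_boundaries_of_van (CochainOp.compat_one (LinearMap.lsmul S N y))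
    (CochainOp.compat_one (Submodule.mkQ (y • (⊤ : Submodule S N)))) hreg
    (exact_lsmul_mkQ N y) (Submodule.mkQ_surjective _) h hyc

/-- All terms of the complex in positive degree are zero. -/
theorem acyclic_succ_of_torsion (h : ∀ j, ∀ m : N, ∃ e : ℕ, x j ^ e • m = 0) (i : ℕ) :
    Acyclic x N (i + 1) := by
  intro c _
  have : c = 0 := by
    funext J
    obtain ⟨j, hj⟩ := Finset.card_pos.1 (by rw [J.2]; exact i.succ_pos)
    obtain ⟨e, m, hm⟩ := exists_pow_smul_eq_toLoc x J.1 (c J)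
    apply pow_smul_cancel x (e := e)
    rw [hm, Pi.zero_apply, smul_zero, toLoc_eq_zero_iff]
    obtain ⟨k, hk⟩ := h j m
    refine ⟨k, ?_⟩
    rw [← Finset.prod_erase_mul _ _ hj, mul_pow, mul_smul, hk, smul_zero]
  rw [this]
  exact Submodule.zero_mem _

/-- The elements annihilated by a power of each `x j`. -/
def powTorsion (N : Type*) [AddCommGroup N] [Module S N] : Submodule S N where
  carrier := {m | ∀ j, ∃ e : ℕ, x j ^ e • m = 0}
  zero_mem' j := ⟨0, smul_zero _⟩
  add_mem' := fun {a b} ha hb j => by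
    obtain ⟨e, he⟩ := ha j
    obtain ⟨e', he'⟩ := hb j
    exact ⟨e + e', by
      rw [smul_add, pow_add, mul_smul, mul_smul, he', smul_comm, he, smul_zero, smul_zero,
        add_zero]⟩
  smul_mem' s a ha j := by
    obtain ⟨e, he⟩ := ha j
    exact ⟨e, by rw [smul_comm, he, smul_zero]⟩

/-- Outside its torsion, a finite module has a regular element in the ideal. -/
theorem exists_isSMulRegular [IsNoetherianRing S] [Module.Finite S N] :
    ∃ y ∈ Ideal.span (Set.range x), IsSMulRegular (N ⧸ powTorsion x N) y := by
  -- Over a Noetherian ring a regular element exists in the ideal once nothing nonzero in the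
  -- quotient is killed by the ideal. A lift of such an element has all `x j` multiples torsion, so
  -- it is torsion itself.
  have h : Subsingleton ((S ⧸ Ideal.span (Set.range x)) →ₗ[S] (N ⧸ powTorsion x N)) := by
    refine subsingleton_of_forall_eq 0 fun φ => ?_
    refine LinearMap.ext fun s => ?_
    obtain ⟨s, rfl⟩ := Ideal.Quotient.mk_surjective s
    obtain ⟨m, hm⟩ := Submodule.mkQ_surjective _ (φ (Ideal.Quotient.mk _ s))
    rw [LinearMap.zero_apply, ← hm, Submodule.mkQ_apply, Submodule.Quotient.mk_eq_zero]
    intro j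
    have h1 : x j • m ∈ powTorsion x N := by
      rw [← Submodule.Quotient.mk_eq_zero, ← Submodule.mkQ_apply, map_smul, hm, ← map_smul]
      convert map_zero φ
      rw [Algebra.smul_def, Ideal.Quotient.algebraMap_eq, ← map_mul, Ideal.Quotient.eq_zero_iff_mem]
      exact Ideal.mul_mem_right _ _ (Ideal.subset_span ⟨j, rfl⟩)
    obtain ⟨e, he⟩ := h1 j
    exact ⟨e + 1, by rw [pow_succ, mul_smul, he]⟩
  obtain ⟨y, hy, hreg⟩ := IsSMulRegular.subsingleton_linearMap_iff.1 h
  exact ⟨y, by rwa [Ideal.annihilator_quotient] at hy, hreg⟩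

/-- Grothendieck's vanishing theorem for Čech cohomology. -/
theorem acyclic_of_supportDim_lt [IsNoetherianRing S] [Module.Finite S N] {i : ℕ}
    (h : Module.supportDim S N < i) : Acyclic x N i := by
  induction i generalizing N with
  | zero =>
    -- A dimension below `0` can only be `⊥`, which means `N = 0`.
    have h1 : Module.supportDim S N = ⊥ := by
      by_contra h2
      obtain ⟨a, ha⟩ := WithBot.ne_bot_iff_exists.1 h2
      rw [← ha] at h
      exact absurd (WithBot.coe_lt_coe.1 h) (not_lt.2 (zero_le (a := a)))
    have := Module.supportDim_eq_bot_iff_subsingleton S N |>.1 h1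
    exact CochainOp.van_of_subsingleton (.one x N) 0
  | succ i ih =>
    -- The torsion submodule has no cohomology in positive degree, and on the quotient by it a
    -- regular element lowers the dimension by one.
    obtain ⟨y, hy, hreg⟩ := exists_isSMulRegular x (N := N)
    have h1 := Module.supportDim_quotSMulTop_succ_le_of_notMem_minimalPrimes (R := S)
      (M := N ⧸ powTorsion x N) (x := y) fun _ => hreg.notMem_of_mem_minimalPrimes
    have h2 : Module.supportDim S (N ⧸ powTorsion x N) ≤ Module.supportDim S N :=
      Module.supportDim_le_of_surjective _ (Submodule.mkQ_surjective _)
    have h3 : Module.supportDim S (QuotSMulTop y (N ⧸ powTorsion x N)) < i := by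
      have := lt_of_le_of_lt (h1.trans h2) h
      push_cast at this
      exact lt_of_add_lt_add_right this
    exact CochainOp.van_of_exact (CochainOp.compat_one (powTorsion x N).subtype)
      (CochainOp.compat_one (powTorsion x N).mkQ) (powTorsion x N).injective_subtype
      (by rw [LinearMap.exact_iff, Submodule.ker_mkQ, Submodule.range_subtype])
      (Submodule.mkQ_surjective _)
      (acyclic_succ_of_torsion x (fun j m => by
        obtain ⟨e, he⟩ := m.2 j
        exact ⟨e, Subtype.ext he⟩) i)
      (acyclic_succ_of_isSMulRegular x hy hreg (ih h3))

end Vanishing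

/-! ### The polynomial ring modulo `𝔪` and some variables; separating functionals -/

section PolynomialRing

open MvPolynomial IsLocalRing
open scoped Pointwise

section Quotients

variable {S : Type*} [CommRing S]

/-- `(S / I) / y (S / I) = S / (I + (y))`. -/
def quotSMulTopQuotientEquiv (I : Ideal S) (y : S) :
    (S ⧸ (I ⊔ Ideal.span {y})) ≃ₗ[S] QuotSMulTop y (S ⧸ I) :=
  have hq : Function.Surjective ((y • (⊤ : Submodule S (S ⧸ I))).mkQ ∘ₗ I.mkQ) :=
    (Submodule.mkQ_surjective _).comp (Submodule.mkQ_surjective _)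
  (Submodule.quotEquivOfEq _ _ (by
    ext s
    rw [LinearMap.mem_ker, LinearMap.comp_apply, Submodule.mkQ_apply, Submodule.mkQ_apply,
      Submodule.Quotient.mk_eq_zero, Submodule.mem_smul_pointwise_iff_exists, Submodule.mem_sup]
    constructor
    · rintro ⟨a, ha, b, hb, rfl⟩
      obtain ⟨t, rfl⟩ := Ideal.mem_span_singleton'.1 hb
      refine ⟨Submodule.Quotient.mk t, trivial, ?_⟩
      rw [← Submodule.Quotient.mk_smul, Submodule.Quotient.mk_add,
        (Submodule.Quotient.mk_eq_zero I).2 ha, zero_add, smul_eq_mul, mul_comm]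
    · rintro ⟨t, -, ht⟩
      obtain ⟨t, rfl⟩ := Submodule.Quotient.mk_surjective _ t
      rw [← Submodule.Quotient.mk_smul, eq_comm, Submodule.Quotient.eq] at ht
      exact ⟨_, ht, y * t, Ideal.mem_span_singleton'.2 ⟨t, mul_comm _ _⟩, by simp⟩)).trans
    (LinearMap.quotKerEquivOfSurjective _ hq)

theorem isSMulRegular_quotient_iff {I : Ideal S} {y : S} :
    IsSMulRegular (S ⧸ I) y ↔ ∀ s, y * s ∈ I → s ∈ I := by
  rw [isSMulRegular_iff_right_eq_zero_of_smul]
  constructor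
  · intro h s hs
    exact (Submodule.Quotient.mk_eq_zero I).1 (h (Submodule.Quotient.mk s) (by
      rw [← Submodule.Quotient.mk_smul]
      exact (Submodule.Quotient.mk_eq_zero I).2 hs))
  · intro h m hm
    obtain ⟨s, rfl⟩ := Submodule.Quotient.mk_surjective _ m
    rw [← Submodule.Quotient.mk_smul, Submodule.Quotient.mk_eq_zero] at hm
    exact (Submodule.Quotient.mk_eq_zero I).2 (h s hm)

end Quotients

variable {R : Type*} [CommRing R] [IsLocalRing R] {n : ℕ}

/-- Reduction modulo the maximal ideal, with the variables in `T` set to zero. -/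
def killVars (R : Type*) [CommRing R] [IsLocalRing R] {n : ℕ} (T : Finset (Fin n)) :
    MvPolynomial (Fin n) R →+* MvPolynomial (Fin n) (ResidueField R) :=
  eval₂Hom (C.comp (residue R)) fun j => if j ∈ T then 0 else X j

theorem killVars_X_of_mem {T : Finset (Fin n)} {j : Fin n} (hj : j ∈ T) :
    killVars R T (X j) = 0 := by simp [killVars, hj]

theorem killVars_X_of_notMem {T : Finset (Fin n)} {j : Fin n} (hj : j ∉ T) :
    killVars R T (X j) = X j := by simp [killVars, hj]

/-- Substituting `0` for `X_j` changes a polynomial by a multiple of `X_j`, and killing `T ∪ {j}` is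
this substitution followed by killing `T`. -/
theorem ker_killVars_insert {T : Finset (Fin n)} (j : Fin n) :
    RingHom.ker (killVars R (insert j T)) = RingHom.ker (killVars R T) ⊔ Ideal.span {X j} := by
  apply le_antisymm
  · intro p hp
    let σ : MvPolynomial (Fin n) R →ₐ[R] MvPolynomial (Fin n) R :=
      aeval fun i => if i = j then 0 else X i
    have h1 : ∀ p, killVars R (insert j T) p = killVars R T (σ p) := by
      intro p
      refine RingHom.congr_fun (f := killVars R (insert j T))
        (g := (killVars R T).comp σ.toRingHom) ?_ p
      refine MvPolynomial.ringHom_ext (fun r => by simp [killVars, σ]) fun i => ?_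
      by_cases hij : i = j
      · subst hij; simp [killVars, σ]
      · simp [killVars, σ, hij]
    have h2 : ∀ p, p - σ p ∈ Ideal.span {(X j : MvPolynomial (Fin n) R)} := by
      intro p
      rw [← Ideal.Quotient.eq_zero_iff_mem, map_sub, sub_eq_zero]
      refine RingHom.congr_fun (f := Ideal.Quotient.mk _)
        (g := (Ideal.Quotient.mk (Ideal.span {(X j : MvPolynomial (Fin n) R)})).comp σ.toRingHom)
        ?_ p
      refine MvPolynomial.ringHom_ext (fun r => by simp [σ]) fun i => ?_
      by_cases hij : i = j
      · subst hij
        simp [σ]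
      · simp [σ, hij]
    rw [RingHom.mem_ker, h1] at hp
    exact Submodule.mem_sup.2 ⟨σ p, hp, _, h2 p, by ring⟩
  · refine sup_le ?_ ?_
    · intro p hp
      let τ : MvPolynomial (Fin n) (ResidueField R) →+* MvPolynomial (Fin n) (ResidueField R) :=
        eval₂Hom C fun i => if i = j then 0 else X i
      have h1 : killVars R (insert j T) = τ.comp (killVars R T) := by
        refine MvPolynomial.ringHom_ext (fun r => by simp [killVars, τ]) fun i => ?_
        by_cases hij : i = j
        · subst hij
          by_cases hiT : i ∈ T <;> simp [killVars, τ, hiT]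
        · by_cases hiT : i ∈ T <;> simp [killVars, τ, hij, hiT]
      rw [RingHom.mem_ker] at hp ⊢
      rw [h1, RingHom.comp_apply, hp, map_zero]
    · rw [Ideal.span_singleton_le_iff_mem, RingHom.mem_ker]
      exact killVars_X_of_mem (Finset.mem_insert_self _ _)

/-- The quotient embeds in a polynomial ring over a field, so a variable outside `T` is a
nonzerodivisor on it. Killing that variable trades one cohomological degree for one element of `T`.
-/
theorem acyclic_ker_killVars (i : ℕ) (T : Finset (Fin n)) (h : i + T.card < n) :
    Acyclic (vars R n) (MvPolynomial (Fin n) R ⧸ RingHom.ker (killVars R T)) i := by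
  induction i generalizing T with
  | zero =>
    obtain ⟨j, hj⟩ : ∃ j, j ∉ T := by
      by_contra! hT
      have := Finset.card_le_card (fun j _ => hT j : Finset.univ ⊆ T)
      simp at this
      omega
    refine acyclic_zero_of_isSMulRegular (vars R n) (Ideal.subset_span ⟨j, rfl⟩) ?_
    rw [isSMulRegular_quotient_iff]
    intro s hs
    rw [RingHom.mem_ker, map_mul, killVars_X_of_notMem hj] at hs
    exact (mul_eq_zero.1 hs).resolve_left (X_ne_zero j)
  | succ i ih =>
    obtain ⟨j, hj⟩ : ∃ j, j ∉ T := by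
      by_contra! hT
      have := Finset.card_le_card (fun j _ => hT j : Finset.univ ⊆ T)
      simp at this
      omega
    refine acyclic_succ_of_isSMulRegular (vars R n) (Ideal.subset_span ⟨j, rfl⟩) ?_ ?_
    · rw [isSMulRegular_quotient_iff]
      intro s hs
      rw [RingHom.mem_ker, map_mul, killVars_X_of_notMem hj] at hs
      exact (mul_eq_zero.1 hs).resolve_left (X_ne_zero j)
    · refine acyclic_of_equiv _ (quotSMulTopQuotientEquiv _ (X j)) ?_
      rw [← ker_killVars_insert]
      exact ih _ (by rw [Finset.card_insert_of_notMem hj]; omega)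

/-- The extension of the maximal ideal to the polynomial ring. -/
abbrev extMax (R : Type*) [CommRing R] [IsLocalRing R] (n : ℕ) : Ideal (MvPolynomial (Fin n) R) :=
  (maximalIdeal R).map C

theorem ker_killVars_empty : RingHom.ker (killVars R (∅ : Finset (Fin n))) = extMax R n := by
  have : killVars R (∅ : Finset (Fin n)) = MvPolynomial.map (residue R) := by
    refine MvPolynomial.ringHom_ext (fun r => by simp [killVars]) fun i => by simp [killVars]
  rw [this, MvPolynomial.ker_map, ker_residue]

theorem mem_extMax {p : MvPolynomial (Fin n) R} :
    p ∈ extMax R n ↔ ∀ α, coeff α p ∈ maximalIdeal R := mem_map_C_iff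

theorem acyclic_extMax {i : ℕ} (hi : i < n) :
    Acyclic (vars R n) (MvPolynomial (Fin n) R ⧸ extMax R n) i := by
  rw [← ker_killVars_empty]
  exact acyclic_ker_killVars i ∅ (by simpa using hi)

theorem supportDim_extMax : Module.supportDim (MvPolynomial (Fin n) R)
    (MvPolynomial (Fin n) R ⧸ extMax R n) = n := by
  rw [Module.supportDim_quotient_eq_ringKrullDim, extMax, ← ker_residue (R := R),
    ← MvPolynomial.ker_map,
    ringKrullDim_eq_of_ringEquiv (RingHom.quotientKerEquivOfSurjective
      (MvPolynomial.map_surjective _ residue_surjective)),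
    MvPolynomial.ringKrullDim_of_isNoetherianRing, ringKrullDim_eq_zero_of_field]
  simp

/-- A linear functional that separates a polynomial from an ideal. -/
theorem exists_functional {J : Ideal (MvPolynomial (Fin n) R)} (hJ : extMax R n ≤ J)
    {s : MvPolynomial (Fin n) R} (hs : s ∉ J) :
    ∃ φ : MvPolynomial (Fin n) R →ₗ[R] R ⧸ maximalIdeal R, (∀ g ∈ J, φ g = 0) ∧ φ s ≠ 0 := by
  -- The quotient by `J` is a vector space over the residue field, and its dual separates points.
  have htors : Module.IsTorsionBySet R (MvPolynomial (Fin n) R ⧸ J) (maximalIdeal R) := by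
    rintro z ⟨r, hr⟩
    obtain ⟨p, rfl⟩ := Ideal.Quotient.mk_surjective z
    change Ideal.Quotient.mk J (r • p) = 0
    rw [Ideal.Quotient.eq_zero_iff_mem, MvPolynomial.smul_eq_C_mul]
    exact Ideal.mul_mem_right _ _ (hJ (Ideal.mem_map_of_mem _ hr))
  let : Field (R ⧸ maximalIdeal R) := Ideal.Quotient.field _
  let : Module (R ⧸ maximalIdeal R) (MvPolynomial (Fin n) R ⧸ J) := htors.module
  have : IsScalarTower R (R ⧸ maximalIdeal R) (MvPolynomial (Fin n) R ⧸ J) :=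
    htors.isScalarTower
  have h1 : Ideal.Quotient.mk J s ≠ 0 := fun h => hs (Ideal.Quotient.eq_zero_iff_mem.1 h)
  obtain ⟨f, hf⟩ : ∃ f : Module.Dual (R ⧸ maximalIdeal R) (MvPolynomial (Fin n) R ⧸ J),
      f (Ideal.Quotient.mk J s) ≠ 0 := by
    by_contra! h
    exact h1 ((Module.forall_dual_apply_eq_zero_iff (R ⧸ maximalIdeal R) _).1 h)
  refine ⟨(f.restrictScalars R) ∘ₗ (J.mkQ.restrictScalars R), fun g hg => ?_, hf⟩
  have : J.mkQ g = 0 := (Submodule.Quotient.mk_eq_zero J).2 hg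
  change f (J.mkQ g) = 0
  rw [this, map_zero]

/-- A homogeneous ideal of the polynomial ring. -/
def IsHomog (w : Fin n → ℤ) (J : Ideal (MvPolynomial (Fin n) R)) : Prop :=
  ∀ p ∈ J, ∀ μ, weightedHomogeneousComponent w μ p ∈ J

/-- Separate a homogeneous component of `s` outside `J` and precompose with the projection to its
degree `μ`. All weights being at least `1`, a monomial with an exponent above `μ` has degree above
`μ`; hence the bound `μ.toNat`. -/
theorem exists_bounded_functional {w : Fin n → ℤ} (hw : ∀ j, 0 < w j)
    {J : Ideal (MvPolynomial (Fin n) R)} (hJ : extMax R n ≤ J) (hJw : IsHomog w J)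
    {s : MvPolynomial (Fin n) R} (hs : s ∉ J) :
    ∃ (φ : MvPolynomial (Fin n) R →ₗ[R] R ⧸ maximalIdeal R) (N : ℕ), (∀ g ∈ J, φ g = 0) ∧
      φ s ≠ 0 ∧ ∀ (α : Fin n →₀ ℕ) (j : Fin n), N < α j → φ (monomial α 1) = 0 := by
  obtain ⟨μ, hμ⟩ : ∃ μ, weightedHomogeneousComponent w μ s ∉ J := by
    by_contra! h
    refine hs ?_
    rw [← sum_weightedHomogeneousComponent w s, finsum_eq_sum _
      (weightedHomogeneousComponent_finsupp s)]
    exact Ideal.sum_mem _ fun μ _ => h μ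
  obtain ⟨φ, hφ, hφs⟩ := exists_functional hJ hμ
  refine ⟨φ ∘ₗ weightedHomogeneousComponent w μ, μ.toNat, fun g hg => hφ _ (hJw g hg μ), hφs,
    fun α j hα => ?_⟩
  rw [LinearMap.comp_apply]
  convert map_zero φ
  refine (isWeightedHomogeneous_monomial w α 1 rfl).weightedHomogeneousComponent_ne _ ?_
  have h1 : (α j : ℤ) ≤ Finsupp.weight w α := by
    rw [Finsupp.weight_apply, Finsupp.sum_fintype _ _ (by simp)]
    have h2 : ∀ i ∈ Finset.univ, 0 ≤ α i • w i := fun i _ => by have := (hw i).le; positivity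
    refine le_trans ?_ (Finset.single_le_sum h2 (Finset.mem_univ j))
    rw [nsmul_eq_mul]
    exact le_mul_of_one_le_right (by positivity) (hw j)
  have h3 := Int.self_le_toNat μ
  have h4 : (μ.toNat : ℤ) < α j := by exact_mod_cast hα
  intro h
  omega

end PolynomialRing

/-! ### Macaulay duality for the top cohomology of the polynomial ring -/

section TopCohomology

open MvPolynomial IsLocalRing

variable {R : Type*} [CommRing R] [IsLocalRing R] {n : ℕ}

/-- The exponent vector all of whose entries are `N`. -/
def constExp (n N : ℕ) : Fin n →₀ ℕ := Finsupp.equivFunOnFinite.symm fun _ => N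

theorem constExp_apply (N : ℕ) (j : Fin n) : constExp n N j = N := rfl

theorem prod_vars_pow (N : ℕ) :
    (∏ j ∈ (Finset.univ : Finset (Fin n)), vars R n j) ^ N = monomial (constExp n N) 1 := by
  rw [← Finset.prod_pow]
  simp only [vars, X_pow_eq_monomial]
  rw [← monomial_sum_one]
  have h : ∑ j : Fin n, Finsupp.single j N = constExp n N := by
    ext j
    simp [constExp_apply, Finsupp.finsetSum_apply, Finsupp.single_apply]
  rw [h]

/-- The polynomial whose coefficients represent the functional `φ` on monomials. -/
theorem exists_dual_polynomial (φ : MvPolynomial (Fin n) R →ₗ[R] R ⧸ maximalIdeal R) (N : ℕ)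
    (hN : ∀ (α : Fin n →₀ ℕ) (j : Fin n), N < α j → φ (monomial α 1) = 0) :
    ∃ p : MvPolynomial (Fin n) R, ∀ (g : MvPolynomial (Fin n) R) (β : Fin n →₀ ℕ),
      β ≤ constExp n N → Ideal.Quotient.mk (maximalIdeal R) (coeff β (g * p)) =
        φ (g * monomial (constExp n N - β) 1) := by
  classical
  choose σ hσ using Ideal.Quotient.mk_surjective (I := maximalIdeal R)
  -- Macaulay's inverse system: the coefficient of `X ^ α` in `p` lifts the value of `φ` at the
  -- complementary monomial of exponent `N - α`.
  let p : MvPolynomial (Fin n) R := ∑ α ∈ Finset.Icc 0 (constExp n N),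
    monomial α (σ (φ (monomial (constExp n N - α) 1)))
  have hp : ∀ γ ≤ constExp n N, coeff γ p = σ (φ (monomial (constExp n N - γ) 1)) := by
    intro γ hγ
    simp only [p, coeff_sum, coeff_monomial]
    rw [Finset.sum_eq_single γ]
    · rw [if_pos rfl]
    · intro b _ hb; rw [if_neg hb]
    · intro h; exact absurd (Finset.mem_Icc.2 ⟨zero_le, hγ⟩) h
  refine ⟨p, fun g β hβ => ?_⟩
  induction g using MvPolynomial.induction_on' with
  | add f g hf hg => rw [add_mul, coeff_add, map_add, hf, hg, add_mul, map_add]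
  | monomial α c =>
    have hc : φ (monomial α c * monomial (constExp n N - β) 1) =
        Ideal.Quotient.mk (maximalIdeal R) c * φ (monomial (α + (constExp n N - β)) 1) := by
      rw [monomial_mul, mul_one, ← mul_one c, ← smul_eq_mul, ← smul_monomial, map_smul,
        smul_eq_mul, mul_one]
      rfl
    rw [coeff_monomial_mul', hc]
    split_ifs with h
    · rw [map_mul, hp _ (le_trans tsub_le_self hβ), hσ]
      have e1 : constExp n N - (β - α) = α + (constExp n N - β) := by
        ext j
        have h1 := h j
        have h2 := hβ j
        simp only [Finsupp.tsub_apply, Finsupp.add_apply]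
        omega
      rw [e1]
    · obtain ⟨j, hj⟩ : ∃ j, ¬ α j ≤ β j := by
        by_contra! h'; exact h h'
      -- The exponent of `j` in the product exceeds `N`, so `φ` is zero there, matching the zero
      -- coefficient on the other side.
      rw [hN _ j, mul_zero, map_zero]
      have h2 := hβ j
      rw [constExp_apply] at h2
      simp only [Finsupp.tsub_apply, Finsupp.add_apply, constExp_apply]
      omega

/-- A polynomial all of whose monomials have some exponent at least `N`, modulo the maximal
ideal, gives a coboundary when divided by the `N`-th power of the product of the variables. -/
theorem mem_boundaries_of_coeff {N : ℕ} {q : MvPolynomial (Fin n) R}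
    (hq : ∀ β : Fin n →₀ ℕ, (∀ j, β j < N) → coeff β q ∈ maximalIdeal R)
    {c : Cochain (vars R n) (MvPolynomial (Fin n) R ⧸ extMax R n) n}
    (hc : ∀ J, (∏ j ∈ J.1, vars R n j) ^ N • c J =
      toLoc (vars R n) _ J.1 (Submodule.Quotient.mk q)) :
    c ∈ boundaries (vars R n) (MvPolynomial (Fin n) R ⧸ extMax R n) n := by
  have hmono : ∀ (β : Fin n →₀ ℕ) (r : R), ((∀ j, β j < N) → r ∈ maximalIdeal R) →
      ∃ c ∈ boundaries (vars R n) (MvPolynomial (Fin n) R ⧸ extMax R n) n,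
        ∀ J, (∏ j ∈ J.1, vars R n j) ^ N • c J =
          toLoc (vars R n) _ J.1 (Submodule.Quotient.mk (monomial β r)) := by
    intro β r hβ
    by_cases h : ∀ j, β j < N
    · refine ⟨0, Submodule.zero_mem _, fun J => ?_⟩
      rw [Pi.zero_apply, smul_zero, (Submodule.Quotient.mk_eq_zero _).2, map_zero]
      rw [mem_extMax]
      intro α
      rw [coeff_monomial]
      split_ifs
      · exact hβ h
      · exact Submodule.zero_mem _
    push Not at h
    obtain ⟨j, hj⟩ := h
    obtain ⟨n, rfl⟩ : ∃ m, n = m + 1 := ⟨n - 1, by have := j.pos; omega⟩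
    -- An exponent at least `N` at `j` cancels `X_j ^ N` from the denominator, so the fraction comes
    -- from the localization that omits `j`.
    let q' : MvPolynomial (Fin (n + 1)) R := monomial (β - Finsupp.single j N) r
    have hq' : X j ^ N * q' = monomial β r := by
      rw [X_pow_eq_monomial, monomial_mul, one_mul]
      rw [add_tsub_cancel_of_le (Finsupp.single_le_iff.2 hj)]
    choose b hb using fun J : {J : Finset (Fin (n + 1)) // J.card = n} =>
      exists_pow_smul_eq (vars R (n + 1)) J.1 N (toLoc (vars R (n + 1))
        (MvPolynomial (Fin (n + 1)) R ⧸ extMax R (n + 1)) J.1 (Submodule.Quotient.mk q'))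
    let ε : MvPolynomial (Fin (n + 1)) R :=
      (-1) ^ ((Finset.univ : Finset (Fin (n + 1))).filter (· < j)).card
    let B : Cochain (vars R (n + 1)) (MvPolynomial (Fin (n + 1)) R ⧸ extMax R (n + 1)) n :=
      fun J => if j ∈ J.1 then 0 else ε • b J
    refine ⟨d _ _ n B, ⟨B, rfl⟩, fun J => ?_⟩
    obtain ⟨J, hJ⟩ := J
    obtain rfl : J = Finset.univ := (Finset.card_eq_iff_eq_univ J).1 (by simpa using hJ)
    rw [d_apply, Finset.sum_eq_single ⟨j, Finset.mem_univ j⟩]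
    · have hj' : j ∉ Finset.univ.erase j := Finset.notMem_erase _ _
      simp only [B, if_neg hj', map_smul, smul_smul]
      rw [show (-1 : MvPolynomial (Fin (n + 1)) R) ^ ((Finset.univ : Finset (Fin (n + 1))).filter
        (· < j)).card = ε from rfl, show ε * ε = 1 by simp [ε, ← mul_pow], mul_one]
      have hbj := hb ⟨Finset.univ.erase j, card_erase ⟨Finset.univ, by simp⟩
        ⟨j, Finset.mem_univ j⟩⟩
      rw [← Finset.mul_prod_erase _ _ (Finset.mem_univ j), mul_pow, mul_smul, ← map_smul, hbj,
        res_mk, ← map_smul, ← Submodule.Quotient.mk_smul, smul_eq_mul, hq']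
    · rintro ⟨a, ha⟩ - haj
      have : j ∈ Finset.univ.erase a :=
        Finset.mem_erase.2 ⟨fun h => haj (Subtype.ext h.symm), Finset.mem_univ _⟩
      simp only [B, if_pos this, map_zero, smul_zero]
    · intro h; exact absurd (Finset.mem_univ _) h
  choose! b hb hb' using hmono
  have hsum : c = ∑ β ∈ q.support, b β (coeff β q) := by
    funext J
    apply pow_smul_cancel (vars R n) (e := N)
    rw [hc, Finset.sum_apply, Finset.smul_sum]
    rw [Finset.sum_congr rfl fun β _ => hb' β (coeff β q) (hq β) J, ← map_sum]
    conv_lhs => rw [← support_sum_monomial_coeff q]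
    congr 1
    exact map_sum (Submodule.mkQ _) _ _
  rw [hsum]
  exact Submodule.sum_mem _ fun β _ => hb β _ (hq β)

theorem pow_smul_res_erase {S : Type*} [CommRing S] (x : Fin n → S) {M : Type*} [AddCommGroup M]
    [Module S M] {J : Finset (Fin n)} {j : Fin n} (hj : j ∈ J) {e : ℕ} (s : S)
    {z : Loc x M (J.erase j)} {m : M}
    (h : (∏ i ∈ J.erase j, x i) ^ e • z = toLoc x M (J.erase j) m) :
    (∏ i ∈ J, x i) ^ e • (s • res x M (J.erase_subset j) z) =
      toLoc x M J (x j ^ e • s • m) := by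
  rw [← Finset.mul_prod_erase _ _ hj, mul_pow, smul_comm, mul_smul, smul_comm s, ← map_smul, h,
    res_mk, map_smul, map_smul]

/-- Converse to `mem_boundaries_of_coeff`. Clearing denominators in a coboundary puts a multiple of
`q` by a power of the product of the variables into an ideal of pure powers, modulo the maximal
ideal. -/
theorem exists_coeff_of_mem_boundaries {N : ℕ} {q : MvPolynomial (Fin n) R}
    {c : Cochain (vars R n) (MvPolynomial (Fin n) R ⧸ extMax R n) n}
    (hc : ∀ J, (∏ j ∈ J.1, vars R n j) ^ N • c J =
      toLoc (vars R n) _ J.1 (Submodule.Quotient.mk q))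
    (hcb : c ∈ boundaries (vars R n) (MvPolynomial (Fin n) R ⧸ extMax R n) n) :
    ∀ β : Fin n →₀ ℕ, (∀ j, β j < N) → coeff β q ∈ maximalIdeal R := by
  intro β hβ
  -- The coefficient is read off at `β + (e, …, e)`: all entries are below `N + e`, so no `X_j ^ (N
  -- + e)` contributes.
  suffices H : ∃ e : ℕ, ∃ q' : Fin n → MvPolynomial (Fin n) R,
      (∏ j, vars R n j) ^ e * q - ∑ j, X j ^ (N + e) * q' j ∈ extMax R n by
    obtain ⟨e, q', h⟩ := H
    have h1 := mem_extMax.1 h (constExp n e + β)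
    rw [coeff_sub, coeff_sum, prod_vars_pow, coeff_monomial_mul, one_mul,
      Finset.sum_eq_zero, sub_zero] at h1
    · exact h1
    · intro j _
      rw [X_pow_eq_monomial, coeff_monomial_mul', if_neg]
      intro h2
      have := h2 j
      have := hβ j
      simp [constExp_apply] at *
      omega
  cases n with
  | zero =>
    have h0 := hc ⟨∅, rfl⟩
    rw [(mem_boundaries_zero _).1 hcb, Pi.zero_apply, smul_zero, eq_comm, toLoc_eq_zero_iff] at h0
    obtain ⟨e, he⟩ := h0
    refine ⟨0, fun _ => 0, ?_⟩
    rw [Finset.prod_empty, one_pow, one_smul] at he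
    simpa using (Submodule.Quotient.mk_eq_zero _).1 he
  | succ n =>
    obtain ⟨b, rfl⟩ := hcb
    choose e m hm using fun J : {J : Finset (Fin (n + 1)) // J.card = n} =>
      exists_pow_smul_eq_toLoc (vars R (n + 1)) J.1 (b J)
    choose q' hq' using fun J => Submodule.Quotient.mk_surjective _ (m J)
    let E := ∑ J, e J
    have hE : ∀ J, e J ≤ E := fun J =>
      Finset.single_le_sum (fun _ _ => Nat.zero_le _) (Finset.mem_univ J)
    let U : {J : Finset (Fin (n + 1)) // J.card = n + 1} := ⟨Finset.univ, by simp⟩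
    let F : Fin (n + 1) → {J : Finset (Fin (n + 1)) // J.card = n} := fun j =>
      ⟨U.1.erase j, card_erase U ⟨j, Finset.mem_univ j⟩⟩
    let ε : Fin (n + 1) → MvPolynomial (Fin (n + 1)) R := fun j =>
      (-1) ^ (U.1.filter (· < j)).card
    let t : Fin (n + 1) → MvPolynomial (Fin (n + 1)) R := fun j =>
      ε j * ((∏ i ∈ (F j).1, vars R (n + 1) i) ^ (E - e (F j)) * q' (F j))
    have hres : ∀ j : Fin (n + 1), (∏ i ∈ U.1, vars R (n + 1) i) ^ E • (ε j •
        res (vars R (n + 1)) (MvPolynomial (Fin (n + 1)) R ⧸ extMax R (n + 1))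
          (U.1.erase_subset j) (b (F j))) =
        toLoc (vars R (n + 1)) (MvPolynomial (Fin (n + 1)) R ⧸ extMax R (n + 1)) U.1
          (Submodule.Quotient.mk (X j ^ E * t j)) := by
      intro j
      have h1 : (∏ i ∈ (F j).1, vars R (n + 1) i) ^ E • b (F j) =
          toLoc (vars R (n + 1)) (MvPolynomial (Fin (n + 1)) R ⧸ extMax R (n + 1)) (F j).1
            (Submodule.Quotient.mk
              ((∏ i ∈ (F j).1, vars R (n + 1) i) ^ (E - e (F j)) * q' (F j))) := by
        rw [← smul_eq_mul, Submodule.Quotient.mk_smul, map_smul, hq', ← hm, smul_smul, ← pow_add,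
          Nat.sub_add_cancel (hE _)]
      rw [pow_smul_res_erase (vars R (n + 1)) (Finset.mem_univ j) (ε j) h1]
      simp only [vars, t, ← Submodule.Quotient.mk_smul, smul_eq_mul]
      rfl
    have h2 := congrArg (fun z => (∏ i ∈ U.1, vars R (n + 1) i) ^ E • z) (hc U)
    have h3 : (∏ i ∈ U.1, vars R (n + 1) i) ^ E • (d (vars R (n + 1))
        (MvPolynomial (Fin (n + 1)) R ⧸ extMax R (n + 1)) n b U) =
        toLoc (vars R (n + 1)) _ U.1 (Submodule.Quotient.mk (∑ j, X j ^ E * t j)) := by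
      rw [d_apply, Finset.smul_sum]
      have e1 : (Submodule.Quotient.mk (∑ j, X j ^ E * t j) :
          MvPolynomial (Fin (n + 1)) R ⧸ extMax R (n + 1)) =
          ∑ j, Submodule.Quotient.mk (X j ^ E * t j) := map_sum (Submodule.mkQ _) _ _
      rw [e1, map_sum, ← Finset.sum_coe_sort U.1]
      exact Finset.sum_congr rfl fun j _ => hres j.1
    simp only at h2
    rw [smul_comm, h3, ← map_smul, ← map_smul, ← Submodule.Quotient.mk_smul,
      ← Submodule.Quotient.mk_smul, toLoc_eq_iff] at h2
    obtain ⟨k, hk⟩ := h2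
    rw [← Submodule.Quotient.mk_smul, ← Submodule.Quotient.mk_smul, eq_comm,
      Submodule.Quotient.eq] at hk
    refine ⟨k + E, fun j => (∏ i ∈ U.1.erase j, vars R (n + 1) i) ^ (k + N) * t j, ?_⟩
    simp only [smul_eq_mul, Finset.mul_sum] at hk
    have hring : ∀ x P T : MvPolynomial (Fin (n + 1)) R,
        x ^ (N + (k + E)) * (P ^ (k + N) * T) = (x * P) ^ k * ((x * P) ^ N * (x ^ E * T)) := by
      intro x P T
      ring
    have hsum : ∑ j, X j ^ (N + (k + E)) * ((∏ i ∈ U.1.erase j, vars R (n + 1) i) ^ (k + N) * t j) =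
        ∑ j, (∏ i ∈ U.1, vars R (n + 1) i) ^ k *
          ((∏ i ∈ U.1, vars R (n + 1) i) ^ N * (X j ^ E * t j)) :=
      Finset.sum_congr rfl fun j _ => by
        rw [hring, ← Finset.mul_prod_erase U.1 _ (Finset.mem_univ j)]
    rw [hsum, pow_add, mul_assoc]
    exact hk

/-- The top cohomology of the polynomial ring over a field is dual to the polynomial ring, so that
each homogeneous ideal is the annihilator of its annihilator. -/
theorem exists_coh_extMax {w : Fin n → ℤ} (hw : ∀ j, 0 < w j)
    {J : Ideal (MvPolynomial (Fin n) R)} (hJ : extMax R n ≤ J) (hJw : IsHomog w J)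
    {s : MvPolynomial (Fin n) R} (hs : s ∉ J) :
    ∃ c : Cochain (vars R n) (MvPolynomial (Fin n) R ⧸ extMax R n) n, d _ _ n c = 0 ∧
      (∀ g ∈ J, g • c ∈ boundaries (vars R n) (MvPolynomial (Fin n) R ⧸ extMax R n) n) ∧
      s • c ∉ boundaries (vars R n) (MvPolynomial (Fin n) R ⧸ extMax R n) n := by
  obtain ⟨φ, N, hφJ, hφs, hN⟩ := exists_bounded_functional hw hJ hJw hs
  obtain ⟨p, hp⟩ := exists_dual_polynomial φ N hN
  -- The class is `p` divided by the `(N + 1)`-st power of the product of the variables. The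
  -- exponents `β` that matter satisfy `β ≤ N`; there the coefficient of `g * p` is `φ (g X ^ (N -
  -- β))`, zero for `g ∈ J`, while `s` and `β = N` give `φ s ≠ 0`.
  choose c hc using fun J : {J : Finset (Fin n) // J.card = n} =>
    exists_pow_smul_eq (vars R n) J.1 (N + 1) (toLoc (vars R n)
      (MvPolynomial (Fin n) R ⧸ extMax R n) J.1 (Submodule.Quotient.mk p))
  have hgc : ∀ (g : MvPolynomial (Fin n) R) J, (∏ j ∈ J.1, vars R n j) ^ (N + 1) • (g • c) J =
      toLoc (vars R n) (MvPolynomial (Fin n) R ⧸ extMax R n) J.1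
        (Submodule.Quotient.mk (g * p)) := by
    intro g J
    rw [Pi.smul_apply, smul_comm, hc, ← map_smul, ← Submodule.Quotient.mk_smul, smul_eq_mul]
  refine ⟨c, ?_, fun g hg => mem_boundaries_of_coeff (fun β hβ => ?_) (hgc g), fun h => ?_⟩
  · funext J
    have := J.2
    have := Finset.card_le_univ J.1
    simp at this
    omega
  · rw [← Ideal.Quotient.eq_zero_iff_mem, hp g β fun j => Nat.lt_succ_iff.1 (hβ j)]
    exact hφJ _ (Ideal.mul_mem_right _ _ hg)
  · have h1 := exists_coeff_of_mem_boundaries (hgc s) h (constExp n N) fun j => Nat.lt_succ_self N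
    rw [← Ideal.Quotient.eq_zero_iff_mem, hp s _ le_rfl, tsub_self] at h1
    exact hφs (by simpa using h1)

end TopCohomology

/-! ### Homogeneous prime avoidance -/

section Avoidance

open MvPolynomial IsLocalRing
open scoped Pointwise

variable {R : Type*} [CommRing R] {n : ℕ} {w : Fin n → ℤ}

theorem le_weight (hw : ∀ j, 0 < w j) (α : Fin n →₀ ℕ) (j : Fin n) :
    (α j : ℤ) ≤ Finsupp.weight w α := by
  rw [Finsupp.weight_apply, Finsupp.sum_fintype _ _ (by simp)]
  have h2 : ∀ i ∈ Finset.univ, 0 ≤ α i • w i := fun i _ => by have := (hw i).le; positivity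
  refine le_trans ?_ (Finset.single_le_sum h2 (Finset.mem_univ j))
  rw [nsmul_eq_mul]
  exact le_mul_of_one_le_right (by positivity) (hw j)

theorem eq_C_of_isWeightedHomogeneous (hw : ∀ j, 0 < w j) {f : MvPolynomial (Fin n) R} {μ : ℤ}
    (hf : f.IsWeightedHomogeneous w μ) (hμ : μ ≤ 0) : f = C (coeff 0 f) := by
  ext α
  rw [coeff_C]
  split_ifs with h
  · rw [h]
  · by_contra h1
    refine h (Finsupp.ext fun j => ?_)
    have h2 := le_weight hw α j
    rw [hf h1] at h2
    simp only [Finsupp.coe_zero, Pi.zero_apply]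
    omega

variable [IsLocalRing R]

/-- A homogeneous element of degree at most `0` is a constant: either it lies in the maximal ideal,
hence in `Q`, or it is a unit, hence not in `P`. Positivity of degrees is needed to equalize them by
taking powers. -/
theorem pos_of_notMem (hw : ∀ j, 0 < w j) {f : MvPolynomial (Fin n) R} {μ : ℤ}
    (hf : f.IsWeightedHomogeneous w μ) {P Q : Ideal (MvPolynomial (Fin n) R)}
    (hP : P ≠ ⊤) (hQ : extMax R n ≤ Q) (hfP : f ∈ P) (hfQ : f ∉ Q) : 0 < μ := by
  by_contra! hμ
  rw [eq_C_of_isWeightedHomogeneous hw hf hμ] at hfP hfQ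
  by_cases hr : coeff 0 f ∈ maximalIdeal R
  · exact hfQ (hQ (Ideal.mem_map_of_mem _ hr))
  · rw [mem_maximalIdeal, mem_nonunits_iff, not_not] at hr
    exact hP (Ideal.eq_top_of_isUnit_mem _ hfP (hr.map C))

theorem IsHomog.exists_notMem {I Q : Ideal (MvPolynomial (Fin n) R)} (hI : IsHomog w I)
    (h : ¬ I ≤ Q) : ∃ f ∈ I, ∃ μ, f.IsWeightedHomogeneous w μ ∧ f ∉ Q := by
  obtain ⟨p, hp, hpQ⟩ := SetLike.not_le_iff_exists.1 h
  by_contra! h'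
  refine hpQ ?_
  rw [← sum_weightedHomogeneousComponent w p, finsum_eq_sum _
    (weightedHomogeneousComponent_finsupp p)]
  exact Ideal.sum_mem _ fun μ _ => h' _ (hI p hp μ) μ
    (weightedHomogeneousComponent_isWeightedHomogeneous μ p)

/-- Homogeneous prime avoidance. -/
theorem IsHomog.exists_avoiding (hw : ∀ j, 0 < w j) {I : Ideal (MvPolynomial (Fin n) R)}
    (hI : IsHomog w I) (s : Finset (Ideal (MvPolynomial (Fin n) R)))
    (hs : ∀ Q ∈ s, Q.IsPrime ∧ extMax R n ≤ Q ∧ ¬ I ≤ Q) :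
    ∃ f ∈ I, ∃ μ, f.IsWeightedHomogeneous w μ ∧ ∀ Q ∈ s, f ∉ Q := by
  classical
  induction s using Finset.strongInduction with
  | H s ih =>
    rcases s.eq_empty_or_nonempty with rfl | ⟨Q, hQ⟩
    · exact ⟨0, Submodule.zero_mem _, 0, isWeightedHomogeneous_zero _ _ _, by simp⟩
    -- If the homogeneous elements of `P` lie in `Q`, a homogeneous element outside `Q` is outside
    -- `P`, so `P` can be dropped.
    by_cases hred : ∃ P ∈ s.erase Q, ∀ f ∈ P, ∀ μ, f.IsWeightedHomogeneous w μ → f ∈ Q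
    · obtain ⟨P, hP, hPQ⟩ := hred
      have hPs := Finset.mem_of_mem_erase hP
      obtain ⟨f, hf, μ, hfμ, h⟩ := ih _ (Finset.erase_ssubset hPs) fun Q' h' =>
        hs Q' (Finset.mem_of_mem_erase h')
      refine ⟨f, hf, μ, hfμ, fun Q' hQ' => ?_⟩
      by_cases hQP : Q' = P
      · subst hQP
        exact fun h1 => h Q (Finset.mem_erase.2 ⟨(Finset.ne_of_mem_erase hP).symm, hQ⟩)
          (hPQ f h1 μ hfμ)
      · exact h Q' (Finset.mem_erase.2 ⟨hQP, hQ'⟩)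
    push Not at hred
    obtain ⟨f, hf, μ, hfμ, h⟩ := ih _ (Finset.erase_ssubset hQ) fun Q' h' =>
      hs Q' (Finset.mem_of_mem_erase h')
    by_cases hfQ : f ∉ Q
    · refine ⟨f, hf, μ, hfμ, fun Q' hQ' => ?_⟩
      by_cases hQP : Q' = Q
      · rwa [hQP]
      · exact h Q' (Finset.mem_erase.2 ⟨hQP, hQ'⟩)
    rw [not_not] at hfQ
    obtain ⟨g₀, hg₀, ν₀, hgν₀, hgQ₀⟩ := hI.exists_notMem (hs Q hQ).2.2
    choose! p hpP ν hpν hpQ using hred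
    have hprime := (hs Q hQ).1
    -- Outside `Q` and inside all other primes, opposite to `f`.
    let g := g₀ * ∏ P ∈ s.erase Q, p P
    have hg : g ∈ I := Ideal.mul_mem_right _ _ hg₀
    have hgν : g.IsWeightedHomogeneous w (ν₀ + ∑ P ∈ s.erase Q, ν P) :=
      hgν₀.mul (IsWeightedHomogeneous.prod _ _ _ hpν)
    have hgQ : g ∉ Q := by
      intro h1
      rcases hprime.mem_or_mem h1 with h1 | h1
      · exact hgQ₀ h1
      · obtain ⟨P, hP, h2⟩ := (hprime.prod_mem_iff).1 h1
        exact hpQ P hP h2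
    have hgP : ∀ P ∈ s.erase Q, g ∈ P := fun P hP =>
      Ideal.mul_mem_left _ _ (Ideal.prod_mem _ hP (hpP P hP))
    rcases (s.erase Q).eq_empty_or_nonempty with he | ⟨P, hP⟩
    · refine ⟨g, hg, _, hgν, fun Q' hQ' => ?_⟩
      by_cases hQP : Q' = Q
      · rwa [hQP]
      · exact absurd (Finset.mem_erase.2 ⟨hQP, hQ'⟩) (by simp [he])
    have hPs := Finset.mem_of_mem_erase hP
    have hμ : 0 < μ := pos_of_notMem hw hfμ hprime.ne_top (hs P hPs).2.1 hfQ (h P hP)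
    have hν := pos_of_notMem hw hgν (hs P hPs).1.ne_top (hs Q hQ).2.1 (hgP P hP) hgQ
    set κ := ν₀ + ∑ P ∈ s.erase Q, ν P
    have hμ' : μ.toNat ≠ 0 := by omega
    have hκ' : κ.toNat ≠ 0 := by omega
    -- With `deg f = μ` and `deg g = κ` both summands have degree `κ μ`, and each prime contains
    -- exactly one of them.
    refine ⟨f ^ κ.toNat + g ^ μ.toNat, add_mem (Ideal.pow_mem_of_mem _ hf _ (by omega))
      (Ideal.pow_mem_of_mem _ hg _ (by omega)), κ * μ, ?_, fun Q' hQ' h1 => ?_⟩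
    · refine IsWeightedHomogeneous.add ?_ ?_
      · convert hfμ.pow κ.toNat using 1
        rw [nsmul_eq_mul, Int.toNat_of_nonneg hν.le]
      · convert hgν.pow μ.toNat using 1
        rw [nsmul_eq_mul, Int.toNat_of_nonneg hμ.le, mul_comm]
    · have hprime' := (hs Q' hQ').1
      by_cases hQP : Q' = Q
      · subst hQP
        exact hgQ (hprime.mem_of_pow_mem _
          ((Ideal.add_mem_iff_right _ (Ideal.pow_mem_of_mem _ hfQ _ (by omega))).1 h1))
      · have hQ'' := Finset.mem_erase.2 ⟨hQP, hQ'⟩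
        exact h Q' hQ'' (hprime'.mem_of_pow_mem _
          ((Ideal.add_mem_iff_left _
            (Ideal.pow_mem_of_mem _ (hgP Q' hQ'') _ (by omega))).1 h1))

theorem IsHomog.sup_span {J : Ideal (MvPolynomial (Fin n) R)} (hJ : IsHomog w J)
    {f : MvPolynomial (Fin n) R} {ν : ℤ} (hf : f.IsWeightedHomogeneous w ν) :
    IsHomog w (J ⊔ Ideal.span {f}) := by
  classical
  intro p hp μ
  obtain ⟨a, ha, b, hb, rfl⟩ := Submodule.mem_sup.1 hp
  obtain ⟨c, rfl⟩ := Ideal.mem_span_singleton'.1 hb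
  rw [map_add]
  refine add_mem (Ideal.mem_sup_left (hJ a ha μ)) (Ideal.mem_sup_right ?_)
  rw [← sum_weightedHomogeneousComponent w c, finsum_eq_sum _
    (weightedHomogeneousComponent_finsupp c), Finset.sum_mul, map_sum]
  refine Ideal.sum_mem _ fun κ _ => ?_
  rw [weightedHomogeneousComponent_of_mem (n := κ + ν)
    ((weightedHomogeneousComponent_isWeightedHomogeneous κ c).mul hf)]
  split_ifs
  · exact Ideal.mul_mem_left _ _ (Ideal.mem_span_singleton_self f)
  · exact Submodule.zero_mem _

end Avoidance

/-! ### Nonzero maps to quotients by primes of the support -/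

section PrimeQuotient

variable {S : Type*} [CommRing S] [IsNoetherianRing S] {N : Type*} [AddCommGroup N] [Module S N]

/-- A finite module maps nontrivially to the quotient by each prime of its support. -/
theorem exists_linearMap_quotient_ne_zero [Module.Finite S N] {Q : Ideal S} (hQ : Q.IsPrime)
    (h : Module.annihilator S N ≤ Q) : ∃ ψ : N →ₗ[S] S ⧸ Q, ψ ≠ 0 := by
  -- A maximal `P` such that the annihilator of `N / P` is still contained in `Q`.
  obtain ⟨P, hP, hmax⟩ := (wellFounded_gt (α := Submodule S N)).has_min
    {P | ∀ a : S, (∀ m, a • m ∈ P) → a ∈ Q}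
    ⟨⊥, fun a ha => h (Module.mem_annihilator.2 fun m => (Submodule.mem_bot S).1 (ha m))⟩
  have hy : ∀ z ∉ P, ∃ y ∉ Q, ∀ m, ∃ p ∈ P, ∃ s : S, y • m = p + s • z := by
    intro z hz
    have h1 := hmax (P ⊔ Submodule.span S {z})
    have h2 : P < P ⊔ Submodule.span S {z} := by
      refine lt_of_le_of_ne le_sup_left fun h => hz ?_
      rw [h]
      exact Submodule.mem_sup_right (Submodule.mem_span_singleton_self z)
    have h3 : P ⊔ Submodule.span S {z} ∉ {P | ∀ a : S, (∀ m, a • m ∈ P) → a ∈ Q} :=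
      fun h => h1 h h2
    rw [Set.mem_ofPred_eq, not_forall] at h3
    obtain ⟨y, h3⟩ := h3
    obtain ⟨h4, h5⟩ := Classical.not_imp.1 h3
    refine ⟨y, h5, fun m => ?_⟩
    obtain ⟨p, hp, q, hq, hpq⟩ := Submodule.mem_sup.1 (h4 m)
    obtain ⟨s, rfl⟩ := Submodule.mem_span_singleton.1 hq
    exact ⟨p, hp, s, hpq.symm⟩
  -- Annihilators of nonzero elements of `N / P` lie in `Q`; `hB` shows that `Q` kills `N / P`.
  -- Hence every nonzero `z` spans a copy of `S / Q`.
  have hA : ∀ (a : S) (z : N), a • z ∈ P → z ∉ P → a ∈ Q := by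
    intro a z haz hz
    obtain ⟨y, hyQ, hym⟩ := hy z hz
    refine (hQ.mem_or_mem (hP (y * a) fun m => ?_)).resolve_left hyQ
    obtain ⟨p, hp, s, hs⟩ := hym m
    rw [mul_comm, mul_smul, hs, smul_add, smul_comm]
    exact add_mem (P.smul_mem _ hp) (P.smul_mem _ haz)
  have hB : ∀ a ∈ Q, ∀ m : N, a • m ∈ P := by
    intro a ha m
    by_contra ham
    obtain ⟨y, hyQ, hym⟩ := hy _ ham
    obtain ⟨p, hp, s, hs⟩ := hym m
    have h1 : (y - s * a) • m ∈ P := by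
      rw [sub_smul, hs, mul_smul, add_sub_cancel_right]; exact hp
    have h2 := hA _ _ h1 fun hm => ham (P.smul_mem _ hm)
    exact hyQ (by simpa using add_mem h2 (Ideal.mul_mem_left Q s ha))
  obtain ⟨z, hz⟩ : ∃ z, z ∉ P := by
    by_contra! h1
    exact hQ.ne_top ((Ideal.eq_top_iff_one _).2 (hP 1 fun m => h1 _))
  obtain ⟨y, hyQ, hym⟩ := hy z hz
  let ι : S ⧸ Q →ₗ[S] N ⧸ P := Submodule.liftQ Q
    (P.mkQ ∘ₗ LinearMap.toSpanSingleton S N z) fun a ha => by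
      rw [LinearMap.mem_ker, LinearMap.comp_apply, Submodule.mkQ_apply,
        Submodule.Quotient.mk_eq_zero]
      exact hB a ha z
  have hι : Function.Injective ι := by
    rw [injective_iff_map_eq_zero]
    intro a ha
    obtain ⟨a, rfl⟩ := Submodule.Quotient.mk_surjective _ a
    exact (Submodule.Quotient.mk_eq_zero _).2
      (hA a z ((Submodule.Quotient.mk_eq_zero _).1 ha) hz)
  -- Multiplication by `y` pushes `N` into the copy of `S / Q` spanned by `z`; it is nonzero at `z`
  -- because `y ∉ Q`.
  let κ : N →ₗ[S] N ⧸ P := y • P.mkQ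
  have hκ : ∀ m, κ m ∈ LinearMap.range ι := by
    intro m
    obtain ⟨p, hp, s, hs⟩ := hym m
    refine ⟨Submodule.Quotient.mk s, ?_⟩
    change P.mkQ (s • z) = y • P.mkQ m
    rw [← map_smul, hs, map_add, (show P.mkQ p = 0 from (Submodule.Quotient.mk_eq_zero _).2 hp),
      zero_add]
  refine ⟨(LinearEquiv.ofInjective ι hι).symm.toLinearMap ∘ₗ κ.codRestrict _ hκ, fun h1 => ?_⟩
  have h2 := LinearMap.congr_fun h1 z
  simp only [LinearMap.comp_apply, LinearMap.zero_apply, LinearEquiv.coe_coe,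
    LinearEquiv.map_eq_zero_iff] at h2
  have h3 : y • P.mkQ z = 0 := congrArg Subtype.val h2
  rw [← map_smul] at h3
  exact hyQ (hA y z ((Submodule.Quotient.mk_eq_zero _).1 h3) hz)

end PrimeQuotient

/-! ### Ideals whose quotient satisfies duality -/

section TopCohomologyNonvanishing

open MvPolynomial IsLocalRing
open scoped Pointwise

variable {R : Type*} [CommRing R] [IsLocalRing R] {n : ℕ}

/-- An ideal of the polynomial ring with Cohen–Macaulay quotient, whose top cohomology satisfies
the duality of ideals and their annihilators. -/
structure DualIdeal (w : Fin n → ℤ) (J : Ideal (MvPolynomial (Fin n) R)) (t : ℕ) : Prop where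
  isHomog : IsHomog w J
  le : extMax R n ≤ J
  dim_le : Module.supportDim (MvPolynomial (Fin n) R) (MvPolynomial (Fin n) R ⧸ J) ≤ t
  acyclic : ∀ i < t, Acyclic (vars R n) (MvPolynomial (Fin n) R ⧸ J) i
  exists_coh : ∀ J' : Ideal (MvPolynomial (Fin n) R), IsHomog w J' → J ≤ J' → ∀ s ∉ J',
    ∃ c : Cochain (vars R n) (MvPolynomial (Fin n) R ⧸ J) t, d _ _ t c = 0 ∧
      (∀ g ∈ J', g • c ∈ boundaries (vars R n) (MvPolynomial (Fin n) R ⧸ J) t) ∧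
      s • c ∉ boundaries (vars R n) (MvPolynomial (Fin n) R ⧸ J) t

variable {w : Fin n → ℤ}

theorem isHomog_extMax : IsHomog w (extMax R n) := by
  classical
  intro p hp μ
  rw [mem_extMax] at hp ⊢
  intro α
  rw [coeff_weightedHomogeneousComponent]
  split_ifs
  · exact hp α
  · exact Submodule.zero_mem _

theorem dualIdeal_extMax [IsNoetherianRing R] (hw : ∀ j, 0 < w j) : DualIdeal w (extMax R n) n where
  isHomog := isHomog_extMax
  le := le_rfl
  dim_le := supportDim_extMax.le
  acyclic _ hi := acyclic_extMax hi
  exists_coh _ hJ' hJ _ hs := exists_coh_extMax hw hJ hJ' hs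

end TopCohomologyNonvanishing

/-! ### Connecting maps for a regular element -/

section Regular

open scoped Pointwise

variable {S : Type*} [CommRing S] {n : ℕ} (x : Fin n → S)
variable {N : Type*} [AddCommGroup N] [Module S N] {y : S}

/-- A class killed by `y` comes from `N / yN` under the connecting map; `b` represents the preimage.
-/
theorem exists_cochain_quotSMulTop {i : ℕ} {c : Cochain x N (i + 1)}
    (hyc : y • c ∈ boundaries x N (i + 1)) :
    ∃ b : Cochain x N i, d x N i b = y • c ∧
      d x (QuotSMulTop y N) i (cochainMap x (Submodule.mkQ (y • (⊤ : Submodule S N))) i b) = 0 := by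
  obtain ⟨b, hb⟩ := hyc
  refine ⟨b, hb, ?_⟩
  rw [d_cochainMap, hb, ← cochainMap_lsmul]
  exact (cochainMap_exact x (exact_lsmul_mkQ N y) _ _).2 ⟨c, rfl⟩

/-- The connecting map `H^i(N/yN) → H^{i+1}(N)` is injective if `H^i(N) = 0`. -/
theorem smul_cochainMap_mem_boundaries_iff (hreg : IsSMulRegular N y) {i : ℕ}
    (hN : Acyclic x N i) {c : Cochain x N (i + 1)} {b : Cochain x N i} (hb : d x N i b = y • c)
    (g : S) :
    g • cochainMap x (Submodule.mkQ (y • (⊤ : Submodule S N))) i b ∈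
      boundaries x (QuotSMulTop y N) i ↔ g • c ∈ boundaries x N (i + 1) := by
  have hinj : ∀ {k} {a : Cochain x N k}, y • a = 0 → a = 0 := fun {k a} h =>
    cochainMap_injective x (f := LinearMap.lsmul S N y) hreg k (by
      rw [cochainMap_lsmul, h, map_zero])
  have hex := cochainMap_exact x (exact_lsmul_mkQ N y)
  rw [← map_smul]
  constructor
  · intro h
    obtain ⟨b', hb', hbb⟩ : ∃ b' ∈ boundaries x N i,
        cochainMap x (Submodule.mkQ (y • (⊤ : Submodule S N))) i (g • b - b') = 0 := by
      cases i with
      | zero => exact ⟨0, Submodule.zero_mem _, by rw [sub_zero]; exact h⟩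
      | succ i =>
        obtain ⟨e, he⟩ := h
        obtain ⟨e', rfl⟩ := cochainMap_surjective x (Submodule.mkQ_surjective _) i e
        exact ⟨d x N i e', ⟨e', rfl⟩, by rw [map_sub, ← d_cochainMap, he, sub_self]⟩
    obtain ⟨a, ha⟩ := (hex i _).1 hbb
    rw [cochainMap_lsmul] at ha
    refine ⟨a, sub_eq_zero.1 (hinj ?_)⟩
    rw [smul_sub, ← map_smul, ha, map_sub, d_boundary x hb', sub_zero, map_smul, hb, smul_comm,
      sub_self]
  · rintro ⟨e, he⟩
    have h1 : d x N i (g • b - y • e) = 0 := by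
      rw [map_sub, map_smul, map_smul, hb, he, smul_comm, sub_self]
    have h2 := cochainMap_boundary x (Submodule.mkQ (y • (⊤ : Submodule S N))) (hN _ h1)
    have h3 : cochainMap x (Submodule.mkQ (y • (⊤ : Submodule S N))) i (y • e) = 0 :=
      (hex i _).2 ⟨e, cochainMap_lsmul x y i e⟩
    rwa [map_sub, h3, sub_zero] at h2

theorem acyclic_quotSMulTop (hreg : IsSMulRegular N y) {i : ℕ} (h : Acyclic x N i)
    (h' : Acyclic x N (i + 1)) : Acyclic x (QuotSMulTop y N) i :=
  CochainOp.van_of_surjective (CochainOp.compat_one (LinearMap.lsmul S N y))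
    (CochainOp.compat_one (Submodule.mkQ (y • (⊤ : Submodule S N)))) hreg
    (exact_lsmul_mkQ N y) (Submodule.mkQ_surjective _) h' h

theorem cochainMap_equiv_mem_boundaries {M : Type*} [AddCommGroup M] [Module S M] (e : M ≃ₗ[S] N)
    {i : ℕ} {c : Cochain x M i} :
    cochainMap x e.toLinearMap i c ∈ boundaries x N i ↔ c ∈ boundaries x M i := by
  refine ⟨fun h => ?_, cochainMap_boundary x _⟩
  have := cochainMap_boundary x e.symm.toLinearMap h
  rwa [← cochainMap_comp, show e.symm.toLinearMap ∘ₗ e.toLinearMap = LinearMap.id from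
    LinearMap.ext fun m => e.symm_apply_apply m, cochainMap_id] at this

end Regular

/-! ### Nonvanishing of cohomology in the degree of the dimension -/

section TopCohomologyNonvanishing

open MvPolynomial IsLocalRing
open scoped Pointwise

variable {R : Type*} [CommRing R] [IsLocalRing R] [IsNoetherianRing R] {n : ℕ} {w : Fin n → ℤ}

theorem supportDim_quotSMulTop_succ_le {S : Type*} [CommRing S] [IsNoetherianRing S] {N : Type*}
    [AddCommGroup N] [Module S N] [Module.Finite S N] {y : S} (hreg : IsSMulRegular N y) :
    Module.supportDim S (QuotSMulTop y N) + 1 ≤ Module.supportDim S N :=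
  Module.supportDim_quotSMulTop_succ_le_of_notMem_minimalPrimes
    fun _ => hreg.notMem_of_mem_minimalPrimes

/-- Since `H^t(S / J) = 0`, the connecting map identifies `H^t(S / (J + (f)))` with the classes of
`H^{t+1}(S / J)` killed by `f`. Classes annihilated by an ideal containing `f` are among them, so
duality passes on. -/
theorem DualIdeal.sup_span {J : Ideal (MvPolynomial (Fin n) R)} {t : ℕ}
    (h : DualIdeal w J (t + 1)) {f : MvPolynomial (Fin n) R} {ν : ℤ}
    (hf : f.IsWeightedHomogeneous w ν)
    (hreg : IsSMulRegular (MvPolynomial (Fin n) R ⧸ J) f) : DualIdeal w (J ⊔ Ideal.span {f}) t where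
  isHomog := h.isHomog.sup_span hf
  le := h.le.trans le_sup_left
  dim_le := by
    have h1 := (supportDim_quotSMulTop_succ_le hreg).trans h.dim_le
    rw [← Module.supportDim_eq_of_equiv (quotSMulTopQuotientEquiv J f)] at h1
    push_cast at h1
    have h2 := ENat.WithBot.lt_add_one_iff.1 (lt_of_add_lt_add_right (a := 1) (lt_of_le_of_lt h1
      (ENat.WithBot.lt_add_one_iff (n := t + 1).2 (by push_cast; exact le_rfl))))
    exact h2
  acyclic i hi := acyclic_of_equiv _ (quotSMulTopQuotientEquiv J f).symm
    (acyclic_quotSMulTop _ hreg (h.acyclic i (by omega)) (h.acyclic (i + 1) (by omega)))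
  exists_coh J' hJ'w hJ' s hs := by
    obtain ⟨c, -, hJc, hsc⟩ := h.exists_coh J' hJ'w (le_sup_left.trans hJ') s hs
    obtain ⟨b, hb, hb'⟩ := exists_cochain_quotSMulTop (vars R n)
      (hJc f (hJ' (Ideal.mem_sup_right (Ideal.mem_span_singleton_self f))))
    have key := smul_cochainMap_mem_boundaries_iff (vars R n) hreg (h.acyclic t (by omega)) hb
    refine ⟨cochainMap (vars R n) (quotSMulTopQuotientEquiv J f).symm.toLinearMap t
      (cochainMap (vars R n) (Submodule.mkQ _) t b), ?_, fun g hg => ?_, ?_⟩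
    · rw [d_cochainMap, hb', map_zero]
    · rw [← map_smul, cochainMap_equiv_mem_boundaries, key]
      exact hJc g hg
    · rw [← map_smul, cochainMap_equiv_mem_boundaries, key]
      exact hsc

/-- Choose `t` minimal. If no associated prime of `S / J` contained `I`, homogeneous prime avoidance
would give a homogeneous `f ∈ I` regular on `S / J`, and `J + (f)` would contradict minimality. -/
theorem exists_dualIdeal (hw : ∀ j, 0 < w j) {I : Ideal (MvPolynomial (Fin n) R)}
    (hI : IsHomog w I) (hle : extMax R n ≤ I) (hne : I ≠ ⊤) :
    ∃ (t : ℕ) (J Q : Ideal (MvPolynomial (Fin n) R)), DualIdeal w J t ∧ J ≤ I ∧ I ≤ Q ∧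
      Q.IsPrime ∧ ∃ s ∉ J, ∀ g, g * s ∈ J ↔ g ∈ Q := by
  classical
  have hex : ∃ t, ∃ J : Ideal (MvPolynomial (Fin n) R), DualIdeal w J t ∧ J ≤ I :=
    ⟨n, _, dualIdeal_extMax hw, hle⟩
  obtain ⟨J, hJ, hJI⟩ := Nat.find_spec hex
  set t := Nat.find hex with ht
  refine ⟨t, J, ?_⟩
  have hmem : ∀ Q ∈ associatedPrimes (MvPolynomial (Fin n) R) (MvPolynomial (Fin n) R ⧸ J),
      Q.IsPrime ∧ ∃ s, ∀ g, g * s ∈ J ↔ g ∈ Q := by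
    intro Q hQ
    obtain ⟨hQ, z, hz⟩ := isAssociatedPrime_iff.1 hQ
    obtain ⟨s, rfl⟩ := Submodule.Quotient.mk_surjective _ z
    refine ⟨hQ, s, fun g => ?_⟩
    rw [hz, Submodule.mem_colon_singleton, Submodule.mem_bot, ← Submodule.Quotient.mk_smul,
      Submodule.Quotient.mk_eq_zero, smul_eq_mul]
  by_cases hQ : ∃ Q ∈ associatedPrimes (MvPolynomial (Fin n) R) (MvPolynomial (Fin n) R ⧸ J), I ≤ Q
  · obtain ⟨Q, hQ, hIQ⟩ := hQ
    obtain ⟨hQ, s, hs⟩ := hmem Q hQ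
    refine ⟨Q, hJ, hJI, hIQ, hQ, s, fun h => hQ.ne_top ((Ideal.eq_top_iff_one _).2 ?_), hs⟩
    rw [← hs, one_mul]
    exact h
  push Not at hQ
  obtain ⟨f, hfI, ν, hfν, hf⟩ := hI.exists_avoiding hw
    (associatedPrimes.finite (MvPolynomial (Fin n) R) (MvPolynomial (Fin n) R ⧸ J)).toFinset
    fun Q h => by
      rw [Set.Finite.mem_toFinset] at h
      obtain ⟨hQ', s, hs⟩ := hmem Q h
      exact ⟨hQ', fun g hg => (hs g).1 (Ideal.mul_mem_right _ _ (hJ.le hg)), hQ Q h⟩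
  have hreg : IsSMulRegular (MvPolynomial (Fin n) R ⧸ J) f := by
    have h1 := biUnion_associatedPrimes_eq_compl_regular (MvPolynomial (Fin n) R)
      (MvPolynomial (Fin n) R ⧸ J)
    by_contra h2
    have h3 : f ∈ ({r | IsSMulRegular (MvPolynomial (Fin n) R ⧸ J) r} : Set _)ᶜ := h2
    rw [← h1] at h3
    obtain ⟨Q, hQ', hfQ⟩ := Set.mem_iUnion₂.1 h3
    exact hf Q ((Set.Finite.mem_toFinset _).2 hQ') hfQ
  have hle' : J ⊔ Ideal.span {f} ≤ I :=
    sup_le hJI ((Ideal.span_singleton_le_iff_mem _).2 hfI)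
  exfalso
  cases h0 : t with
  | zero =>
    rw [h0] at hJ
    -- For `t = 0` the quotient by `J + (f)` would have negative dimension, although it is nonzero
    -- because `I` is proper.
    have h1 := (supportDim_quotSMulTop_succ_le hreg).trans hJ.dim_le
    rw [← Module.supportDim_eq_of_equiv (quotSMulTopQuotientEquiv J f)] at h1
    have : Nontrivial (MvPolynomial (Fin n) R ⧸ J ⊔ Ideal.span {f}) :=
      Ideal.Quotient.nontrivial_iff.2 fun h => hne (top_le_iff.1 (h ▸ hle'))
    have h2 := Module.supportDim_ne_bot_of_nontrivial (MvPolynomial (Fin n) R)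
      (MvPolynomial (Fin n) R ⧸ J ⊔ Ideal.span {f})
    obtain ⟨a, ha⟩ := WithBot.ne_bot_iff_exists.1 h2
    rw [← ha] at h1
    have h3 : ((a + 1 : ℕ∞) : WithBot ℕ∞) ≤ ((0 : ℕ∞) : WithBot ℕ∞) := h1
    rw [WithBot.coe_le_coe] at h3
    simp at h3
  | succ t' =>
    rw [h0] at hJ
    exact Nat.find_min hex (m := t') (by omega) ⟨_, hJ.sup_span hfν hreg, hle'⟩

/-- A nonzero element of `P` lifts to some `y ∉ Q`, which is regular on the domain `S / Q`. -/
theorem supportDim_quotient_lt {S : Type*} [CommRing S] [IsNoetherianRing S] {Q : Ideal S}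
    (hQ : Q.IsPrime) {P : Submodule S (S ⧸ Q)} (hP : P ≠ ⊥) :
    Module.supportDim S ((S ⧸ Q) ⧸ P) + 1 ≤ Module.supportDim S (S ⧸ Q) := by
  obtain ⟨z, hz, hz0⟩ := Submodule.exists_mem_ne_zero_of_ne_bot hP
  obtain ⟨y, rfl⟩ := Submodule.Quotient.mk_surjective _ z
  have hy : y ∉ Q := fun h => hz0 ((Submodule.Quotient.mk_eq_zero _).2 h)
  have hreg : IsSMulRegular (S ⧸ Q) y :=
    isSMulRegular_quotient_iff.2 fun s hs => (hQ.mem_or_mem hs).resolve_left hy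
  refine le_trans ?_ (supportDim_quotSMulTop_succ_le hreg)
  have hle : y • (⊤ : Submodule S (S ⧸ Q)) ≤ P := by
    intro m hm
    obtain ⟨a, -, rfl⟩ := (Submodule.mem_smul_pointwise_iff_exists _ _ _).1 hm
    obtain ⟨a, rfl⟩ := Submodule.Quotient.mk_surjective _ a
    rw [← Submodule.Quotient.mk_smul, smul_eq_mul, mul_comm, ← smul_eq_mul,
      Submodule.Quotient.mk_smul]
    exact P.smul_mem _ hz
  gcongr
  exact Module.supportDim_le_of_surjective (Submodule.factor hle) (Submodule.factor_surjective hle)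

/-- A finite module over a polynomial ring that is annihilated by the maximal ideal of the
coefficients has nonzero cohomology in the degree given by its dimension. -/
theorem exists_supportDim_eq_not_acyclic (hw : ∀ j, 0 < w j) {N : Type*} [AddCommGroup N]
    [Module (MvPolynomial (Fin n) R) N] [Module.Finite (MvPolynomial (Fin n) R) N] [Nontrivial N]
    (hle : extMax R n ≤ Module.annihilator (MvPolynomial (Fin n) R) N)
    (hhom : IsHomog w (Module.annihilator (MvPolynomial (Fin n) R) N)) :
    ∃ t : ℕ, Module.supportDim (MvPolynomial (Fin n) R) N = t ∧ ¬ Acyclic (vars R n) N t := by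
  set I := Module.annihilator (MvPolynomial (Fin n) R) N with hI
  have hne : I ≠ ⊤ := by
    intro h
    rw [hI, Module.annihilator_eq_top_iff] at h
    exact not_subsingleton N h
  obtain ⟨t, J, Q, hJ, hJI, hIQ, hQ, s, hs, hsQ⟩ := exists_dualIdeal hw hhom hle hne
  have hdimI : Module.supportDim (MvPolynomial (Fin n) R) N =
      Module.supportDim (MvPolynomial (Fin n) R) (MvPolynomial (Fin n) R ⧸ I) := by
    rw [Module.supportDim_eq_ringKrullDim_quotient_annihilator,
      Module.supportDim_quotient_eq_ringKrullDim]
  have h1 : Module.supportDim (MvPolynomial (Fin n) R) N ≤ t := by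
    rw [hdimI]
    exact (Module.supportDim_le_of_surjective (Submodule.factor hJI)
      (Submodule.factor_surjective hJI)).trans hJ.dim_le
  have hJQ := hJI.trans hIQ
  -- As `Q` is the annihilator of `s` modulo `J`, multiplication by `s` on `S / J` factors through
  -- `S / Q`. By duality for `J' = J` it is nonzero on `H^t(S / J)`.
  have h2 : ¬ Acyclic (vars R n) (MvPolynomial (Fin n) R ⧸ Q) t := by
    intro h
    obtain ⟨c, hc, -, hsc⟩ := hJ.exists_coh J hJ.isHomog le_rfl s hs
    refine hsc ?_
    let φ : (MvPolynomial (Fin n) R ⧸ Q) →ₗ[MvPolynomial (Fin n) R] MvPolynomial (Fin n) R ⧸ J :=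
      Submodule.liftQ Q (LinearMap.toSpanSingleton _ _ (Submodule.Quotient.mk s)) fun g hg => by
        rw [LinearMap.mem_ker, LinearMap.toSpanSingleton_apply, ← Submodule.Quotient.mk_smul,
          Submodule.Quotient.mk_eq_zero]
        exact (hsQ g).2 hg
    have hφ : φ ∘ₗ Submodule.factor hJQ = s • LinearMap.id := by
      refine LinearMap.ext fun z => ?_
      obtain ⟨z, rfl⟩ := Submodule.Quotient.mk_surjective _ z
      change z • (Submodule.Quotient.mk s : MvPolynomial (Fin n) R ⧸ J) =
        s • Submodule.Quotient.mk z
      rw [← Submodule.Quotient.mk_smul, ← Submodule.Quotient.mk_smul, smul_eq_mul, smul_eq_mul,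
        mul_comm]
    rw [← cochainMap_id (vars R n) t c, ← cochainMap_smul, ← hφ, cochainMap_comp]
    exact cochainMap_boundary _ _ (h _ (by rw [d_cochainMap, hc, map_zero]))
  -- Grothendieck vanishing turns nonvanishing into `t ≤ dim S / Q`, which squeezes the dimension of
  -- `N` to `t`.
  have h3 : (t : WithBot ℕ∞) ≤
      Module.supportDim (MvPolynomial (Fin n) R) (MvPolynomial (Fin n) R ⧸ Q) := by
    by_contra! h
    exact h2 (acyclic_of_supportDim_lt _ h)
  have h4 : Module.supportDim (MvPolynomial (Fin n) R) (MvPolynomial (Fin n) R ⧸ Q) ≤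
      Module.supportDim (MvPolynomial (Fin n) R) N := by
    rw [hdimI]
    exact Module.supportDim_le_of_surjective (Submodule.factor hIQ)
      (Submodule.factor_surjective hIQ)
  refine ⟨t, le_antisymm h1 (h3.trans h4), fun hN => h2 ?_⟩
  -- `H^t(N)` surjects onto `H^t(range ψ)`, as the kernel has dimension at most `t`, and that onto
  -- `H^t(S / Q)`, as the cokernel has dimension below `t`.
  obtain ⟨ψ, hψ⟩ := exists_linearMap_quotient_ne_zero (N := N) hQ hIQ
  have hrange : Acyclic (vars R n) (LinearMap.range ψ) t :=
    CochainOp.van_of_surjective (CochainOp.compat_one (LinearMap.ker ψ).subtype)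
      (CochainOp.compat_one ψ.rangeRestrict) (Submodule.injective_subtype _)
      (by rw [LinearMap.exact_iff, LinearMap.ker_rangeRestrict, Submodule.range_subtype])
      ψ.surjective_rangeRestrict
      (acyclic_of_supportDim_lt (N := LinearMap.ker ψ) _ (lt_of_le_of_lt
        ((Module.supportDim_le_of_injective _ (Submodule.injective_subtype _)).trans h1)
        (by exact_mod_cast Nat.lt_succ_self t))) hN
  refine CochainOp.van_of_exact (CochainOp.compat_one (LinearMap.range ψ).subtype)
    (CochainOp.compat_one (LinearMap.range ψ).mkQ) (Submodule.injective_subtype _)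
    (by rw [LinearMap.exact_iff, Submodule.ker_mkQ, Submodule.range_subtype])
    (Submodule.mkQ_surjective _) hrange (acyclic_of_supportDim_lt _ ?_)
  have h5 := (supportDim_quotient_lt hQ (P := LinearMap.range ψ)
    (by rwa [Ne, LinearMap.range_eq_bot])).trans (h4.trans h1)
  exact lt_of_add_lt_add_right (ENat.WithBot.lt_add_one_iff.2 h5)

end TopCohomologyNonvanishing

/-! ### Tensor products with finite modules -/

section TensorFinite

variable {R : Type*} {S : Type*} [CommRing R] [CommRing S] [Algebra R S]
  {M : Type*} [AddCommGroup M] [Module R M] [Module S M] [IsScalarTower R S M]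
  {X : Type*} [AddCommGroup X] [Module R X]

theorem finite_tensor [Module.Finite S M] [Module.Finite R X] : Module.Finite S (M ⊗[R] X) := by
  obtain ⟨r, b, hb⟩ := Module.Finite.exists_fin (R := R) (M := X)
  refine Module.Finite.of_surjective
    (∑ i : Fin r, tmulRight (R := R) (S := S) M (b i) ∘ₗ LinearMap.proj i) fun z => ?_
  induction z with
  | zero => exact ⟨0, map_zero _⟩
  | add z z' h h' =>
    obtain ⟨a, rfl⟩ := h
    obtain ⟨a', rfl⟩ := h'
    exact ⟨a + a', map_add _ _ _⟩
  | tmul m y =>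
    obtain ⟨c, rfl⟩ := (Submodule.mem_span_range_iff_exists_fun R).1
      (hb ▸ Submodule.mem_top : y ∈ Submodule.span R (Set.range b))
    refine ⟨fun i => c i • m, ?_⟩
    simp only [LinearMap.sum_apply, LinearMap.comp_apply, LinearMap.proj_apply,
      TensorProduct.tmul_sum]
    exact Finset.sum_congr rfl fun i _ => TensorProduct.smul_tmul _ _ _

theorem annihilator_le_tensor : Module.annihilator S M ≤ Module.annihilator S (M ⊗[R] X) := by
  intro s hs
  rw [Module.mem_annihilator] at hs ⊢
  intro z
  induction z with
  | zero => exact smul_zero _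
  | add z z' h h' => rw [smul_add, h, h', add_zero]
  | tmul m y => rw [TensorProduct.smul_tmul', hs, TensorProduct.zero_tmul]

end TensorFinite

/-! ### The kernel of reduction modulo an ideal on cohomology -/

section Nakayama

variable {R : Type*} {S : Type*} [CommRing R] [CommRing S] [Algebra R S]
variable {n : ℕ} {x : Fin n → S} {w : Fin n → ℤ}

theorem cochainMap_sum {M N ι : Type*} [AddCommGroup M] [Module S M] [AddCommGroup N] [Module S N]
    (s : Finset ι) (f : ι → M →ₗ[S] N) (i : ℕ) (c : Cochain x M i) :
    cochainMap x (∑ j ∈ s, f j) i c = ∑ j ∈ s, cochainMap x (f j) i c := by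
  induction s using Finset.cons_induction with
  | empty => simp [cochainMap_zero]
  | cons j s hj ih => rw [Finset.sum_cons, cochainMap_add, ih, Finset.sum_cons]

variable (S) (M : Type*) [AddCommGroup M] [Module R M] [Module S M] [IsScalarTower R S M]

/-- The map `M ⊗ X → M` given by a functional on `X`. -/
def tensorEval {X : Type*} [AddCommGroup X] [Module R X] (α : X →ₗ[R] R) : M ⊗[R] X →ₗ[S] M :=
  (TensorProduct.AlgebraTensorModule.rid R S M).toLinearMap ∘ₗ
    TensorProduct.AlgebraTensorModule.lTensor S M α

variable {S M}

theorem tensorEval_tmul {X : Type*} [AddCommGroup X] [Module R X] (α : X →ₗ[R] R) (m : M)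
    (y : X) : tensorEval S M α (m ⊗ₜ y) = α y • m := rfl

theorem Grading.compat_tensorEval (G : Grading R x w M) {X : Type*} [AddCommGroup X] [Module R X]
    (α : X →ₗ[R] R) : (G.tensor X).Compat G (tensorEval S M α) := by
  intro μ z
  induction z with
  | zero => simp
  | add z z' h h' => simp only [map_add, h, h']
  | tmul m y =>
    rw [tensorEval_tmul, map_smul]
    rfl

theorem tensorEval_fintypeLinearCombination {r : ℕ} (a : Fin r → R) :
    tensorEval S M (Fintype.linearCombination R a) =
      ∑ j, algebraMap R S (a j) • tensorEval S M (LinearMap.proj j) := by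
  refine LinearMap.ext fun z => ?_
  rw [LinearMap.sum_apply]
  induction z with
  | zero => simp
  | add z z' h h' => simp only [map_add, h, h', Finset.sum_add_distrib]
  | tmul m y =>
    simp only [LinearMap.smul_apply, tensorEval_tmul, Fintype.linearCombination_apply,
      Finset.sum_smul, algebraMap_smul, smul_smul, LinearMap.proj_apply, smul_eq_mul]
    exact Finset.sum_congr rfl fun j _ => by rw [mul_comm]

theorem sum_tmulRight_comp_tensorEval (r : ℕ) :
    ∑ j : Fin r, tmulRight (S := S) M (Pi.single j (1 : R)) ∘ₗ
      tensorEval S M (LinearMap.proj (R := R) (φ := fun _ => R) j) = LinearMap.id := by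
  refine LinearMap.ext fun z => ?_
  rw [LinearMap.sum_apply, LinearMap.id_apply]
  induction z with
  | zero => simp
  | add z z' h h' =>
    simp only [map_add, Finset.sum_add_distrib]
    rw [h, h']
  | tmul m y =>
    change ∑ j, (y j • m) ⊗ₜ[R] Pi.single j 1 = m ⊗ₜ[R] y
    conv_rhs => rw [pi_eq_sum_univ' y, TensorProduct.tmul_sum]
    exact Finset.sum_congr rfl fun j _ => TensorProduct.smul_tmul _ _ _

/-- The identity of `M ⊗ R ^ r` is a sum of `r` homogeneous maps factoring through `M`. -/
theorem Grading.van_tensor_pi (G : Grading R x w M) {i : ℕ} {μ : ℤ}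
    (h : (G.op μ).Van i) (r : ℕ) : ((G.tensor (Fin r → R)).op μ).Van i := by
  intro c hc
  have hsum := cochainMap_id x i (((G.tensor (Fin r → R)).op μ).op i c)
  rw [← sum_tmulRight_comp_tensorEval, cochainMap_sum] at hsum
  rw [← hsum]
  refine Submodule.sum_mem _ fun j _ => ?_
  have hj := (G.compat_tensorEval (LinearMap.proj (R := R) (φ := fun _ : Fin r => R) j)).op μ i c
  rw [cochainMap_comp, hj]
  exact cochainMap_boundary _ _ (h _ (by rw [d_cochainMap, hc, map_zero]))

/-- Right exactness of `M ⊗ -` on `X → R → R / I → 0`, with `M ⊗ R` identified with `M`. -/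
theorem exact_tensorEval_tmulRight (I : Ideal R) {X : Type*} [AddCommGroup X] [Module R X]
    {α : X →ₗ[R] R} (hα : LinearMap.range α = I) :
    Function.Exact (tensorEval S M α) (tmulRight (R := R) (S := S) M (1 : R ⧸ I)) := by
  have h1 : Function.Exact α (Submodule.mkQ I) := by
    rw [LinearMap.exact_iff, Submodule.ker_mkQ, hα]
  have h2 := lTensor_exact M h1 (Submodule.mkQ_surjective I)
  intro m
  have h3 := h2 (m ⊗ₜ 1)
  rw [LinearMap.lTensor_tmul] at h3
  change m ⊗ₜ[R] (1 : R ⧸ I) = 0 ↔ _ at h3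
  refine h3.trans ⟨?_, ?_⟩
  · rintro ⟨z, hz⟩
    refine ⟨z, ?_⟩
    change TensorProduct.AlgebraTensorModule.rid R S M (LinearMap.lTensor M α z) = m
    rw [hz, TensorProduct.AlgebraTensorModule.rid_tmul, one_smul]
  · rintro ⟨z, rfl⟩
    refine ⟨z, (TensorProduct.AlgebraTensorModule.rid R S M).injective ?_⟩
    rw [TensorProduct.AlgebraTensorModule.rid_tmul, one_smul]
    rfl

theorem tmulRight_one_surjective (I : Ideal R) :
    Function.Surjective (tmulRight (R := R) (S := S) M (1 : R ⧸ I)) := by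
  intro z
  induction z with
  | zero => exact ⟨0, map_zero _⟩
  | add z z' h h' =>
    obtain ⟨a, rfl⟩ := h
    obtain ⟨a', rfl⟩ := h'
    exact ⟨a + a', map_add _ _ _⟩
  | tmul m y =>
    obtain ⟨r, rfl⟩ := Ideal.Quotient.mk_surjective y
    refine ⟨r • m, ?_⟩
    change (r • m) ⊗ₜ[R] (1 : R ⧸ I) = _
    rw [TensorProduct.smul_tmul, Algebra.smul_def, mul_one]
    rfl

theorem range_fintypeLinearCombination {I : Ideal R} {r : ℕ} {a : Fin r → R}
    (ha : Ideal.span (Set.range a) = I) :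
    LinearMap.range (Fintype.linearCombination R a) = I := by
  rw [← ha, Fintype.range_linearCombination]

/-- `M / I M = M ⊗ R / I`. -/
def quotientTensorEquiv (I : Ideal R) :
    (M ⧸ (I.map (algebraMap R S) • (⊤ : Submodule S M))) ≃ₗ[S] M ⊗[R] (R ⧸ I) :=
  (Submodule.quotEquivOfEq _ _ (by
    apply le_antisymm
    · rw [Submodule.smul_le]
      intro s hs m _
      rw [LinearMap.mem_ker, map_smul]
      suffices h : I.map (algebraMap R S) ≤ Module.annihilator S (M ⊗[R] (R ⧸ I)) from
        Module.mem_annihilator.1 (h hs) _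
      rw [Ideal.map_le_iff_le_comap]
      intro a ha
      rw [Ideal.mem_comap, Module.mem_annihilator]
      intro z
      obtain ⟨m, rfl⟩ := tmulRight_one_surjective (S := S) I z
      change (algebraMap R S a • m) ⊗ₜ[R] (1 : R ⧸ I) = 0
      rw [algebraMap_smul, TensorProduct.smul_tmul, Algebra.smul_def, mul_one,
        Ideal.Quotient.algebraMap_eq, Ideal.Quotient.eq_zero_iff_mem.2 ha, TensorProduct.tmul_zero]
    · intro m hm
      obtain ⟨z, rfl⟩ := (exact_tensorEval_tmulRight I (α := I.subtype) I.range_subtype m).1 hm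
      induction z with
      | zero => rw [map_zero]; exact Submodule.zero_mem _
      | add z z' h h' =>
        rw [map_add]
        have key : ∀ z, tensorEval S M I.subtype z ∈ LinearMap.ker (tmulRight (R := R) (S := S) M
          (1 : R ⧸ I)) := fun z =>
          (exact_tensorEval_tmulRight I (α := I.subtype) I.range_subtype _).2 ⟨z, rfl⟩
        exact add_mem (h (key z)) (h' (key z'))
      | tmul m y =>
        rw [tensorEval_tmul, ← algebraMap_smul S (I.subtype y) m]
        exact Submodule.smul_mem_smul (Ideal.mem_map_of_mem _ y.2) trivial)).trans
    (LinearMap.quotKerEquivOfSurjective _ (tmulRight_one_surjective I))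

variable (x) in
/-- If `H^{i+1}(W) = 0` for the kernel `W` of `M ⊗ R ^ r → M`, then the kernel of
`H^i(M) → H^i(M ⊗ R / I)` is `I H^i(M)`. -/
theorem exists_sum_smul_of_van {I : Ideal R} {r : ℕ} {a : Fin r → R}
    (ha : Ideal.span (Set.range a) = I)
    {PW : CochainOp x (LinearMap.ker (tensorEval S M (Fintype.linearCombination R a)))}
    {PF : CochainOp x (M ⊗[R] (Fin r → R))} {PM : CochainOp x M}
    (hW : PW.Compat PF (LinearMap.ker (tensorEval S M (Fintype.linearCombination R a))).subtype)
    (hF : PF.Compat PM (tensorEval S M (Fintype.linearCombination R a)))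
    {i : ℕ} (h : PW.Van (i + 1)) {c : Cochain x M i} (hc : d x M i c = 0)
    (hk : cochainMap x (tmulRight M (1 : R ⧸ I)) i c ∈ boundaries x (M ⊗[R] (R ⧸ I)) i) :
    ∃ b : Fin r → Cochain x M i, (∀ j, d x M i (b j) = 0) ∧
      PM.op i c - ∑ j, algebraMap R S (a j) • b j ∈ boundaries x M i := by
  -- The class lifts to `M ⊗ R ^ r`; the coordinates `b j` of the lift express it as `∑ a j • b j`.
  obtain ⟨z, hz, hcz⟩ := CochainOp.exists_lift_of_van hW hF (Submodule.injective_subtype _)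
    (by rw [LinearMap.exact_iff, Submodule.range_subtype])
    (exact_tensorEval_tmulRight I (range_fintypeLinearCombination ha))
    (tmulRight_one_surjective I) h hc hk
  refine ⟨fun j => cochainMap x (tensorEval S M (LinearMap.proj j)) i z,
    fun j => by rw [d_cochainMap, hz, map_zero], ?_⟩
  convert hcz using 2
  rw [tensorEval_fintypeLinearCombination]
  rw [cochainMap_sum]
  exact Finset.sum_congr rfl fun j _ => (cochainMap_smul x _ _ i z).symm

end Nakayama

/-! ### Nakayama's lemma for graded pieces of cohomology -/

section NakayamaLocal

open IsLocalRing

variable {R : Type*} {S : Type*} [CommRing R] [IsLocalRing R] [CommRing S] [Algebra R S]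
variable {n : ℕ} {x : Fin n → S} {w : Fin n → ℤ}
variable {M : Type*} [AddCommGroup M] [Module R M] [Module S M] [IsScalarTower R S M]

/-- Classes of degree `μ` die in `H^i(M ⊗ k)`, hence lie in `𝔪 H^i(M)`. Projecting the coefficients
to degree `μ` gives `H^i(M)_μ = 𝔪 H^i(M)_μ`, and this piece is finite over `R`. -/
theorem Grading.van_of_van_tensor {r : ℕ} {a : Fin r → R}
    (ha : Ideal.span (Set.range a) = maximalIdeal R) (G : Grading R x w M) {i : ℕ} {μ : ℤ}
    (hfg : (cohDeg x w G.deg i μ).FG)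
    (hW : ((Grading.ker (G.compat_tensorEval (Fintype.linearCombination R a))).op μ).Van (i + 1))
    (hk : ((G.tensor (R ⧸ maximalIdeal R)).op μ).Van i) : (G.op μ).Van i := by
  rw [← Grading.cohDeg_eq_bot_iff]
  refine Submodule.eq_bot_of_le_smul_of_le_jacobson_bot (maximalIdeal R) _ hfg ?_
    (maximalIdeal_le_jacobson _)
  intro y hy
  obtain ⟨c, hc, hcμ, rfl⟩ := G.mem_cohDeg.1 hy
  have h1 : cochainMap x (tmulRight M (1 : R ⧸ maximalIdeal R)) i c ∈
      boundaries x (M ⊗[R] (R ⧸ maximalIdeal R)) i := by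
    rw [← hcμ, ← Grading.op_apply, (G.compat_tmulRight (1 : R ⧸ maximalIdeal R)).op μ]
    exact hk _ (by rw [d_cochainMap, hc, map_zero])
  obtain ⟨b, hb, hcb⟩ := exists_sum_smul_of_van x ha
    ((Grading.compat_ker (G.compat_tensorEval (Fintype.linearCombination R a))).op μ)
    ((G.compat_tensorEval (Fintype.linearCombination R a)).op μ) hW hc h1
  have h2 := (G.op μ).op_boundary hcb
  rw [map_sub, CochainOp.op_op, Grading.op_apply, hcμ, map_sum] at h2
  have h3 : ∀ j, (G.op μ).op i (algebraMap R S (a j) • b j) = a j • G.cochainProj μ i (b j) := by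
    intro j
    rw [Grading.op_apply, algebraMap_smul, map_smul]
  simp only [h3] at h2
  have h4 : cls x c hc = ∑ j, a j • cls x _ (G.d_cochainProj_eq_zero (hb j) μ) := by
    have h5 : ∑ j, a j • cls x _ (G.d_cochainProj_eq_zero (hb j) μ) =
        cls x (∑ j, a j • G.cochainProj μ i (b j)) (by
          rw [map_sum]
          refine Finset.sum_eq_zero fun j _ => ?_
          rw [← algebraMap_smul S, map_smul, G.d_cochainProj_eq_zero (hb j) μ, smul_zero]) := by
      let q := (((boundaries x M i).submoduleOf (LinearMap.ker (d x M i))).mkQ.restrictScalars R)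
      have : ∀ j, a j • cls x _ (G.d_cochainProj_eq_zero (hb j) μ) =
          q (a j • ⟨_, G.d_cochainProj_eq_zero (hb j) μ⟩) := fun j => (map_smul q _ _).symm
      simp only [this]
      rw [← map_sum]
      change q _ = q _
      congr 1
      apply Subtype.ext
      simp
    rw [h5, cls_eq]
    exact h2
  rw [h4]
  exact Submodule.sum_mem _ fun j _ => Submodule.smul_mem_smul
    (ha ▸ Ideal.subset_span ⟨j, rfl⟩) (G.cls_cochainProj_mem (hb j) μ)

end NakayamaLocal

/-! ### Supports and dimensions of closed fibres -/

section SupportDim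

variable {S : Type*} [CommRing S]
variable {M : Type*} [AddCommGroup M] [Module S M] [Module.Finite S M]
variable {N : Type*} [AddCommGroup N] [Module S N] [Module.Finite S N]

theorem support_subset_of_annihilator_le (h : Module.annihilator S M ≤ Module.annihilator S N) :
    Module.support S N ⊆ Module.support S M := fun P hP => by
  rw [Module.mem_support_iff_of_finite] at hP ⊢
  exact h.trans hP

theorem supportDim_le_of_support_subset {M N : Type*} [AddCommGroup M] [Module S M]
    [AddCommGroup N] [Module S N] (h : Module.support S N ⊆ Module.support S M) :
    Module.supportDim S N ≤ Module.supportDim S M :=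
  Order.krullDim_le_of_strictMono (fun P => (⟨P.1, h P.2⟩ : Module.support S M)) fun _ _ hab => hab

theorem support_tensor_quotient {R : Type*} [CommRing R] [Algebra R S] [Module R M]
    [IsScalarTower R S M] (I : Ideal R) : Module.support S (M ⊗[R] (R ⧸ I)) =
      Module.support S M ∩ PrimeSpectrum.zeroLocus (I.map (algebraMap R S)) := by
  rw [← (quotientTensorEquiv (S := S) (M := M) I).support_eq, Module.support_quotient]

/-- Only the part of the support over `V(I)` enters, so the inclusion of supports need only be
checked there. -/
theorem supportDim_tensor_quotient_le {R : Type*} [CommRing R] [Algebra R S] [Module R M]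
    [IsScalarTower R S M] [Module R N] [IsScalarTower R S N] (I : Ideal R)
    (h : Module.support S N ∩ PrimeSpectrum.zeroLocus (I.map (algebraMap R S)) ⊆
      Module.support S M) :
    Module.supportDim S (N ⊗[R] (R ⧸ I)) ≤ Module.supportDim S (M ⊗[R] (R ⧸ I)) := by
  apply supportDim_le_of_support_subset
  rw [support_tensor_quotient, support_tensor_quotient]
  exact fun P hP => ⟨h hP, hP.2⟩

theorem annihilator_le_of_injective {M N : Type*} [AddCommGroup M] [Module S M]
    [AddCommGroup N] [Module S N] {f : N →ₗ[S] M} (hf : Function.Injective f) :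
    Module.annihilator S M ≤ Module.annihilator S N := by
  intro s hs
  rw [Module.mem_annihilator] at hs ⊢
  exact fun m => hf (by rw [map_smul, hs, map_zero])

end SupportDim

/-! ### Vanishing above the dimension of the closed fibre -/

section Vanishing

open IsLocalRing

variable {R : Type u} [CommRing R] [IsLocalRing R] [IsNoetherianRing R] {n : ℕ} {w : Fin n → ℤ}

local notation "𝒮" => MvPolynomial (Fin n) R

theorem exists_fin_generators (I : Ideal R) : ∃ (r : ℕ) (a : Fin r → R),
    Ideal.span (Set.range a) = I := by
  obtain ⟨s, hs⟩ := IsNoetherian.noetherian I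
  obtain ⟨a, ha⟩ : ∃ a : Fin s.card → R, Set.range a = s :=
    ⟨fun j => s.equivFin.symm j, by
      ext y
      simp only [Set.mem_range, Finset.mem_coe]
      exact ⟨by rintro ⟨j, rfl⟩; exact (s.equivFin.symm j).2,
        fun h => ⟨s.equivFin ⟨y, h⟩, by simp⟩⟩⟩
  exact ⟨_, a, by rw [ha]; exact hs⟩

/-- One step of the descending induction. The kernel of `N ⊗ R ^ r → N` has no larger closed fibre,
so `H` applies to it; it lives in the universe `max u v`, which is why `H` is kept apart from `N`.
-/
theorem acyclic_of_supportDim_tensor_lt_of_forall (hw : ∀ j, 0 < w j) {N : Type v}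
    [AddCommGroup N] [Module R N] [Module 𝒮 N] [IsScalarTower R 𝒮 N] [Module.Finite 𝒮 N]
    (G : Grading R (vars R n) w N) {i : ℕ}
    (h : Module.supportDim 𝒮 (N ⊗[R] (R ⧸ maximalIdeal R)) < i)
    (H : ∀ (W : Type (max u v)) [AddCommGroup W] [Module R W] [Module 𝒮 W] [IsScalarTower R 𝒮 W]
      [Module.Finite 𝒮 W], Grading R (vars R n) w W →
      Module.supportDim 𝒮 (W ⊗[R] (R ⧸ maximalIdeal R)) < (i + 1 : ℕ) →
      Acyclic (vars R n) W (i + 1)) : Acyclic (vars R n) N i := by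
  obtain ⟨r, a, ha⟩ := exists_fin_generators (maximalIdeal R)
  have : Module.Finite 𝒮 (N ⊗[R] (Fin r → R)) := finite_tensor
  have : Module.Finite 𝒮 (N ⊗[R] (R ⧸ maximalIdeal R)) := finite_tensor
  refine G.acyclic_of_forall_van fun μ => G.van_of_van_tensor ha ((G.finBdd hw).1 i μ)
    (CochainOp.van_of_acyclic _ (H _ (Grading.ker (G.compat_tensorEval _)) ?_))
    (CochainOp.van_of_acyclic _ (acyclic_of_supportDim_lt _ h))
  refine lt_of_le_of_lt (supportDim_tensor_quotient_le (M := N) _ ?_)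
    (h.trans (by exact_mod_cast Nat.lt_succ_self i))
  exact fun P hP => support_subset_of_annihilator_le
    (annihilator_le_tensor.trans (annihilator_le_of_injective (Submodule.injective_subtype _))) hP.1

/-- Cohomology vanishes above the dimension of the closed fibre. -/
theorem acyclic_of_supportDim_tensor_lt (hw : ∀ j, 0 < w j) {N : Type v}
    [AddCommGroup N] [Module R N] [Module 𝒮 N] [IsScalarTower R 𝒮 N] [Module.Finite 𝒮 N]
    (G : Grading R (vars R n) w N) {i : ℕ}
    (h : Module.supportDim 𝒮 (N ⊗[R] (R ⧸ maximalIdeal R)) < i) : Acyclic (vars R n) N i := by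
  -- Descending induction on `i`, in the universe `max u v`, which forming the kernel does not
  -- enlarge further.
  have key : ∀ (k i : ℕ), n < i + k → ∀ (W : Type (max u v)) [AddCommGroup W] [Module R W]
      [Module 𝒮 W] [IsScalarTower R 𝒮 W] [Module.Finite 𝒮 W], Grading R (vars R n) w W →
      Module.supportDim 𝒮 (W ⊗[R] (R ⧸ maximalIdeal R)) < i → Acyclic (vars R n) W i := by
    intro k
    induction k with
    | zero => intro i hi W _ _ _ _ _ _ _; exact acyclic_of_lt _ (by omega)
    | succ k ih =>
      intro i hi W _ _ _ _ _ G h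
      exact acyclic_of_supportDim_tensor_lt_of_forall.{u, max u v} hw G h
        (ih (i + 1) (by omega))
  exact acyclic_of_supportDim_tensor_lt_of_forall hw G h (key (n + 1) (i + 1) (by omega))

end Vanishing

/-! ### Supports of `Tor_1` and the local criterion of flatness -/

section LocalFlatness

variable {R : Type*} {S : Type*} [CommRing R] [CommRing S] [Algebra R S]
variable (S) (M : Type*) [AddCommGroup M] [Module R M] [Module S M] [IsScalarTower R S M]

/-- The map `M ⊗ K → M ⊗ F`, as an `S`-linear map. -/
abbrev tensorMap {K F : Type*} [AddCommGroup K] [Module R K] [AddCommGroup F] [Module R F]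
    (α : K →ₗ[R] F) : M ⊗[R] K →ₗ[S] M ⊗[R] F :=
  TensorProduct.AlgebraTensorModule.lTensor S M α

/-- The kernel of `M ⊗ K → M ⊗ F`; if `F` is free and `K` a submodule, this is
`Tor_1(M, F / K)`. -/
abbrev torKer {K F : Type*} [AddCommGroup K] [Module R K] [AddCommGroup F] [Module R F]
    (α : K →ₗ[R] F) : Submodule S (M ⊗[R] K) := LinearMap.ker (tensorMap S M α)

variable {S M}

theorem tensorMap_comp {K F H : Type*} [AddCommGroup K] [Module R K] [AddCommGroup F] [Module R F]
    [AddCommGroup H] [Module R H] (α : K →ₗ[R] F) (β : F →ₗ[R] H) (z : M ⊗[R] K) :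
    tensorMap S M β (tensorMap S M α z) = tensorMap S M (β ∘ₗ α) z :=
  (LinearMap.lTensor_comp_apply M β α z).symm

theorem tensorMap_exact {K F H : Type*} [AddCommGroup K] [Module R K] [AddCommGroup F]
    [Module R F] [AddCommGroup H] [Module R H] {α : K →ₗ[R] F} {β : F →ₗ[R] H}
    (h : Function.Exact α β) (hβ : Function.Surjective β) :
    Function.Exact (tensorMap S M α) (tensorMap S M β) := lTensor_exact M h hβ

theorem tensorMap_surjective {K F : Type*} [AddCommGroup K] [Module R K] [AddCommGroup F]
    [Module R F] {α : K →ₗ[R] F} (h : Function.Surjective α) :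
    Function.Surjective (tensorMap S M α) := LinearMap.lTensor_surjective M h

variable {P : PrimeSpectrum S}

theorem notMem_support_torKer_iff {K F : Type*} [AddCommGroup K] [Module R K] [AddCommGroup F]
    [Module R F] {α : K →ₗ[R] F} : P ∉ Module.support S (torKer S M α) ↔
      ∀ z, tensorMap S M α z = 0 → ∃ s ∉ P.asIdeal, s • z = 0 := by
  rw [Module.notMem_support_iff']
  constructor
  · intro h z hz
    obtain ⟨s, hs, h1⟩ := h ⟨z, hz⟩
    exact ⟨s, hs, congrArg Subtype.val h1⟩
  · rintro h ⟨z, hz⟩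
    obtain ⟨s, hs, h1⟩ := h z hz
    exact ⟨s, hs, Subtype.ext h1⟩

/-- The `Tor_1` of an extension is locally squeezed between those of its ends: a diagram chase in
which elements are successively multiplied by scalars outside `P`. -/
theorem notMem_support_torKer_of_exact {K₁ K I F₁ F H : Type*} [AddCommGroup K₁] [Module R K₁]
    [AddCommGroup K] [Module R K] [AddCommGroup I] [Module R I] [AddCommGroup F₁] [Module R F₁]
    [AddCommGroup F] [Module R F] [AddCommGroup H] [Module R H]
    {i : K₁ →ₗ[R] K} {p : K →ₗ[R] I} {j : F₁ →ₗ[R] F} {q : F →ₗ[R] H}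
    {α₁ : K₁ →ₗ[R] F₁} {α : K →ₗ[R] F} {β : I →ₗ[R] H}
    (hip : Function.Exact i p) (hp : Function.Surjective p)
    (hj : Function.Injective (tensorMap S M j)) (h₁ : α ∘ₗ i = j ∘ₗ α₁) (h₂ : q ∘ₗ α = β ∘ₗ p)
    (hα₁ : P ∉ Module.support S (torKer S M α₁)) (hβ : P ∉ Module.support S (torKer S M β)) :
    P ∉ Module.support S (torKer S M α) := by
  rw [notMem_support_torKer_iff] at *
  intro z hz
  obtain ⟨s, hs, h3⟩ := hβ (tensorMap S M p z) (by
    rw [tensorMap_comp, ← h₂, ← tensorMap_comp, hz, map_zero])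
  rw [← map_smul] at h3
  obtain ⟨y, hy⟩ := (tensorMap_exact hip hp _).1 h3
  obtain ⟨t, ht, h4⟩ := hα₁ y (hj (by
    rw [tensorMap_comp, ← h₁, ← tensorMap_comp, hy, map_smul, hz, smul_zero, map_zero]))
  refine ⟨t * s, fun h => (P.2.mem_or_mem h).elim ht hs, ?_⟩
  rw [mul_smul, ← hy, ← map_smul, h4, map_zero]

theorem tensorMap_injective_of_leftInverse {K F : Type*} [AddCommGroup K] [Module R K]
    [AddCommGroup F] [Module R F] {α : K →ₗ[R] F} (β : F →ₗ[R] K) (h : β ∘ₗ α = LinearMap.id) :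
    Function.Injective (tensorMap S M α) := by
  refine Function.LeftInverse.injective (g := tensorMap S M β) fun z => ?_
  rw [tensorMap_comp, h]
  exact LinearMap.congr_fun (LinearMap.lTensor_id M K) z

/-- If the functor `M ⊗ -` is exact on ideals locally at `P`, it is so on submodules of finite
free modules. -/
theorem notMem_support_torKer_of_ideal
    (hI : ∀ I : Ideal R, P ∉ Module.support S (torKer S M I.subtype)) (r : ℕ)
    (K : Submodule R (Fin r → R)) : P ∉ Module.support S (torKer S M K.subtype) := by
  induction r with
  | zero =>
    rw [notMem_support_torKer_iff]
    intro z _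
    refine ⟨1, fun h => P.2.ne_top ((Ideal.eq_top_iff_one _).2 h), ?_⟩
    rw [one_smul]
    have : Subsingleton K := ⟨fun a b => Subtype.ext (Subsingleton.elim _ _)⟩
    exact Subsingleton.elim _ _
  | succ r ih =>
    let j : (Fin r → R) →ₗ[R] (Fin (r + 1) → R) :=
      { toFun := fun f => Fin.cons 0 f
        map_add' := fun f g => by ext i; refine Fin.cases ?_ (fun i => ?_) i <;> simp
        map_smul' := fun c g => by ext i; refine Fin.cases ?_ (fun i => ?_) i <;> simp }
    let t : (Fin (r + 1) → R) →ₗ[R] (Fin r → R) := LinearMap.funLeft R R Fin.succ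
    let q : (Fin (r + 1) → R) →ₗ[R] R := LinearMap.proj 0
    have htj : t ∘ₗ j = LinearMap.id := rfl
    have hjt : ∀ f, f 0 = 0 → j (t f) = f := fun f hf => by
      ext i
      refine Fin.cases ?_ (fun i => ?_) i
      · exact hf.symm
      · rfl
    -- `K` is an extension of an ideal, its image under the first coordinate, by its intersection
    -- with the remaining `R ^ r`.
    let K₁ := K.comap j
    let I : Ideal R := K.map q
    let i : K₁ →ₗ[R] K := j.restrict fun f hf => hf
    let p : K →ₗ[R] I := q.restrict fun f hf => Submodule.mem_map_of_mem hf
    refine notMem_support_torKer_of_exact (i := i) (p := p) (j := j) (q := q)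
      (α₁ := K₁.subtype) (β := I.subtype) ?_ ?_ (tensorMap_injective_of_leftInverse t htj)
      rfl rfl (ih K₁) (hI I)
    · rintro ⟨f, hf⟩
      constructor
      · intro h
        have h0 : f 0 = 0 := congrArg Subtype.val h
        refine ⟨⟨t f, ?_⟩, Subtype.ext (hjt f h0)⟩
        rw [Submodule.mem_comap, hjt f h0]
        exact hf
      · rintro ⟨g, hg⟩
        rw [← hg]
        rfl
    · rintro ⟨_, f, hf, rfl⟩
      exact ⟨⟨f, hf⟩, rfl⟩

section Colon

variable (I : Ideal R) (a : R)

/-- Tensor the exact sequence `(I : a) → I × R → I + (a) → 0`, where `b ↦ (b a, -b)`. An element of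
`M ⊗ I` that dies in `M ⊗ (I + (a))` comes from `M ⊗ (I : a)`, and the second coordinate shows that
its preimage dies in `M ⊗ R`. -/
theorem exists_mem_torKer_of_tensorMap_inclusion_eq_zero {z : M ⊗[R] I}
    (hz : tensorMap S M (Submodule.inclusion (le_sup_left : I ≤ I ⊔ Ideal.span {a})) z = 0) :
    ∃ (J : Ideal R) (hJ : ∀ b ∈ J, b * a ∈ I) (y : M ⊗[R] J), (∀ b, b * a ∈ I → b ∈ J) ∧
      tensorMap S M J.subtype y = 0 ∧
      tensorMap S M ((LinearMap.mulRight R a).restrict hJ) y = z := by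
  let J : Ideal R := Submodule.comap (LinearMap.mulRight R a) I
  have hJ : ∀ b ∈ J, b * a ∈ I := fun b hb => hb
  let f : J →ₗ[R] I × R := ((LinearMap.mulRight R a).restrict hJ).prod (-J.subtype)
  have ha : a ∈ I ⊔ Ideal.span {a} := Ideal.mem_sup_right (Ideal.mem_span_singleton_self a)
  let g : I × R →ₗ[R] (I ⊔ Ideal.span {a} : Ideal R) :=
    (Submodule.inclusion le_sup_left).coprod (LinearMap.toSpanSingleton R _ ⟨a, ha⟩)
  have hfg : Function.Exact f g := by
    rintro ⟨⟨b, hb⟩, c⟩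
    constructor
    · intro h
      have h1 : b + c * a = 0 := congrArg Subtype.val h
      have h2 : -c * a = b := by linear_combination -h1
      refine ⟨⟨-c, ?_⟩, ?_⟩
      · change -c * a ∈ I
        rwa [h2]
      · refine Prod.ext (Subtype.ext h2) ?_
        change -(-c) = c
        rw [neg_neg]
    · rintro ⟨e, he⟩
      rw [← he]
      apply Subtype.ext
      change e.1 * a + -e.1 * a = 0
      ring
  have hg : Function.Surjective g := by
    rintro ⟨b, hb⟩
    obtain ⟨b₁, hb₁, b₂, hb₂, rfl⟩ := Submodule.mem_sup.1 hb
    obtain ⟨c, rfl⟩ := Ideal.mem_span_singleton'.1 hb₂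
    exact ⟨(⟨b₁, hb₁⟩, c), rfl⟩
  obtain ⟨y, hy⟩ := (tensorMap_exact (S := S) (M := M) hfg hg
    (tensorMap S M (LinearMap.inl R I R) z)).1 (by
      rw [tensorMap_comp, show g ∘ₗ LinearMap.inl R I R = Submodule.inclusion le_sup_left from
        LinearMap.coprod_inl _ _]
      exact hz)
  refine ⟨J, hJ, y, fun b hb => hb, ?_, ?_⟩
  · have h1 := congrArg (tensorMap S M (LinearMap.snd R I R)) hy
    rw [tensorMap_comp, tensorMap_comp, LinearMap.snd_comp_inl,
      show LinearMap.snd R I R ∘ₗ f = -J.subtype from LinearMap.snd_prod _ _] at h1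
    have h2 : tensorMap S M (-J.subtype) y = -tensorMap S M J.subtype y :=
      LinearMap.congr_fun (LinearMap.lTensor_neg (M := M) J.subtype) y
    have h3 : tensorMap S M (0 : I →ₗ[R] R) z = 0 :=
      LinearMap.congr_fun (LinearMap.lTensor_zero M) z
    rw [h2, h3, neg_eq_zero] at h1
    exact h1
  · have h1 := congrArg (tensorMap S M (LinearMap.fst R I R)) hy
    rw [tensorMap_comp, tensorMap_comp, LinearMap.fst_comp_inl,
      show LinearMap.fst R I R ∘ₗ f = (LinearMap.mulRight R a).restrict hJ from
        LinearMap.fst_prod _ _] at h1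
    rw [h1]
    exact LinearMap.congr_fun (LinearMap.lTensor_id M I) z

end Colon

open IsLocalRing in
/-- A form of the local criterion of flatness. -/
theorem notMem_support_torKer_ideal [IsNoetherianRing R] [IsLocalRing R] [IsNoetherianRing S]
    [Module.Finite S M] (hP : (maximalIdeal R).map (algebraMap R S) ≤ P.asIdeal)
    (hm : P ∉ Module.support S (torKer S M (maximalIdeal R).subtype)) (I : Ideal R) :
    P ∉ Module.support S (torKer S M I.subtype) := by
  induction I using (wellFounded_gt (α := Ideal R)).induction with
  | _ I ih =>
  by_cases hI : I = ⊤
  · subst hI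
    rw [notMem_support_torKer_iff]
    intro z hz
    refine ⟨1, fun h => P.2.ne_top ((Ideal.eq_top_iff_one _).2 h), ?_⟩
    rw [one_smul]
    exact tensorMap_injective_of_leftInverse (S := S) (M := M)
      (LinearMap.id.codRestrict ⊤ fun _ => trivial) rfl (hz.trans (map_zero _).symm)
  by_cases hIm : I = maximalIdeal R
  · rwa [hIm]
  obtain ⟨a, ha, haI⟩ := SetLike.exists_of_lt (lt_of_le_of_ne (le_maximalIdeal hI) hIm)
  have hlt : I < I ⊔ Ideal.span {a} := by
    refine lt_of_le_of_ne le_sup_left fun h => haI ?_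
    rw [h]
    exact Ideal.mem_sup_right (Ideal.mem_span_singleton_self a)
  -- Noetherian induction gives the claim for `I + (a)`, so up to a scalar outside `P` the element
  -- `z` comes from the `Tor_1` of `R / (I : a)`.
  have key : ∀ z, tensorMap S M I.subtype z = 0 → ∃ s ∉ P.asIdeal,
      ∃ (J : Ideal R) (hJ : ∀ b ∈ J, b * a ∈ I) (y : M ⊗[R] J), (∀ b, b * a ∈ I → b ∈ J) ∧
      tensorMap S M J.subtype y = 0 ∧
      tensorMap S M ((LinearMap.mulRight R a).restrict hJ) y = s • z := by
    intro z hz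
    obtain ⟨s, hs, h1⟩ := notMem_support_torKer_iff.1 (ih _ hlt)
      (tensorMap S M (Submodule.inclusion le_sup_left) z) (by
        rw [tensorMap_comp]
        exact hz)
    rw [← map_smul] at h1
    exact ⟨s, hs, exists_mem_torKer_of_tensorMap_inclusion_eq_zero I a h1⟩
  by_cases hcolon : ∀ b, b * a ∈ I → b ∈ I
  · have : Module.Finite S (M ⊗[R] I) := finite_tensor
    -- If `(I : a) = I`, this says that `a` acts surjectively on the finite module `Tor_1` locally
    -- at `P`. As `a ∈ 𝔪` maps into `P`, Nakayama's lemma applies; it enters through the support of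
    -- the quotient by `a`.
    suffices h : P ∉ Module.support S (QuotSMulTop (algebraMap R S a) (torKer S M I.subtype)) by
      rw [Module.support_quotSMulTop] at h
      intro h1
      exact h ⟨h1, by
        rw [PrimeSpectrum.mem_zeroLocus, Set.singleton_subset_iff]
        exact hP (Ideal.mem_map_of_mem _ ha)⟩
    rw [Module.notMem_support_iff']
    intro m
    obtain ⟨⟨z, hz⟩, rfl⟩ := Submodule.Quotient.mk_surjective _ m
    obtain ⟨s, hs, J, hJ, y, hJ', hy, hyz⟩ := key z hz
    obtain rfl : J = I := le_antisymm (fun b hb => hcolon b (hJ b hb))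
      fun b hb => hJ' b (Ideal.mul_mem_right _ _ hb)
    refine ⟨s, hs, ?_⟩
    rw [← Submodule.Quotient.mk_smul, Submodule.Quotient.mk_eq_zero,
      Submodule.mem_smul_pointwise_iff_exists]
    refine ⟨⟨y, hy⟩, trivial, Subtype.ext ?_⟩
    change algebraMap R S a • y = s • z
    rw [← hyz, algebraMap_smul, show (LinearMap.mulRight R a).restrict hJ = a • LinearMap.id from
      LinearMap.ext fun b => Subtype.ext (mul_comm b.1 a)]
    change _ = LinearMap.lTensor M (a • LinearMap.id) y
    rw [LinearMap.lTensor_smul, LinearMap.lTensor_id]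
    rfl
  · push Not at hcolon
    obtain ⟨b, hba, hbI⟩ := hcolon
    rw [notMem_support_torKer_iff]
    intro z hz
    obtain ⟨s, hs, J, hJ, y, hJ', hy, hyz⟩ := key z hz
    -- Otherwise the colon ideal is strictly larger and the induction hypothesis covers it.
    have hIJ : I < J := by
      refine lt_of_le_of_ne (fun b hb => hJ' b (Ideal.mul_mem_right _ _ hb)) fun h => hbI ?_
      rw [h]
      exact hJ' b hba
    obtain ⟨t, ht, h1⟩ := notMem_support_torKer_iff.1 (ih J hIJ) y hy
    refine ⟨t * s, fun h => (P.2.mem_or_mem h).elim ht hs, ?_⟩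
    rw [mul_smul, ← hyz, ← map_smul, h1, map_zero]

open IsLocalRing in
theorem support_torKer_subset [IsNoetherianRing R] [IsLocalRing R] [IsNoetherianRing S]
    [Module.Finite S M] {r : ℕ} (K : Submodule R (Fin r → R)) :
    Module.support S (torKer S M K.subtype) ∩
      PrimeSpectrum.zeroLocus ((maximalIdeal R).map (algebraMap R S)) ⊆
    Module.support S (torKer S M (maximalIdeal R).subtype) := by
  rintro P ⟨hP, hPm⟩
  by_contra h
  exact notMem_support_torKer_of_ideal
    (notMem_support_torKer_ideal ((PrimeSpectrum.mem_zeroLocus _ _).1 hPm) h) r K hP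

end LocalFlatness

/-! ### Independence of `Tor_1` from the presentation -/

section Schanuel

variable {R : Type*} {S : Type*} [CommRing R] [CommRing S] [Algebra R S]
variable {M : Type*} [AddCommGroup M] [Module R M] [Module S M] [IsScalarTower R S M]
variable {K F K' F' k : Type*} [AddCommGroup K] [Module R K] [AddCommGroup F] [Module R F]
  [AddCommGroup K'] [Module R K'] [AddCommGroup F'] [Module R F'] [AddCommGroup k] [Module R k]

/-- A map of short exact sequences induces a map on `Tor_1`. -/
def torKerMap {α : K →ₗ[R] F} {α' : K' →ₗ[R] F'} {κ : K →ₗ[R] K'} {φ : F →ₗ[R] F'}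
    (h : α' ∘ₗ κ = φ ∘ₗ α) : torKer S M α →ₗ[S] torKer S M α' :=
  (tensorMap S M κ).restrict fun z hz => by
    rw [LinearMap.mem_ker] at hz ⊢
    rw [tensorMap_comp, h, ← tensorMap_comp, hz, map_zero]

theorem exists_lift_of_exact {α' : K' →ₗ[R] F'} {β' : F' →ₗ[R] k} (hα' : Function.Injective α')
    (h' : Function.Exact α' β') {ι : F →ₗ[R] F'} (hι : β' ∘ₗ ι = 0) :
    ∃ κ : F →ₗ[R] K', α' ∘ₗ κ = ι := by
  have hmem : ∀ y, ι y ∈ LinearMap.range α' := fun y => (h' _).1 (LinearMap.congr_fun hι y)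
  refine ⟨(LinearEquiv.ofInjective α' hα').symm.toLinearMap ∘ₗ ι.codRestrict _ hmem, ?_⟩
  refine LinearMap.ext fun y => ?_
  exact congrArg Subtype.val ((LinearEquiv.ofInjective α' hα').apply_symm_apply ⟨ι y, hmem y⟩)

/-- The composite `ψ φ` differs from the identity by a map into `K`, so `κ' κ = id + η α`; the
second term vanishes on the kernel of `M ⊗ α`. -/
theorem torKerMap_torKerMap {α : K →ₗ[R] F} {β : F →ₗ[R] k} {α' : K' →ₗ[R] F'}
    {φ : F →ₗ[R] F'} {ψ : F' →ₗ[R] F} {κ : K →ₗ[R] K'} {κ' : K' →ₗ[R] K}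
    (hα : Function.Injective α) (h : Function.Exact α β)
    (hκ : α' ∘ₗ κ = φ ∘ₗ α) (hκ' : α ∘ₗ κ' = ψ ∘ₗ α') (hβ : β ∘ₗ (ψ ∘ₗ φ) = β)
    (z : torKer S M α) : torKerMap hκ' (torKerMap hκ z) = z := by
  obtain ⟨η, hη⟩ := exists_lift_of_exact hα h (ι := ψ ∘ₗ φ - LinearMap.id) (by
    rw [LinearMap.comp_sub, hβ, LinearMap.comp_id, sub_self])
  have h1 : κ' ∘ₗ κ = η ∘ₗ α + LinearMap.id := by
    refine LinearMap.ext fun y => hα ?_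
    have e1 := LinearMap.congr_fun hκ y
    have e2 := LinearMap.congr_fun hκ' (κ y)
    have e3 := LinearMap.congr_fun hη (α y)
    simp only [LinearMap.comp_apply, LinearMap.add_apply, LinearMap.sub_apply,
      LinearMap.id_apply, map_add] at *
    rw [e2, e1, e3, sub_add_cancel]
  apply Subtype.ext
  change tensorMap S M κ' (tensorMap S M κ z.1) = z.1
  rw [tensorMap_comp, h1]
  have h2 : tensorMap S M (η ∘ₗ α + LinearMap.id) z.1 =
      tensorMap S M (η ∘ₗ α) z.1 + tensorMap S M LinearMap.id z.1 :=
    LinearMap.congr_fun (LinearMap.lTensor_add M (η ∘ₗ α) LinearMap.id) z.1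
  rw [h2, ← tensorMap_comp, LinearMap.mem_ker.1 z.2, map_zero, zero_add]
  exact LinearMap.congr_fun (LinearMap.lTensor_id M K) z.1

/-- `Tor_1` does not depend on the presentation. -/
theorem exists_torKer_equiv [Module.Projective R F] [Module.Projective R F']
    {α : K →ₗ[R] F} {β : F →ₗ[R] k} (hα : Function.Injective α) (h : Function.Exact α β)
    (hβ : Function.Surjective β) {α' : K' →ₗ[R] F'} {β' : F' →ₗ[R] k}
    (hα' : Function.Injective α') (h' : Function.Exact α' β') (hβ' : Function.Surjective β') :
    Nonempty (torKer S M α ≃ₗ[S] torKer S M α') := by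
  obtain ⟨φ, hφ⟩ := Module.projective_lifting_property β' β hβ'
  obtain ⟨ψ, hψ⟩ := Module.projective_lifting_property β β' hβ
  obtain ⟨κ, hκ⟩ := exists_lift_of_exact hα' h' (ι := φ ∘ₗ α) (by
    rw [← LinearMap.comp_assoc, hφ]; exact h.linearMap_comp_eq_zero)
  obtain ⟨κ', hκ'⟩ := exists_lift_of_exact hα h (ι := ψ ∘ₗ α') (by
    rw [← LinearMap.comp_assoc, hψ]; exact h'.linearMap_comp_eq_zero)
  exact ⟨LinearEquiv.ofLinearMap (torKerMap hκ) (torKerMap hκ')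
    (LinearMap.ext fun z => torKerMap_torKerMap hα' h' hκ' hκ
      (by rw [← LinearMap.comp_assoc, hφ, hψ]) z)
    (LinearMap.ext fun z => torKerMap_torKerMap hα h hκ hκ'
      (by rw [← LinearMap.comp_assoc, hψ, hφ]) z)⟩

end Schanuel

/-! ### The derived functor `Tor_1` in terms of a presentation -/

section Tor

open CategoryTheory

/-- The homology at `B` of a complex `A → B → C` whose cokernel at `B` is `D`. -/
theorem exists_homology_equiv {S A B C D : Type*} [Ring S] [AddCommGroup A] [Module S A]
    [AddCommGroup B] [Module S B] [AddCommGroup C] [Module S C] [AddCommGroup D] [Module S D]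
    {f : A →ₗ[S] B} {g : B →ₗ[S] C} {e : B →ₗ[S] D} {ι : D →ₗ[S] C}
    (he : Function.Surjective e) (hfe : Function.Exact f e) (hι : ι ∘ₗ e = g)
    (hgf : ∀ a, g (f a) = 0) :
    Nonempty ((LinearMap.ker g ⧸ LinearMap.range (f.codRestrict (LinearMap.ker g) hgf)) ≃ₗ[S]
      LinearMap.ker ι) := by
  let q : LinearMap.ker g →ₗ[S] LinearMap.ker ι := e.restrict fun b hb => by
    rw [LinearMap.mem_ker] at hb ⊢
    rw [← LinearMap.comp_apply, hι, hb]
  have hq : Function.Surjective q := by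
    rintro ⟨y, hy⟩
    obtain ⟨b, rfl⟩ := he y
    refine ⟨⟨b, ?_⟩, rfl⟩
    rw [LinearMap.mem_ker, ← hι]
    exact hy
  refine ⟨(Submodule.quotEquivOfEq _ _ ?_).trans (q.quotKerEquivOfSurjective hq)⟩
  ext ⟨b, hb⟩
  constructor
  · rintro ⟨a, ha⟩
    rw [← ha]
    exact Subtype.ext ((hfe _).2 ⟨a, rfl⟩)
  · intro h
    obtain ⟨a, ha⟩ := (hfe b).1 (congrArg Subtype.val h)
    exact ⟨a, Subtype.ext ha⟩

/-- `Tor_1` as the kernel of `M ⊗ K → M ⊗ F`, for a presentation by a projective module. -/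
theorem exists_tor_equiv (R : Type u) (S : Type u) [CommRing R] [CommRing S] [Algebra R S]
    (M : Type v) [AddCommGroup M] [Module R M] [Module S M] [IsScalarTower R S M]
    (k : Type u) [AddCommGroup k] [Module R k] {K F : Type*} [AddCommGroup K] [Module R K]
    [AddCommGroup F] [Module R F] [Module.Projective R F]
    {α : K →ₗ[R] F} {β : F →ₗ[R] k} (hα : Function.Injective α) (h : Function.Exact α β)
    (hβ : Function.Surjective β) : Nonempty (tor R S M 1 k ≃ₗ[S] torKer S M α) := by
  let P := projectiveResolution (ModuleCat.of R k)
  let C := ((tensorFunctor R S M).mapHomologicalComplex (ComplexShape.down ℕ)).obj P.complex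
  let d₁ : P.complex.X 1 →ₗ[R] P.complex.X 0 := (P.complex.d 1 0).hom
  let d₂ : P.complex.X 2 →ₗ[R] P.complex.X 1 := (P.complex.d 2 1).hom
  let π : P.complex.X 0 →ₗ[R] k := (P.π.f 0).hom
  have hd : Function.Exact d₂ d₁ :=
    (ShortComplex.ShortExact.moduleCat_exact_iff_function_exact _).1 (P.exact_succ 0)
  have hπ : Function.Exact d₁ π :=
    (ShortComplex.ShortExact.moduleCat_exact_iff_function_exact _).1 P.exact₀
  have hπs : Function.Surjective π := (ModuleCat.epi_iff_surjective (P.π.f 0)).1 inferInstance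
  have hproj : Module.Projective R (P.complex.X 0) :=
    (IsProjective.iff_projective _).2 (P.projective 0)
  have e₁ : tor R S M 1 k ≅ C.homology 1 := P.isoLeftDerivedObj (tensorFunctor R S M) 1
  have e₂ : C.homology 1 ≅ (C.sc' 2 1 0).homology :=
    C.homologyIsoSc' 2 1 0 (by simp) (by simp)
  have e₃ := (C.sc' 2 1 0).moduleCatHomologyIso
  -- By right exactness `M ⊗ range d₁` is the cokernel of `M ⊗ d₂`, so the homology at `P_1` is the
  -- kernel of `M ⊗ range d₁ → M ⊗ P_0`.
  obtain ⟨e₄⟩ := exists_homology_equiv (S := S) (f := tensorMap S M d₂) (g := tensorMap S M d₁)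
    (e := tensorMap S M d₁.rangeRestrict) (ι := tensorMap S M (LinearMap.range d₁).subtype)
    (tensorMap_surjective d₁.surjective_rangeRestrict)
    (tensorMap_exact (by
      rw [LinearMap.exact_iff, LinearMap.ker_rangeRestrict]
      exact LinearMap.exact_iff.1 hd) d₁.surjective_rangeRestrict)
    (LinearMap.ext fun z => tensorMap_comp _ _ z)
    (fun z => by
      rw [tensorMap_comp, hd.linearMap_comp_eq_zero]
      exact LinearMap.congr_fun (LinearMap.lTensor_zero M) z)
  obtain ⟨e₅⟩ := exists_torKer_equiv (S := S) (M := M) (LinearMap.range d₁).injective_subtype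
    (by rw [LinearMap.exact_iff, Submodule.range_subtype]; exact LinearMap.exact_iff.1 hπ)
    hπs hα h hβ
  exact ⟨(e₁ ≪≫ e₂ ≪≫ e₃).toLinearEquiv.trans (e₄.trans e₅)⟩

end Tor

/-! ### Homogeneous annihilators and graded Nakayama -/

section HomogeneousAnnihilator

open MvPolynomial IsLocalRing

variable {R : Type*} [CommRing R] {n : ℕ} {w : Fin n → ℤ}
variable {M : Type*} [AddCommGroup M] [Module R M] [Module (MvPolynomial (Fin n) R) M]
  [IsScalarTower R (MvPolynomial (Fin n) R) M]

theorem Grading.proj_monomial_smul (G : Grading R (vars R n) w M) (α : Fin n →₀ ℕ) (r : R)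
    (κ : ℤ) (m : M) : G.proj κ (monomial α r • m) =
      monomial α r • G.proj (κ - Finsupp.weight w α) m := by
  have h : ∀ (κ : ℤ) (m : M), G.proj κ ((monomial α (1 : R)) • m) =
      monomial α (1 : R) • G.proj (κ - Finsupp.weight w α) m := by
    induction α using Finsupp.induction_linear with
    | zero =>
      intro κ m
      rw [show (monomial (0 : Fin n →₀ ℕ) (1 : R)) = 1 from rfl, one_smul, one_smul, map_zero,
        sub_zero]
    | add α β hα hβ =>
      intro κ m
      rw [show (monomial (α + β) (1 : R)) = monomial α 1 * monomial β 1 by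
        rw [monomial_mul, one_mul], mul_smul, hα, hβ, mul_smul, map_add, sub_sub]
    | single j e =>
      intro κ m
      have h1 := G.proj_pow_smul j e (κ - e * w j) m
      rw [sub_add_cancel] at h1
      rw [← X_pow_eq_monomial, h1]
      simp [Finsupp.weight_single]
  have hr : ∀ m : M, monomial α r • m = r • monomial α (1 : R) • m := by
    intro m
    rw [← smul_assoc, smul_monomial, smul_eq_mul, mul_one]
  rw [hr, map_smul, h, ← hr]

theorem Grading.proj_smul_of_mem (G : Grading R (vars R n) w M) {ν : ℤ} {m : M}
    (hm : G.proj ν m = m) (p : MvPolynomial (Fin n) R) (κ : ℤ) :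
    G.proj κ (p • m) = weightedHomogeneousComponent w (κ - ν) p • m := by
  classical
  induction p using MvPolynomial.induction_on' with
  | add p q hp hq => rw [add_smul, map_add, hp, hq, map_add, add_smul]
  | monomial α r =>
    rw [G.proj_monomial_smul, weightedHomogeneousComponent_of_mem
      (isWeightedHomogeneous_monomial w α r rfl)]
    split_ifs with h
    · rw [← h, sub_sub_cancel, hm]
    · rw [← hm, G.proj_of_ne _ _ _ (by omega), smul_zero, zero_smul]

/-- For `m` homogeneous of degree `ν`, the component of `p • m` in degree `μ + ν` is that of `p` in
degree `μ` times `m`. -/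
theorem Grading.isHomog_annihilator (G : Grading R (vars R n) w M) :
    IsHomog w (Module.annihilator (MvPolynomial (Fin n) R) M) := by
  intro p hp μ
  rw [Module.mem_annihilator] at hp ⊢
  intro m
  obtain ⟨s, hs⟩ := G.exists_sum m
  rw [← hs, Finset.smul_sum]
  refine Finset.sum_eq_zero fun ν _ => ?_
  have h := G.proj_smul_of_mem (G.proj_proj ν m) p (μ + ν)
  rw [hp, map_zero, add_sub_cancel_right] at h
  exact h.symm

variable [IsLocalRing R]

/-- A maximal ideal containing the annihilator of `M` and `𝔪` is a point of the support of `M ⊗ k`.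
If the two generated the unit ideal, some annihilator would have a unit as degree `0` component;
this component also annihilates, forcing `M = 0`. -/
theorem nontrivial_tensor_residueField [IsNoetherianRing R] (hw : ∀ j, 0 < w j)
    [Module.Finite (MvPolynomial (Fin n) R) M] [Nontrivial M] (G : Grading R (vars R n) w M) :
    Nontrivial (M ⊗[R] (R ⧸ maximalIdeal R)) := by
  classical
  have hne : Module.annihilator (MvPolynomial (Fin n) R) M ⊔ extMax R n ≠ ⊤ := by
    intro h
    obtain ⟨a, ha, e, he, hae⟩ := Submodule.mem_sup.1 ((Ideal.eq_top_iff_one _).1 h)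
    have h0 : coeff 0 a + coeff 0 e = 1 := by
      rw [← coeff_add, hae]
      exact coeff_zero_one
    have hunit : IsUnit (coeff 0 a) := by
      by_contra hu
      have h1 := Ideal.add_mem _ ((mem_maximalIdeal _).2 hu) (mem_extMax.1 he 0)
      rw [h0] at h1
      exact (maximalIdeal.isMaximal R).ne_top ((Ideal.eq_top_iff_one _).2 h1)
    have h2 := G.isHomog_annihilator a ha 0
    rw [eq_C_of_isWeightedHomogeneous hw (weightedHomogeneousComponent_isWeightedHomogeneous 0 a)
      le_rfl, coeff_weightedHomogeneousComponent, if_pos (map_zero _)] at h2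
    have h3 := Ideal.eq_top_of_isUnit_mem _ h2 (hunit.map C)
    rw [Module.annihilator_eq_top_iff] at h3
    exact not_subsingleton M h3
  obtain ⟨P, hP, hle⟩ := Ideal.exists_le_maximal _ hne
  have : Module.Finite (MvPolynomial (Fin n) R) (M ⊗[R] (R ⧸ maximalIdeal R)) := finite_tensor
  rw [← Module.nonempty_support_iff (R := MvPolynomial (Fin n) R), support_tensor_quotient]
  refine ⟨⟨P, hP.isPrime⟩, ?_, ?_⟩
  · rw [Module.mem_support_iff_of_finite]
    exact le_sup_left.trans hle
  · exact (PrimeSpectrum.mem_zeroLocus _ _).2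
      (SetLike.coe_subset_coe.2 ((le_sup_right : extMax R n ≤ _).trans hle))

theorem extMax_le_annihilator {N : Type*} [AddCommGroup N] [Module R N]
    [Module (MvPolynomial (Fin n) R) N] [IsScalarTower R (MvPolynomial (Fin n) R) N]
    (h : ∀ a ∈ maximalIdeal R, ∀ z : N, a • z = 0) :
    extMax R n ≤ Module.annihilator (MvPolynomial (Fin n) R) N := by
  rw [Ideal.map_le_iff_le_comap]
  intro a ha
  rw [Ideal.mem_comap, Module.mem_annihilator]
  intro z
  rw [← MvPolynomial.algebraMap_eq, algebraMap_smul, h a ha]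

theorem smul_tensor_quotient_eq_zero {R M : Type*} [CommRing R] [AddCommGroup M] [Module R M]
    {I : Ideal R} {a : R} (ha : a ∈ I) (z : M ⊗[R] (R ⧸ I)) : a • z = 0 := by
  induction z with
  | zero => exact smul_zero _
  | add z z' h h' => rw [smul_add, h, h', add_zero]
  | tmul m y =>
    rw [← TensorProduct.tmul_smul, Algebra.smul_def, Ideal.Quotient.algebraMap_eq,
      Ideal.Quotient.eq_zero_iff_mem.2 ha, zero_mul, TensorProduct.tmul_zero]

/-- Multiplication by `a ∈ I` on `I` factors through the inclusion `I → R`, which kills these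
elements after tensoring. -/
theorem smul_torKer_eq_zero {R S M : Type*} [CommRing R] [CommRing S] [Algebra R S]
    [AddCommGroup M] [Module R M] [Module S M] [IsScalarTower R S M] {I : Ideal R} {a : R}
    (ha : a ∈ I) (z : torKer S M I.subtype) : a • z = 0 := by
  let φ : R →ₗ[R] I := LinearMap.toSpanSingleton R I ⟨a, ha⟩
  have h1 : φ ∘ₗ I.subtype = a • LinearMap.id :=
    LinearMap.ext fun b => Subtype.ext (mul_comm b.1 a)
  apply Subtype.ext
  change a • z.1 = 0
  have h2 : tensorMap S M (a • LinearMap.id) z.1 = a • z.1 := by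
    change LinearMap.lTensor M (a • LinearMap.id) z.1 = _
    rw [LinearMap.lTensor_smul, LinearMap.lTensor_id]
    rfl
  rw [← h2, ← h1, ← tensorMap_comp, LinearMap.mem_ker.1 z.2, map_zero]

end HomogeneousAnnihilator

/-! ### Cohomology of all `Tor_1` is controlled by that of `Tor_1(M, k)` -/

section TorVanishing

open IsLocalRing

variable {R : Type u} [CommRing R] [IsLocalRing R] [IsNoetherianRing R] {n : ℕ} {w : Fin n → ℤ}
variable {M : Type v} [AddCommGroup M] [Module R M] [Module (MvPolynomial (Fin n) R) M]
  [IsScalarTower R (MvPolynomial (Fin n) R) M] [Module.Finite (MvPolynomial (Fin n) R) M]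

/-- The grading of `Tor_1`. -/
abbrev Grading.torKer (G : Grading R (vars R n) w M) {K F : Type*} [AddCommGroup K] [Module R K]
    [AddCommGroup F] [Module R F] (α : K →ₗ[R] F) :
    Grading R (vars R n) w (torKer (MvPolynomial (Fin n) R) M α) :=
  Grading.ker (G.compat_lTensor α)

/-- Cohomology of the modules `Tor_1(M, -)` vanishes where that of `Tor_1(M, k)` does. -/
theorem acyclic_torKer (hw : ∀ j, 0 < w j) (G : Grading R (vars R n) w M) {c : ℤ}
    (hc : ∀ i : ℕ, c < i →
      Acyclic (vars R n) (torKer (MvPolynomial (Fin n) R) M (maximalIdeal R).subtype) i)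
    {r : ℕ} (K : Submodule R (Fin r → R)) {i : ℕ} (hi : c < i) :
    Acyclic (vars R n) (torKer (MvPolynomial (Fin n) R) M K.subtype) i := by
  have : Module.Finite (MvPolynomial (Fin n) R) (M ⊗[R] K) := finite_tensor
  have : Module.Finite (MvPolynomial (Fin n) R) (M ⊗[R] maximalIdeal R) := finite_tensor
  have hle := supportDim_tensor_quotient_le
    (M := torKer (MvPolynomial (Fin n) R) M (maximalIdeal R).subtype)
    (N := torKer (MvPolynomial (Fin n) R) M K.subtype) (maximalIdeal R) (support_torKer_subset K)
  have hle' : Module.supportDim (MvPolynomial (Fin n) R)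
      (torKer (MvPolynomial (Fin n) R) M (maximalIdeal R).subtype ⊗[R] (R ⧸ maximalIdeal R)) ≤
      Module.supportDim (MvPolynomial (Fin n) R)
        (torKer (MvPolynomial (Fin n) R) M (maximalIdeal R).subtype) :=
    Module.supportDim_le_of_surjective _ (tmulRight_one_surjective _)
  refine acyclic_of_supportDim_tensor_lt hw (G.torKer K.subtype)
    (lt_of_le_of_lt (hle.trans hle') ?_)
  rcases subsingleton_or_nontrivial
    (torKer (MvPolynomial (Fin n) R) M (maximalIdeal R).subtype) with hs | hs
  · rw [Module.supportDim_eq_bot_of_subsingleton]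
    exact WithBot.bot_lt_coe _
  -- `Tor_1(M, k)` is killed by `𝔪`, so its cohomology is nonzero in the degree of its dimension;
  -- the bound `c` on cohomology thus bounds the dimension.
  · obtain ⟨t, ht, hta⟩ := exists_supportDim_eq_not_acyclic hw
      (N := torKer (MvPolynomial (Fin n) R) M (maximalIdeal R).subtype)
      (extMax_le_annihilator fun a ha z => smul_torKer_eq_zero ha z)
      (G.torKer (maximalIdeal R).subtype).isHomog_annihilator
    rw [ht]
    have h1 : (t : ℤ) ≤ c := by
      by_contra! h
      exact hta (hc t h)
    have h2 : t < i := by omega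
    exact_mod_cast h2

end TorVanishing

/-! ### Passing vanishing between `M` and `M ⊗ X` in one degree -/

section BaseChange

open IsLocalRing

variable {R : Type u} [CommRing R] {n : ℕ} {w : Fin n → ℤ}
variable {M : Type v} [AddCommGroup M] [Module R M] [Module (MvPolynomial (Fin n) R) M]
  [IsScalarTower R (MvPolynomial (Fin n) R) M]

local notation "𝒮" => MvPolynomial (Fin n) R

theorem Grading.van_range_tensorMap (G : Grading R (vars R n) w M) {K F : Type*} [AddCommGroup K]
    [Module R K] [AddCommGroup F] [Module R F] (α : K →ₗ[R] F) {i : ℕ} {μ : ℤ}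
    (hT : ((G.torKer α).op μ).Van (i + 1)) (hK : ((G.tensor K).op μ).Van i) :
    ((Grading.range (G.compat_lTensor α)).op μ).Van i :=
  CochainOp.van_of_surjective ((Grading.compat_ker (G.compat_lTensor α)).op μ)
    ((Grading.compat_rangeRestrict (G.compat_lTensor α)).op μ) (Submodule.injective_subtype _)
    (by rw [LinearMap.exact_iff, LinearMap.ker_rangeRestrict, Submodule.range_subtype])
    (LinearMap.surjective_rangeRestrict _) hT hK

variable [IsNoetherianRing R]

/-- Descending induction on `i`, for all finite `X` at once. For `X = R ^ r / K`, let `Z` be the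
image of `M ⊗ K` in `M ⊗ R ^ r`. Vanishing of `H^{i+2}(Tor_1)` and of `H^{i+1}(M ⊗ K)_μ` gives
`H^{i+1}(Z)_μ = 0`, so `H^i(M ⊗ R ^ r)_μ` surjects onto `H^i(M ⊗ X)_μ`. -/
theorem Grading.van_tensor (G : Grading R (vars R n) w M) {μ ℓ : ℤ}
    (hT : ∀ (r : ℕ) (K : Submodule R (Fin r → R)) (i : ℕ), ℓ + 1 < i →
      Acyclic (vars R n) (LocalCoh.torKer 𝒮 M K.subtype) i)
    (hM : ∀ i : ℕ, ℓ ≤ i → (G.op μ).Van i) {X : Type u} [AddCommGroup X] [Module R X]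
    [Module.Finite R X] {i : ℕ} (hi : ℓ ≤ i) : ((G.tensor X).op μ).Van i := by
  have key : ∀ (k i : ℕ), n < i + k → ℓ ≤ i → ∀ (X : Type u) [AddCommGroup X] [Module R X]
      [Module.Finite R X], ((G.tensor X).op μ).Van i := by
    intro k
    induction k with
    | zero => intro i hi _ X _ _ _; exact CochainOp.van_of_acyclic _ (acyclic_of_lt _ (by omega))
    | succ k ih =>
      intro i hi hℓ X _ _ _
      obtain ⟨r, φ, hφ⟩ := Module.Finite.exists_fin' R X
      have hZ := G.van_range_tensorMap (LinearMap.ker φ).subtype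
        (CochainOp.van_of_acyclic ((G.torKer (LinearMap.ker φ).subtype).op μ)
          (hT r (LinearMap.ker φ) (i + 2) (by push_cast; omega)))
        (ih (i + 1) (by omega) (by push_cast; omega) (LinearMap.ker φ))
      have hex := tensorMap_exact (S := 𝒮) (M := M)
        (by rw [LinearMap.exact_iff, Submodule.range_subtype] :
          Function.Exact (LinearMap.ker φ).subtype φ) hφ
      exact CochainOp.van_of_surjective
        ((Grading.compat_range (G.compat_lTensor (LinearMap.ker φ).subtype)).op μ)
        ((G.compat_lTensor φ).op μ) (Submodule.injective_subtype _)
        (by rw [LinearMap.exact_iff, Submodule.range_subtype]; exact LinearMap.exact_iff.1 hex)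
        (tensorMap_surjective hφ) hZ (G.van_tensor_pi (hM i hℓ) r)
  exact key (n + 1) i (by omega) hi X

variable [IsLocalRing R]

/-- The kernel of `M ⊗ R ^ r → M` is an extension of `Tor_1(M, k)` by the image of `M ⊗ K`. -/
theorem Grading.van_ker_tensorEval (G : Grading R (vars R n) w M) {r : ℕ} {a : Fin r → R}
    (ha : Ideal.span (Set.range a) = maximalIdeal R) {i : ℕ} {μ : ℤ}
    (hZ : ((Grading.range (G.compat_lTensor
      (LinearMap.ker (Fintype.linearCombination R a)).subtype)).op μ).Van i)
    (hT : Acyclic (vars R n) (LocalCoh.torKer 𝒮 M (maximalIdeal R).subtype) i) :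
    ((Grading.ker (G.compat_tensorEval (Fintype.linearCombination R a))).op μ).Van i := by
  set α := Fintype.linearCombination R a with hα
  have hrange : LinearMap.range α = maximalIdeal R := range_fintypeLinearCombination ha
  let α' : (Fin r → R) →ₗ[R] maximalIdeal R := α.codRestrict _ fun y => hrange ▸ ⟨y, rfl⟩
  have hα' : Function.Surjective α' := by
    rintro ⟨y, hy⟩
    rw [← hrange] at hy
    obtain ⟨z, rfl⟩ := hy
    exact ⟨z, rfl⟩
  have hker : Function.Exact (LinearMap.ker α).subtype α' := by
    rw [LinearMap.exact_iff, LinearMap.ker_codRestrict, Submodule.range_subtype]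
  have hex := tensorMap_exact (S := 𝒮) (M := M) hker hα'
  have hcomp : ∀ z, tensorEval 𝒮 M (maximalIdeal R).subtype (tensorMap 𝒮 M α' z) =
      tensorEval 𝒮 M α z := fun z => congrArg (TensorProduct.AlgebraTensorModule.rid R 𝒮 M)
    (tensorMap_comp (S := 𝒮) (M := M) α' (maximalIdeal R).subtype z)
  have hrid : ∀ z, tensorMap 𝒮 M (maximalIdeal R).subtype z = 0 ↔
      tensorEval 𝒮 M (maximalIdeal R).subtype z = 0 := fun z =>
    (TensorProduct.AlgebraTensorModule.rid R 𝒮 M).map_eq_zero_iff.symm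
  let Z := LinearMap.range (tensorMap 𝒮 M (LinearMap.ker α).subtype)
  have hZW : Z ≤ LinearMap.ker (tensorEval 𝒮 M α) := fun z hz => by
    rw [LinearMap.mem_ker, ← hcomp, (hex z).2 hz, map_zero]
  let q : LinearMap.ker (tensorEval 𝒮 M α) →ₗ[𝒮] LocalCoh.torKer 𝒮 M (maximalIdeal R).subtype :=
    (tensorMap 𝒮 M α').restrict fun z hz => by
      rw [LinearMap.mem_ker, hrid, hcomp]
      exact hz
  refine CochainOp.van_of_exact (f := Submodule.inclusion hZW) (g := q)
    (PL := (G.torKer (maximalIdeal R).subtype).op μ) ?_ ?_ (Submodule.inclusion_injective hZW) ?_ ?_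
    hZ (CochainOp.van_of_acyclic _ hT)
  · refine Compat.op (fun κ z => Subtype.ext ?_) μ
    exact ((Grading.compat_range (G.compat_lTensor _)) κ z).trans
      (Grading.compat_ker (G.compat_tensorEval α) κ (Submodule.inclusion hZW z)).symm
  · refine Compat.op (fun κ z => Subtype.ext ?_) μ
    refine Eq.trans ?_ (Grading.compat_ker (G.compat_lTensor (maximalIdeal R).subtype) κ (q z)).symm
    change tensorMap 𝒮 M α' (Submodule.subtype _ _) = _
    rw [Grading.compat_ker (G.compat_tensorEval α) κ z]
    exact G.compat_lTensor α' κ z.1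
  · rintro ⟨z, hz⟩
    constructor
    · intro h
      exact ⟨⟨z, (hex z).1 (congrArg Subtype.val h)⟩, rfl⟩
    · rintro ⟨y, hy⟩
      rw [← hy]
      exact Subtype.ext ((hex y.1).2 y.2)
  · rintro ⟨y, hy⟩
    obtain ⟨z, rfl⟩ := tensorMap_surjective (S := 𝒮) (M := M) hα' y
    exact ⟨⟨z, by rw [LinearMap.mem_ker, ← hcomp]; exact (hrid _).1 hy⟩, rfl⟩

/-- Nakayama with descending induction on `i`: the kernel of `M ⊗ R ^ r → M` needs vanishing in
degree `i + 1`, which holds for both parts of the extension of `Grading.van_ker_tensorEval`. -/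
theorem Grading.van_of_forall_van_tensor (hw : ∀ j, 0 < w j) [Module.Finite 𝒮 M]
    (G : Grading R (vars R n) w M) {μ ℓ : ℤ}
    (hT : ∀ (r : ℕ) (K : Submodule R (Fin r → R)) (i : ℕ), ℓ < i →
      Acyclic (vars R n) (LocalCoh.torKer 𝒮 M K.subtype) i)
    (hm : ∀ i : ℕ, ℓ < i → Acyclic (vars R n) (LocalCoh.torKer 𝒮 M (maximalIdeal R).subtype) i)
    (hk : ∀ i : ℕ, ℓ ≤ i → ((G.tensor (R ⧸ maximalIdeal R)).op μ).Van i)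
    {i : ℕ} (hi : ℓ ≤ i) : (G.op μ).Van i := by
  obtain ⟨r, a, ha⟩ := exists_fin_generators (maximalIdeal R)
  have key : ∀ (k i : ℕ), n < i + k → ℓ ≤ i → (G.op μ).Van i := by
    intro k
    induction k with
    | zero => intro i hi _; exact CochainOp.van_of_acyclic _ (acyclic_of_lt _ (by omega))
    | succ k ih =>
      intro i hi hℓ
      refine G.van_of_van_tensor ha ((G.finBdd hw).1 i μ) ?_ (hk i hℓ)
      refine G.van_ker_tensorEval ha (G.van_range_tensorMap _
        (CochainOp.van_of_acyclic _ (hT r _ (i + 2) (by push_cast; omega))) ?_)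
        (hm (i + 1) (by push_cast; omega))
      -- The induction hypothesis covers all degrees above `i`, so `Grading.van_tensor` with bound
      -- `i + 1` handles `M ⊗ K`.
      have h1 : ∀ j : ℕ, ((i + 1 : ℕ) : ℤ) ≤ j → (G.op μ).Van j := fun j hj =>
        ih j (by omega) (by omega)
      exact G.van_tensor (fun r K j hj => hT r K j (by push_cast at hj; omega)) h1 le_rfl
  exact key (n + 1) i (by omega) hi

end BaseChange

/-! ### The top degree: comparison with the closed fibre -/

section ClosedFibre

open IsLocalRing

variable {R : Type u} [CommRing R] [IsLocalRing R] [IsNoetherianRing R] {n : ℕ} {w : Fin n → ℤ}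
variable {M : Type v} [AddCommGroup M] [Module R M] [Module (MvPolynomial (Fin n) R) M]
  [IsScalarTower R (MvPolynomial (Fin n) R) M] [Module.Finite (MvPolynomial (Fin n) R) M]

theorem acyclic_of_annihilator_le (hw : ∀ j, 0 < w j) {N : Type*} [AddCommGroup N] [Module R N]
    [Module (MvPolynomial (Fin n) R) N] [IsScalarTower R (MvPolynomial (Fin n) R) N]
    [Module.Finite (MvPolynomial (Fin n) R) N] (G : Grading R (vars R n) w N)
    (h : Module.annihilator (MvPolynomial (Fin n) R) M ≤
      Module.annihilator (MvPolynomial (Fin n) R) N) {t i : ℕ}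
    (ht : Module.supportDim (MvPolynomial (Fin n) R) (M ⊗[R] (R ⧸ maximalIdeal R)) = t)
    (hi : t < i) : Acyclic (vars R n) N i := by
  refine acyclic_of_supportDim_tensor_lt hw G (lt_of_le_of_lt (supportDim_tensor_quotient_le
    (M := M) (maximalIdeal R) fun P hP => support_subset_of_annihilator_le h hP.1) ?_)
  rw [ht]
  exact_mod_cast hi

/-- Classes in `H^t(M ⊗ k)` lift to `M`, for the dimension `t` of `M ⊗ k`. -/
theorem exists_lift_residue (hw : ∀ j, 0 < w j) (G : Grading R (vars R n) w M) {t : ℕ}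
    (ht : Module.supportDim (MvPolynomial (Fin n) R) (M ⊗[R] (R ⧸ maximalIdeal R)) = t)
    {c : Cochain (vars R n) (M ⊗[R] (R ⧸ maximalIdeal R)) t} (hc : d _ _ t c = 0) :
    ∃ a : Cochain (vars R n) M t, d _ _ t a = 0 ∧
      c - cochainMap (vars R n) (tmulRight M (1 : R ⧸ maximalIdeal R)) t a ∈
        boundaries (vars R n) (M ⊗[R] (R ⧸ maximalIdeal R)) t := by
  have hcompat := G.compat_tmulRight (1 : R ⧸ maximalIdeal R)
  exact CochainOp.exists_lift_of_surjective
    (CochainOp.compat_one (LinearMap.ker (tmulRight M (1 : R ⧸ maximalIdeal R))).subtype)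
    (CochainOp.compat_one _) (Submodule.injective_subtype _)
    (by rw [LinearMap.exact_iff, Submodule.range_subtype]) (tmulRight_one_surjective _)
    (CochainOp.van_one.2 (acyclic_of_annihilator_le hw (Grading.ker hcompat)
      (annihilator_le_of_injective (Submodule.injective_subtype _)) ht (Nat.lt_succ_self t))) hc

/-- In degree `t` the kernels of `M → M ⊗ k` and of `M ⊗ R ^ r → M` have no cohomology one degree
higher. The first fact makes `H^t(M) → H^t(M ⊗ k)` surjective, the second allows Nakayama's lemma.
-/
theorem van_iff_van_residue (hw : ∀ j, 0 < w j) (G : Grading R (vars R n) w M) {t : ℕ}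
    (ht : Module.supportDim (MvPolynomial (Fin n) R) (M ⊗[R] (R ⧸ maximalIdeal R)) = t) (μ : ℤ) :
    (G.op μ).Van t ↔ ((G.tensor (R ⧸ maximalIdeal R)).op μ).Van t := by
  have hcompat := G.compat_tmulRight (1 : R ⧸ maximalIdeal R)
  constructor
  · refine CochainOp.van_of_surjective ((Grading.compat_ker hcompat).op μ) (hcompat.op μ)
      (Submodule.injective_subtype _) (by rw [LinearMap.exact_iff, Submodule.range_subtype])
      (tmulRight_one_surjective _) (CochainOp.van_of_acyclic _ ?_)
    exact acyclic_of_annihilator_le hw (Grading.ker hcompat)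
      (annihilator_le_of_injective (Submodule.injective_subtype _)) ht (Nat.lt_succ_self t)
  · obtain ⟨r, a, ha⟩ := exists_fin_generators (maximalIdeal R)
    have : Module.Finite (MvPolynomial (Fin n) R) (M ⊗[R] (Fin r → R)) := finite_tensor
    refine G.van_of_van_tensor ha ((G.finBdd hw).1 t μ) (CochainOp.van_of_acyclic _ ?_)
    exact acyclic_of_annihilator_le hw
      (Grading.ker (G.compat_tensorEval (Fintype.linearCombination R a)))
      (annihilator_le_tensor.trans (annihilator_le_of_injective (Submodule.injective_subtype _)))
      ht (Nat.lt_succ_self t)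

/-- Surjectivity is lifting of classes. For injectivity, every element of `H^t(M) ⊗ k` is `c ⊗ 1`;
if `c` dies in `H^t(M ⊗ k)`, it lies in `𝔪 H^t(M)` and `c ⊗ 1 = 0`. -/
theorem comparison_bijective (hw : ∀ j, 0 < w j) (G : Grading R (vars R n) w M) {t : ℕ}
    (ht : Module.supportDim (MvPolynomial (Fin n) R) (M ⊗[R] (R ⧸ maximalIdeal R)) = t) :
    Function.Bijective (comparison (R := R) (vars R n) M (R ⧸ maximalIdeal R) t) := by
  constructor
  · rw [injective_iff_map_eq_zero]
    intro z hz
    obtain ⟨y, rfl⟩ := tmulRight_one_surjective (S := MvPolynomial (Fin n) R) (maximalIdeal R) z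
    obtain ⟨c, hc, rfl⟩ := exists_cls (vars R n) y
    obtain ⟨r, a, ha⟩ := exists_fin_generators (maximalIdeal R)
    have : Module.Finite (MvPolynomial (Fin n) R) (M ⊗[R] (Fin r → R)) := finite_tensor
    obtain ⟨b, hb, hcb⟩ := exists_sum_smul_of_van (vars R n) ha
      (CochainOp.compat_one _) (CochainOp.compat_one _)
      (CochainOp.van_one.2 (acyclic_of_annihilator_le hw
        (Grading.ker (G.compat_tensorEval (Fintype.linearCombination R a)))
        (annihilator_le_tensor.trans (annihilator_le_of_injective (Submodule.injective_subtype _)))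
        ht (Nat.lt_succ_self t))) hc ((cls_eq_zero _).1 hz)
    have h1 : cls (vars R n) c hc =
        ∑ j, algebraMap R (MvPolynomial (Fin n) R) (a j) • cls (vars R n) (b j) (hb j) := by
      let q := ((boundaries (vars R n) M t).submoduleOf (LinearMap.ker (d (vars R n) M t))).mkQ
      change q _ = ∑ j, algebraMap R (MvPolynomial (Fin n) R) (a j) • q ⟨b j, hb j⟩
      simp only [← map_smul]
      rw [← map_sum, ← sub_eq_zero, ← map_sub, Submodule.mkQ_apply,
        Submodule.Quotient.mk_eq_zero]
      change (_ - _ : LinearMap.ker (d (vars R n) M t)).1 ∈ boundaries (vars R n) M t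
      convert hcb using 1
      simp [CochainOp.one]
    rw [h1, map_sum]
    refine Finset.sum_eq_zero fun j _ => ?_
    rw [map_smul, algebraMap_smul]
    exact smul_tensor_quotient_eq_zero (ha ▸ Ideal.subset_span ⟨j, rfl⟩) _
  · intro y
    obtain ⟨c, hc, rfl⟩ := exists_cls (vars R n) y
    obtain ⟨a, ha, hca⟩ := exists_lift_residue hw G ht hc
    exact ⟨cls (vars R n) a ha ⊗ₜ 1, ((cls_eq _).2 hca).symm⟩

theorem exists_mem_cohDeg_comparison_eq (hw : ∀ j, 0 < w j) (G : Grading R (vars R n) w M)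
    {t : ℕ}
    (ht : Module.supportDim (MvPolynomial (Fin n) R) (M ⊗[R] (R ⧸ maximalIdeal R)) = t) {μ : ℤ}
    {y : Coh (vars R n) (M ⊗[R] (R ⧸ maximalIdeal R)) t}
    (hy : y ∈ cohDeg (vars R n) w (G.tensor (R ⧸ maximalIdeal R)).deg t μ) :
    ∃ z ∈ cohDeg (vars R n) w G.deg t μ,
      comparison (R := R) (vars R n) M (R ⧸ maximalIdeal R) t (z ⊗ₜ 1) = y := by
  obtain ⟨c, hc, hμ, rfl⟩ := (G.tensor (R ⧸ maximalIdeal R)).mem_cohDeg.1 hy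
  have ⟨a, ha, hca⟩ := exists_lift_residue hw G ht hc
  refine ⟨_, G.cls_cochainProj_mem ha μ, ((cls_eq _).2 ?_).symm⟩
  have h1 := ((G.tensor (R ⧸ maximalIdeal R)).op μ).op_boundary hca
  have h2 := (G.compat_tmulRight (1 : R ⧸ maximalIdeal R)).op μ t a
  rw [map_sub, Grading.op_apply, hμ, ← h2] at h1
  exact h1

theorem map_comparison (hw : ∀ j, 0 < w j) (G : Grading R (vars R n) w M) {t : ℕ}
    (ht : Module.supportDim (MvPolynomial (Fin n) R) (M ⊗[R] (R ⧸ maximalIdeal R)) = t) (μ : ℤ) :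
    (tensorDeg (R ⧸ maximalIdeal R) (cohDeg (vars R n) w G.deg t) μ).map
      ((comparison (R := R) (vars R n) M (R ⧸ maximalIdeal R) t).restrictScalars R) =
    cohDeg (vars R n) w (tensorDeg (R ⧸ maximalIdeal R) G.deg) t μ := by
  rw [← G.deg_tensor]
  apply le_antisymm
  · rw [Submodule.map_le_iff_le_comap]
    rintro _ ⟨z, rfl⟩
    induction z with
    | zero => rw [map_zero]; exact Submodule.zero_mem _
    | add z z' h h' => rw [map_add]; exact add_mem h h'
    | tmul y s => exact Grading.cohMap_mem_cohDeg (G.compat_tmulRight s) y.2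
  · exact fun y hy => (exists_mem_cohDeg_comparison_eq hw G ht hy).elim fun z hz =>
      ⟨z ⊗ₜ 1, ⟨(⟨z, hz.1⟩ : cohDeg (vars R n) w G.deg t μ) ⊗ₜ 1, rfl⟩, hz.2⟩

theorem exists_supportDim_residue (hw : ∀ j, 0 < w j) (G : Grading R (vars R n) w M)
    [Nontrivial M] : ∃ t : ℕ,
      Module.supportDim (MvPolynomial (Fin n) R) (M ⊗[R] (R ⧸ maximalIdeal R)) = t ∧
      ¬ Acyclic (vars R n) M t := by
  have := nontrivial_tensor_residueField hw G
  have : Module.Finite (MvPolynomial (Fin n) R) (M ⊗[R] (R ⧸ maximalIdeal R)) := finite_tensor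
  obtain ⟨t, ht, hta⟩ := exists_supportDim_eq_not_acyclic hw
    (N := M ⊗[R] (R ⧸ maximalIdeal R))
    (extMax_le_annihilator fun a ha z => smul_tensor_quotient_eq_zero ha z)
    (G.tensor (R ⧸ maximalIdeal R)).isHomog_annihilator
  exact ⟨t, ht, fun h => hta ((G.tensor _).acyclic_of_forall_van fun μ =>
    (van_iff_van_residue hw G ht μ).1 (CochainOp.van_of_acyclic _ h))⟩

end ClosedFibre

/-! ### The invariants `cd`, `a^i`, `reg` and depth -/

section Invariants

variable {R : Type u} [CommRing R] [IsNoetherianRing R] {n : ℕ} {w : Fin n → ℤ}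
variable {M : Type v} [AddCommGroup M] [Module R M] [Module (MvPolynomial (Fin n) R) M]
  [IsScalarTower R (MvPolynomial (Fin n) R) M] [Module.Finite (MvPolynomial (Fin n) R) M]

theorem coe_intCast_le {a b : ℤ} : ((a : ℝ) : EReal) ≤ ((b : ℝ) : EReal) ↔ a ≤ b := by
  rw [EReal.coe_le_coe_iff, Int.cast_le]

theorem acyclic_of_cd_le {S : Type*} [CommRing S] {x : Fin n → S} {N : Type*} [AddCommGroup N]
    [Module S N] {c : ℤ} (h : cd x N ≤ ((c : ℝ) : EReal)) {i : ℕ} (hi : c < i) :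
    Acyclic x N i := by
  by_contra hN
  rw [acyclic_iff, not_not] at hN
  have h1 : ((i : ℕ) : EReal) ≤ ((c : ℝ) : EReal) :=
    (le_iSup₂ (f := fun (i : ℕ) (_ : Nontrivial (Coh x N i)) => (i : EReal)) i hN).trans h
  have h2 : (((i : ℤ) : ℝ) : EReal) ≤ ((c : ℝ) : EReal) := by simpa using h1
  exact absurd (coe_intCast_le.1 h2) (not_le.2 hi)

/-- The degrees with nonzero cohomology form a nonempty set of integers, bounded above by
`Grading.finBdd`, so the supremum is attained. -/
theorem Grading.aInv_eq_intCast (hw : ∀ j, 0 < w j) (G : Grading R (vars R n) w M) {i : ℕ}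
    (h : ¬ Acyclic (vars R n) M i) :
    ∃ a : ℤ, aInv (vars R n) w G.deg i = ((a : ℝ) : EReal) := by
  obtain ⟨μ₀, hμ₀⟩ := (G.finBdd hw).2
  obtain ⟨μ₁, hμ₁⟩ : ∃ μ, ¬ (G.op μ).Van i := by
    by_contra! h'
    exact h (G.acyclic_of_forall_van h')
  obtain ⟨a, ha, hmax⟩ := Int.exists_greatest_of_bdd (P := fun μ => ¬ (G.op μ).Van i)
    ⟨μ₀, fun μ hμ => by
      by_contra! hlt
      exact hμ (hμ₀ μ hlt i)⟩ ⟨μ₁, hμ₁⟩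
  refine ⟨a, le_antisymm (iSup₂_le fun μ hμ => ?_) ?_⟩
  · rw [Ne, G.cohDeg_eq_bot_iff] at hμ
    exact coe_intCast_le.2 (hmax μ hμ)
  · exact le_iSup₂ (f := fun (μ : ℤ) (_ : cohDeg (vars R n) w G.deg i μ ≠ ⊥) => ((μ : ℝ) : EReal))
      a (by rwa [Ne, G.cohDeg_eq_bot_iff])

/-- Comparison of regularities through the nonvanishing of graded pieces. -/
theorem reg_le_reg {R S : Type*} [CommRing R] [CommRing S] [Algebra R S] {x : Fin n → S}
    {M N : Type*} [AddCommGroup M] [Module R M] [Module S M] [IsScalarTower R S M]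
    [AddCommGroup N] [Module R N] [Module S N] [IsScalarTower R S N]
    {𝓜 : ℤ → Submodule R M} {𝓝 : ℤ → Submodule R N}
    (h : ∀ (i : ℕ) (μ : ℤ), cohDeg x w 𝓝 i μ ≠ ⊥ → ∃ k ≥ i, cohDeg x w 𝓜 k μ ≠ ⊥) :
    reg x w 𝓝 ≤ reg x w 𝓜 := by
  refine iSup_le fun i => ?_
  -- The summand `i` is moved across so that the supremum over `μ` can be opened, and then moved
  -- back.
  rw [← EReal.le_sub_iff_add_le (Or.inl (EReal.natCast_ne_bot i)) (Or.inl (EReal.natCast_ne_top i))]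
  refine iSup₂_le fun μ hμ => ?_
  rw [EReal.le_sub_iff_add_le (Or.inl (EReal.natCast_ne_bot i)) (Or.inl (EReal.natCast_ne_top i))]
  obtain ⟨k, hik, hk⟩ := h i μ hμ
  refine le_trans (add_le_add ?_ (Nat.cast_le.2 hik))
    (le_iSup (fun i => aInv x w 𝓜 i + (i : EReal)) k)
  exact le_iSup₂ (f := fun (μ : ℤ) (_ : cohDeg x w 𝓜 k μ ≠ ⊥) => ((μ : ℝ) : EReal)) μ hk

theorem acyclic_zero_of_depth_pos {S : Type*} [CommRing S] {x : Fin n → S} {N : Type*}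
    [AddCommGroup N] [Module S N] (h : 0 < depth N (Ideal.span (Set.range x))) :
    Acyclic x N 0 := by
  rw [depth, lt_iSup_iff] at h
  obtain ⟨rs, h⟩ := h
  rw [lt_iSup_iff] at h
  obtain ⟨⟨hmem, hreg⟩, hlen⟩ := h
  cases rs with
  | nil => simp at hlen
  | cons r rs =>
    rw [RingTheory.Sequence.isWeaklyRegular_cons_iff] at hreg
    exact acyclic_zero_of_isSMulRegular x (hmem r List.mem_cons_self) hreg.1

end Invariants

/-! ### Vanishing statements in terms of `cd` of `Tor_1(M, k)` -/

section Main

open IsLocalRing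

variable {R : Type u} [CommRing R] [IsLocalRing R] [IsNoetherianRing R] {n : ℕ} {w : Fin n → ℤ}
variable {M : Type v} [AddCommGroup M] [Module R M] [Module (MvPolynomial (Fin n) R) M]
  [IsScalarTower R (MvPolynomial (Fin n) R) M] [Module.Finite (MvPolynomial (Fin n) R) M]

theorem acyclic_torKer_of_cd_le {c : ℤ}
    (h : cd (vars R n) (tor R (MvPolynomial (Fin n) R) M 1 (R ⧸ maximalIdeal R)) ≤
      ((c : ℝ) : EReal)) {i : ℕ} (hi : c < i) :
    Acyclic (vars R n) (torKer (MvPolynomial (Fin n) R) M (maximalIdeal R).subtype) i := by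
  obtain ⟨e⟩ := exists_tor_equiv R (MvPolynomial (Fin n) R) M (R ⧸ maximalIdeal R)
    (maximalIdeal R).injective_subtype
    (by rw [LinearMap.exact_iff, Submodule.range_subtype, Submodule.ker_mkQ] :
      Function.Exact (maximalIdeal R).subtype (Submodule.mkQ (maximalIdeal R)))
    (Submodule.mkQ_surjective _)
  exact acyclic_of_equiv _ e (acyclic_of_cd_le h hi)

theorem Grading.van_residue_of_van (hw : ∀ j, 0 < w j) (G : Grading R (vars R n) w M) {μ ℓ : ℤ}
    (h : cd (vars R n) (tor R (MvPolynomial (Fin n) R) M 1 (R ⧸ maximalIdeal R)) ≤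
      (((ℓ + 1 : ℤ) : ℝ) : EReal))
    (hM : ∀ i : ℕ, ℓ ≤ i → (G.op μ).Van i) {i : ℕ} (hi : ℓ ≤ i) :
    ((G.tensor (R ⧸ maximalIdeal R)).op μ).Van i :=
  G.van_tensor (fun _ K _ hi => acyclic_torKer hw G
    (fun _ hi => acyclic_torKer_of_cd_le h hi) K hi) hM hi

theorem Grading.van_of_van_residue (hw : ∀ j, 0 < w j) (G : Grading R (vars R n) w M) {μ ℓ : ℤ}
    (h : cd (vars R n) (tor R (MvPolynomial (Fin n) R) M 1 (R ⧸ maximalIdeal R)) ≤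
      ((ℓ : ℝ) : EReal))
    (hk : ∀ i : ℕ, ℓ ≤ i → ((G.tensor (R ⧸ maximalIdeal R)).op μ).Van i) {i : ℕ} (hi : ℓ ≤ i) :
    (G.op μ).Van i :=
  G.van_of_forall_van_tensor hw (fun _ K _ hi => acyclic_torKer hw G
    (fun _ hi => acyclic_torKer_of_cd_le h hi) K hi) (fun _ hi => acyclic_torKer_of_cd_le h hi)
    hk hi

end Main
end LocalCoh

/-! ### The theorem -/

open LocalCoh MvPolynomial IsLocalRing in
theorem proposition6p3
    {R : Type u} [CommRing R] [IsNoetherianRing R] [IsLocalRing R]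
    {n : ℕ} (w : Fin n → ℤ) (hw : ∀ j, 0 < w j)
    {𝕄 : Type v} [AddCommGroup 𝕄] [Module R 𝕄] [Module (MvPolynomial (Fin n) R) 𝕄]
    [IsScalarTower R (MvPolynomial (Fin n) R) 𝕄] [Module.Finite (MvPolynomial (Fin n) R) 𝕄]
    (𝓜 : ℤ → Submodule R 𝕄) [DirectSum.Decomposition 𝓜]
    [SetLike.GradedSMul (weightedHomogeneousSubmodule R w) 𝓜] :
    -- (i)
    (Nontrivial 𝕄 → ∃ d : ℕ,
      Module.supportDim (MvPolynomial (Fin n) R) (𝕄 ⊗[R] ResidueField R) = d ∧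
      (Function.Bijective (comparison (R := R) (vars R n) 𝕄
          (ResidueField R) d) ∧
        ∀ μ : ℤ,
          (tensorDeg (ResidueField R) (cohDeg (vars R n) w 𝓜 d) μ).map
            ((comparison (R := R) (vars R n) 𝕄
              (ResidueField R) d).restrictScalars R) =
          cohDeg (vars R n) w (tensorDeg (ResidueField R) 𝓜) d μ) ∧
      IsGreatest {i : ℕ | Nontrivial (Coh (vars R n) 𝕄 i)} d ∧
      aInv (vars R n) w 𝓜 d =
        aInv (vars R n) w (tensorDeg (ResidueField R) 𝓜) d ∧
      ∃ a : ℤ, aInv (vars R n) w 𝓜 d = ((a : ℝ) : EReal)) ∧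
    -- (ii)
    (∀ μ ℓ : ℤ,
      cd (vars R n)
          (tor R (MvPolynomial (Fin n) R) 𝕄 1 (ResidueField R)) ≤ (((ℓ + 1 : ℤ) : ℝ) : EReal) →
      (∀ i : ℕ, ℓ ≤ i → cohDeg (vars R n) w 𝓜 i μ = ⊥) →
      ∀ i : ℕ, ℓ ≤ i →
        cohDeg (vars R n) w (tensorDeg (ResidueField R) 𝓜) i μ = ⊥) ∧
    (∀ μ ℓ : ℤ,
      cd (vars R n)
          (tor R (MvPolynomial (Fin n) R) 𝕄 1 (ResidueField R)) ≤ ((ℓ : ℝ) : EReal) →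
      ((∀ i : ℕ, ℓ ≤ i → cohDeg (vars R n) w 𝓜 i μ = ⊥) ↔
        ∀ i : ℕ, ℓ ≤ i →
          cohDeg (vars R n) w (tensorDeg (ResidueField R) 𝓜) i μ
            = ⊥)) ∧
    -- regularity
    (cd (vars R n)
        (tor R (MvPolynomial (Fin n) R) 𝕄 1 (ResidueField R)) ≤ 1 →
      reg (vars R n) w (tensorDeg (ResidueField R) 𝓜) ≤
          reg (vars R n) w 𝓜 ∧
      (0 < depth 𝕄 (Ideal.span (Set.range (vars R n))) →
        reg (vars R n) w (tensorDeg (ResidueField R) 𝓜) =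
          reg (vars R n) w 𝓜)) := by
  let G : Grading R (vars R n) w 𝕄 := .ofDecomposition 𝓜 fun j μ m hm => by
    have h := SetLike.GradedSMul.smul_mem (A := weightedHomogeneousSubmodule R w)
      (isWeightedHomogeneous_X R w j) hm
    rwa [vadd_eq_add, add_comm] at h
  have hG : G.deg = 𝓜 := Grading.deg_ofDecomposition 𝓜 _
  have hGk : (G.tensor (ResidueField R)).deg = tensorDeg (ResidueField R) 𝓜 := by
    rw [G.deg_tensor, hG]
  have hvan : ∀ (i : ℕ) (μ : ℤ), cohDeg (vars R n) w 𝓜 i μ = ⊥ ↔ (G.op μ).Van i :=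
    fun i μ => by rw [← hG, G.cohDeg_eq_bot_iff]
  have hvank : ∀ (i : ℕ) (μ : ℤ), cohDeg (vars R n) w (tensorDeg (ResidueField R) 𝓜) i μ = ⊥ ↔
      ((G.tensor (ResidueField R)).op μ).Van i :=
    fun i μ => by rw [← hGk, (G.tensor (ResidueField R)).cohDeg_eq_bot_iff]
  have hforward : ∀ μ ℓ : ℤ, cd (vars R n)
      (tor R (MvPolynomial (Fin n) R) 𝕄 1 (ResidueField R)) ≤ (((ℓ + 1 : ℤ) : ℝ) : EReal) →
      (∀ i : ℕ, ℓ ≤ i → cohDeg (vars R n) w 𝓜 i μ = ⊥) → ∀ i : ℕ, ℓ ≤ i →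
        cohDeg (vars R n) w (tensorDeg (ResidueField R) 𝓜) i μ = ⊥ := by
    intro μ ℓ h hM i hi
    rw [hvank]
    exact G.van_residue_of_van hw h (fun i hi => (hvan i μ).1 (hM i hi)) hi
  have hconverse : ∀ μ ℓ : ℤ, cd (vars R n)
      (tor R (MvPolynomial (Fin n) R) 𝕄 1 (ResidueField R)) ≤ ((ℓ : ℝ) : EReal) →
      (∀ i : ℕ, ℓ ≤ i → cohDeg (vars R n) w (tensorDeg (ResidueField R) 𝓜) i μ = ⊥) →
      ∀ i : ℕ, ℓ ≤ i → cohDeg (vars R n) w 𝓜 i μ = ⊥ := by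
    intro μ ℓ h hk i hi
    rw [hvan]
    exact G.van_of_van_residue hw h (fun i hi => (hvank i μ).1 (hk i hi)) hi
  have hcd : ∀ {b c : ℤ}, b ≤ c → cd (vars R n)
      (tor R (MvPolynomial (Fin n) R) 𝕄 1 (ResidueField R)) ≤ ((b : ℝ) : EReal) →
      cd (vars R n) (tor R (MvPolynomial (Fin n) R) 𝕄 1 (ResidueField R)) ≤ ((c : ℝ) : EReal) :=
    fun hbc h => h.trans (coe_intCast_le.2 hbc)
  refine ⟨fun _ => ?_, hforward, fun μ ℓ h => ⟨hforward μ ℓ (hcd (by omega) h),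
    hconverse μ ℓ h⟩, fun h => ?_⟩
  · obtain ⟨t, ht, hta⟩ := exists_supportDim_residue hw G
    refine ⟨t, ht, ⟨comparison_bijective hw G ht, fun μ => ?_⟩, ⟨?_, fun i hi => ?_⟩, ?_, ?_⟩
    · rw [← hG]
      exact map_comparison hw G ht μ
    · rw [acyclic_iff, not_not] at hta
      exact hta
    · by_contra! hlt
      exact (acyclic_iff _).1 (acyclic_of_annihilator_le hw G le_rfl ht hlt) hi
    · have hiff : ∀ μ, cohDeg (vars R n) w 𝓜 t μ ≠ ⊥ ↔
          cohDeg (vars R n) w (tensorDeg (ResidueField R) 𝓜) t μ ≠ ⊥ := fun μ => by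
        rw [Ne, Ne, hvan, hvank]
        exact not_congr (van_iff_van_residue hw G ht μ)
      simp only [aInv, hiff]
    · rw [← hG]
      exact G.aInv_eq_intCast hw hta
  · have h1 : cd (vars R n) (tor R (MvPolynomial (Fin n) R) 𝕄 1 (ResidueField R)) ≤
        (((1 : ℤ) : ℝ) : EReal) := by simpa using h
    -- For `ℓ = i` the hypothesis `cd ≤ i + 1` holds for every `i ≥ 0`. A nonzero `H^i(M ⊗ k)_μ`
    -- thus forces some nonzero `H^k(𝕄)_μ` with `k ≥ i`, and `μ + i ≤ μ + k`.
    have hle : reg (vars R n) w (tensorDeg (ResidueField R) 𝓜) ≤ reg (vars R n) w 𝓜 := by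
      refine reg_le_reg fun i μ hμ => ?_
      by_contra! hM
      exact hμ (hforward μ i (hcd (by omega) h1)
        (fun k hk => hM k (by exact_mod_cast hk)) i le_rfl)
    refine ⟨hle, fun hdepth => le_antisymm hle (reg_le_reg fun i μ hμ => ?_)⟩
    -- Positive depth kills `H^0(𝕄)`, so only `ℓ = i ≥ 1` occurs, where `cd ≤ ℓ` holds and the
    -- converse implication is available.
    have hi : i ≠ 0 := by
      rintro rfl
      exact hμ ((hvan 0 μ).2 (CochainOp.van_of_acyclic _ (acyclic_zero_of_depth_pos hdepth)))
    by_contra! hM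
    exact hμ (hconverse μ i (hcd (by omega) h1)
      (fun k hk => hM k (by exact_mod_cast hk)) i le_rfl)

end
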